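/- **Theorem 1.3.** Let $n\ge 1$, let $B_n=\{z\in\mathbb{C}^n:|z|<1\}$ be the unit ball, where $|z|$ is the Euclidean norm, and let $$\tilde\Delta:=\sum_{j,k=1}^{n}\left(\delta_{jk}-|z|^2z_j\bar z_k\right)\frac{\partial^2}{\partial z_j\partial\bar z_k}.$$ Let $u:\overline{B_n}\to\mathbb{C}$ be a function that is of class $C^2$ (in the real sense) in $B_n$ and satisfies $\tilde\Delta u=0$ in $B_n$. Then the following two statements hold. (i) If $n$ is odd and $u\in C^{\frac{n+1}{2}}(\overline{B_n})$, then $u$ is pluriharmonic in $B_n$. (ii) If $n=2k$ is even and $u\in C^{k,\alpha}(\overline{B_n})$ for some $\alpha>1/2$, then $u$ is pluriharmonic in $B_n$. Here $C^{m}(\overline{B_n})$ is the space of functions that are $m$ times continuously differentiable in the real sense up to the boundary, $C^{k,\alpha}(\overline{B_n})$ is the space of those $u\in C^{k}(\overline{B_n})$ whose derivatives of order $k$ are Hölder continuous with exponent $\alpha$ on $\overline{B_n}$, and $u$ is pluriharmonic in $B_n$ if it is $C^2$ and $\partial^2u/\partial z_j\partial\bar z_k=0$ in $B_n$ for all $1\le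 j,k\le n$. -/

import Mathlib

open Metric
open scoped NNReal

/-- The Wirtinger derivative `∂u/∂z_j = (1/2) (∂u/∂x_j - i ∂u/∂y_j)`, with `z_j = x_j + i y_j`,
of a function on `ℂⁿ` at the point `z`. -/
noncomputable def dz {n : ℕ} (j : Fin n) (u : EuclideanSpace ℂ (Fin n) → ℂ)
    (z : EuclideanSpace ℂ (Fin n)) : ℂ :=
  (1 / 2 : ℂ) * (fderiv ℝ u z (EuclideanSpace.single j 1)
    - Complex.I * fderiv ℝ u z (EuclideanSpace.single j Complex.I))

/-- The Wirtinger derivative `∂u/∂z̄_k = (1/2) (∂u/∂x_k + i ∂u/∂y_k)`. -/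
noncomputable def dzbar {n : ℕ} (k : Fin n) (u : EuclideanSpace ℂ (Fin n) → ℂ)
    (z : EuclideanSpace ℂ (Fin n)) : ℂ :=
  (1 / 2 : ℂ) * (fderiv ℝ u z (EuclideanSpace.single k 1)
    + Complex.I * fderiv ℝ u z (EuclideanSpace.single k Complex.I))

/-- The modified operator `∑_{j,k} (δ_{jk} - |z|² z_j z̄_k) ∂²u/∂z_j∂z̄_k`, where `|z|` is the
Euclidean norm on `ℂⁿ`. -/
noncomputable def modLaplacian {n : ℕ} (u : EuclideanSpace ℂ (Fin n) → ℂ)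
    (z : EuclideanSpace ℂ (Fin n)) : ℂ :=
  ∑ j : Fin n, ∑ k : Fin n,
    ((if j = k then 1 else 0) - ((‖z‖ ^ 2 : ℝ) : ℂ) * z j * (starRingEnd ℂ) (z k))
      * dz j (dzbar k u) z

/-- `u` is pluriharmonic on the (open) set `s`: it is `C²` there and `∂²u/∂z_j∂z̄_k = 0` on `s`
for all `j`, `k`. -/
def IsPluriharmonicOn {n : ℕ} (u : EuclideanSpace ℂ (Fin n) → ℂ)
    (s : Set (EuclideanSpace ℂ (Fin n))) : Prop :=
  ContDiffOn ℝ 2 u s ∧ ∀ z ∈ s, ∀ j k : Fin n, dz j (dzbar k u) z = 0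

/-- The class `C^{k,α}` on the closed unit ball of `ℂⁿ`: `u` is (real) `C^k` up to the boundary
and its derivative of order `k` is Hölder continuous with exponent `α` on the closed ball.
On a closed ball, the derivatives `iteratedFDerivWithin` are the continuous extensions to the
boundary of the derivatives in the interior. -/
def IsHolderClass {n : ℕ} (k : ℕ) (α : ℝ≥0) (u : EuclideanSpace ℂ (Fin n) → ℂ) : Prop :=
  ContDiffOn ℝ k u (closedBall 0 1) ∧
    ∃ C : ℝ≥0, HolderOnWith C α (iteratedFDerivWithin ℝ k u (closedBall 0 1)) (closedBall 0 1)

/-!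
A solution `u` is expanded on the spheres `|z| = ρ` in bihomogeneous harmonic polynomials. The
operator commutes with unitary maps, so for `h` harmonic of bidegree `(p, q)` the moment
`F(ρ) = ∫ u(ρζ) h(ζ) dσ(ζ)` satisfies an ordinary differential equation. In the variable `t = ρ⁴`, which is
what the factor `|z|²` in the operator calls for, `f(t) = t ^ (-(p + q) / 4) F(t ^ (1/4))` solves
the hypergeometric equation with `a = p / 2`, `b = q / 2` and `c = (n + p + q + 1) / 2`
(`hypergeom_radialProfile`). Boundedness of `u` excludes the singular behaviour `t ^ (1 - c)` at
`0`.

If `p, q ≥ 1`, energy monotonicity shows that the flux `t ^ c (1 - t) ^ (a + b - c + 1) f'` of a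
nonzero real solution stays away from `0` near `t = 1`. All derivatives of `f` solve equations of
the same kind, with shifted parameters, so `|f⁽ᵐ⁺¹⁾| ≥ ε (1 - t) ^ (γ - 1)` with
`γ = c - a - b - m = (n + 1) / 2 - m`. The regularity assumed of `u` says that `f⁽ᵐ⁾` is continuous up to `t = 1`
when `n = 2m - 1` (`γ = 0`), or Hölder continuous of exponent larger than `1 / 2` when `n = 2m`
(`γ = 1 / 2`), and both contradict this bound: see `IsHypergeomSol.eq_zero_of_isLittleO` and
`moment_eq_zero`. If `p = 0` or `q = 0`, then `f` is constant (`moment_eq_mul_pow`).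

To conclude that `∂²u/∂z_j∂z̄_k = 0` without summing series, fix the value of `p - q`. Exactly one
bidegree with this value has a zero entry, and a polynomial `U` of the conjugate bidegree, thus
holomorphic or antiholomorphic, has the same moments as `u` against it, by Riesz representation in
finite dimension. By the Fischer decomposition (`fischer_induction`), `u` and `U` have the same
moments against all polynomials with this value of `p - q` (`exists_pluriharmonic_correction`).
Since `∂²/∂z_j∂z̄_k` preserves `p - q`, integration by parts against test functions `χ(|z|⁴) P`
shows that `∂²u/∂z_j∂z̄_k` and `∂²U/∂z_j∂z̄_k = 0` have the same integrals against all of these,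
and polynomials in `z` and `z̄` are dense by the Stone–Weierstrass theorem.

The case `n = 1` is immediate, the operator being then `(1 - |z|⁴) ∂²/∂z∂z̄`.
-/

open MeasureTheory MvPolynomial Set Filter Topology
open scoped ContDiff ComplexConjugate

/-! ### Wirtinger calculus -/

section Wirtinger

variable {n : ℕ} {u v : EuclideanSpace ℂ (Fin n) → ℂ} {z : EuclideanSpace ℂ (Fin n)}

lemma dz_add (j : Fin n) (hu : DifferentiableAt ℝ u z) (hv : DifferentiableAt ℝ v z) :
    dz j (fun x => u x + v x) z = dz j u z + dz j v z := by
  simp only [dz, fderiv_fun_add hu hv, add_apply]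
  ring

lemma dzbar_add (j : Fin n) (hu : DifferentiableAt ℝ u z) (hv : DifferentiableAt ℝ v z) :
    dzbar j (fun x => u x + v x) z = dzbar j u z + dzbar j v z := by
  simp only [dzbar, fderiv_fun_add hu hv, add_apply]
  ring

lemma dz_mul (j : Fin n) (hu : DifferentiableAt ℝ u z) (hv : DifferentiableAt ℝ v z) :
    dz j (fun x => u x * v x) z = dz j u z * v z + u z * dz j v z := by
  simp only [dz, fderiv_fun_mul hu hv, add_apply, smul_apply, smul_eq_mul]
  ring

lemma dzbar_mul (j : Fin n) (hu : DifferentiableAt ℝ u z) (hv : DifferentiableAt ℝ v z) :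
    dzbar j (fun x => u x * v x) z = dzbar j u z * v z + u z * dzbar j v z := by
  simp only [dzbar, fderiv_fun_mul hu hv, add_apply, smul_apply, smul_eq_mul]
  ring

lemma dz_const (j : Fin n) (c : ℂ) : dz j (fun _ => c) z = 0 := by
  simp [dz]

lemma dzbar_const (j : Fin n) (c : ℂ) : dzbar j (fun _ => c) z = 0 := by
  simp [dzbar]

lemma dz_congr (j : Fin n) (h : u =ᶠ[𝓝 z] v) : dz j u z = dz j v z := by
  simp only [dz, h.fderiv_eq]

/-- The `i`-th coordinate as a real-linear functional. -/
noncomputable def coordCLM (n : ℕ) (i : Fin n) : EuclideanSpace ℂ (Fin n) →L[ℝ] ℂ :=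
  (EuclideanSpace.proj i : EuclideanSpace ℂ (Fin n) →L[ℂ] ℂ).restrictScalars ℝ

lemma hasFDerivAt_coord (i : Fin n) :
    HasFDerivAt (fun x : EuclideanSpace ℂ (Fin n) => x i) (coordCLM n i) z :=
  (coordCLM n i).hasFDerivAt

lemma hasFDerivAt_conj_coord (i : Fin n) :
    HasFDerivAt (fun x : EuclideanSpace ℂ (Fin n) => conj (x i))
      ((Complex.conjCLE : ℂ →L[ℝ] ℂ).comp (coordCLM n i)) z :=
  ((Complex.conjCLE : ℂ →L[ℝ] ℂ).comp (coordCLM n i)).hasFDerivAt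

lemma dz_coord (j i : Fin n) : dz j (fun x => x i) z = if i = j then 1 else 0 := by
  rw [dz, (hasFDerivAt_coord i).fderiv]
  by_cases h : i = j
  · subst h; simp [coordCLM]; norm_num
  · simp [coordCLM, h]

lemma dzbar_coord (j i : Fin n) : dzbar j (fun x => x i) z = 0 := by
  rw [dzbar, (hasFDerivAt_coord i).fderiv]
  by_cases h : i = j
  · subst h; simp [coordCLM]
  · simp [coordCLM, h]

lemma dz_conj_coord (j i : Fin n) : dz j (fun x => conj (x i)) z = 0 := by
  rw [dz, (hasFDerivAt_conj_coord i).fderiv]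
  by_cases h : i = j
  · subst h; simp [coordCLM]
  · simp [coordCLM, h]

lemma dzbar_conj_coord (j i : Fin n) :
    dzbar j (fun x => conj (x i)) z = if i = j then 1 else 0 := by
  rw [dzbar, (hasFDerivAt_conj_coord i).fderiv]
  by_cases h : i = j
  · subst h; simp [coordCLM]; norm_num
  · simp [coordCLM, h]

end Wirtinger

/-! ### Polynomials in `z` and `z̄` -/

/-- Polynomials in `z₁, …, zₙ, z̄₁, …, z̄ₙ`; the variable `z_j` is `X (.inl j)` and `z̄_j` is
`X (.inr j)`. -/
abbrev ZPoly (n : ℕ) := MvPolynomial (Fin n ⊕ Fin n) ℂ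

/-- The value at `z` of a polynomial in `z` and `z̄`. -/
noncomputable def ev {n : ℕ} (P : ZPoly n) (z : EuclideanSpace ℂ (Fin n)) : ℂ :=
  MvPolynomial.eval (Sum.elim (fun j => z j) (fun j => conj (z j))) P

section ev

variable {n : ℕ} (P Q : ZPoly n) (z : EuclideanSpace ℂ (Fin n))

@[simp] lemma ev_add : ev (P + Q) z = ev P z + ev Q z := by simp [ev]
@[simp] lemma ev_mul : ev (P * Q) z = ev P z * ev Q z := by simp [ev]
@[simp] lemma ev_C (c : ℂ) : ev (C c : ZPoly n) z = c := by simp [ev]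
@[simp] lemma ev_smul (c : ℂ) : ev (c • P) z = c * ev P z := by simp [ev]
@[simp] lemma ev_zero : ev (0 : ZPoly n) z = 0 := by simp [ev]
@[simp] lemma ev_one : ev (1 : ZPoly n) z = 1 := by simp [ev]
@[simp] lemma ev_natCast (k : ℕ) : ev (k : ZPoly n) z = k := by simp [ev]
@[simp] lemma ev_inl (j : Fin n) : ev (X (.inl j)) z = z j := by simp [ev]
@[simp] lemma ev_inr (j : Fin n) : ev (X (.inr j)) z = conj (z j) := by simp [ev]
@[simp] lemma ev_sum {ι : Type*} (s : Finset ι) (f : ι → ZPoly n) :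
    ev (∑ i ∈ s, f i) z = ∑ i ∈ s, ev (f i) z := by simp [ev]

lemma contDiff_ev : ContDiff ℝ ∞ (ev P) := by
  induction P using MvPolynomial.induction_on with
  | C a =>
    have : ev (C a : ZPoly n) = fun _ => a := by ext; simp
    rw [this]; exact contDiff_const
  | add p q hp hq =>
    have : ev (p + q) = fun x => ev p x + ev q x := by ext; simp
    rw [this]; exact hp.add hq
  | mul_X p i hp =>
    cases i with
    | inl i =>
      have : ev (p * X (.inl i)) = fun x => ev p x * coordCLM n i x := by ext; simp [coordCLM]
      rw [this]; exact hp.mul (coordCLM n i).contDiff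
    | inr i =>
      have : ev (p * X (.inr i)) =
          fun x => ev p x * ((Complex.conjCLE : ℂ →L[ℝ] ℂ).comp (coordCLM n i)) x := by
        ext; simp [coordCLM]
      rw [this]; exact hp.mul (ContinuousLinearMap.contDiff _)

lemma continuous_ev : Continuous (ev P) := (contDiff_ev P).continuous

lemma differentiableAt_ev : DifferentiableAt ℝ (ev P) z :=
  (contDiff_ev P).differentiable (by simp) z

lemma dz_ev (j : Fin n) : dz j (ev P) z = ev (pderiv (.inl j) P) z := by
  induction P using MvPolynomial.induction_on with
  | C a =>
    have : ev (C a : ZPoly n) = fun _ => a := by ext; simp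
    rw [this, dz_const]; simp
  | add p q hp hq =>
    have : ev (p + q) = fun x => ev p x + ev q x := by ext; simp
    rw [this, dz_add j (differentiableAt_ev p z) (differentiableAt_ev q z), hp, hq]
    simp
  | mul_X p i hp =>
    have : ev (p * X i) = fun x => ev p x * ev (X i) x := by ext; simp
    rw [this, dz_mul j (differentiableAt_ev p z) (differentiableAt_ev _ z), hp]
    have h2 : dz j (ev (X i)) z = ev (pderiv (.inl j) (X i)) z := by
      cases i with
      | inl i =>
        have : ev (X (.inl i)) = fun x : EuclideanSpace ℂ (Fin n) => x i := by ext; simp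
        rw [this, dz_coord, pderiv_X, Pi.single_apply]
        by_cases h : j = i
        · simp [h]
        · simp [Ne.symm h]
      | inr i =>
        have : ev (X (.inr i)) = fun x : EuclideanSpace ℂ (Fin n) => conj (x i) := by ext; simp
        rw [this, dz_conj_coord, pderiv_X, Pi.single_apply]
        simp
    rw [h2, Derivation.leibniz]
    simp only [smul_eq_mul, ev_add, ev_mul]
    ring

lemma dzbar_ev (j : Fin n) : dzbar j (ev P) z = ev (pderiv (.inr j) P) z := by
  induction P using MvPolynomial.induction_on with
  | C a =>
    have : ev (C a : ZPoly n) = fun _ => a := by ext; simp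
    rw [this, dzbar_const]; simp
  | add p q hp hq =>
    have : ev (p + q) = fun x => ev p x + ev q x := by ext; simp
    rw [this, dzbar_add j (differentiableAt_ev p z) (differentiableAt_ev q z), hp, hq]
    simp
  | mul_X p i hp =>
    have : ev (p * X i) = fun x => ev p x * ev (X i) x := by ext; simp
    rw [this, dzbar_mul j (differentiableAt_ev p z) (differentiableAt_ev _ z), hp]
    have h2 : dzbar j (ev (X i)) z = ev (pderiv (.inr j) (X i)) z := by
      cases i with
      | inl i =>
        have : ev (X (.inl i)) = fun x : EuclideanSpace ℂ (Fin n) => x i := by ext; simp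
        rw [this, dzbar_coord, pderiv_X, Pi.single_apply]
        simp
      | inr i =>
        have : ev (X (.inr i)) = fun x : EuclideanSpace ℂ (Fin n) => conj (x i) := by ext; simp
        rw [this, dzbar_conj_coord, pderiv_X, Pi.single_apply]
        by_cases h : j = i
        · simp [h]
        · simp [Ne.symm h]
    rw [h2, Derivation.leibniz]
    simp only [smul_eq_mul, ev_add, ev_mul]
    ring

end ev

/-- The polynomial `|z|² = ∑ z_j z̄_j`. -/
noncomputable def normSqPoly (n : ℕ) : ZPoly n := ∑ j, X (.inl j) * X (.inr j)

lemma ev_normSqPoly {n : ℕ} (z : EuclideanSpace ℂ (Fin n)) :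
    ev (normSqPoly n) z = ((‖z‖ ^ 2 : ℝ) : ℂ) := by
  rw [EuclideanSpace.norm_sq_eq]
  simp [normSqPoly, Complex.mul_conj, Complex.normSq_eq_norm_sq]

/-- The bidegree of a variable: `z_j` has bidegree `(1, 0)` and `z̄_j` has bidegree `(0, 1)`. -/
def biweight (n : ℕ) : Fin n ⊕ Fin n → ℕ × ℕ := Sum.elim (fun _ => (1, 0)) (fun _ => (0, 1))

/-- Polynomials bihomogeneous of bidegree `(p, q)`: degree `p` in `z`, degree `q` in `z̄`. -/
def IsBihom {n : ℕ} (p q : ℕ) (P : ZPoly n) : Prop :=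
  IsWeightedHomogeneous (biweight n) P (p, q)

/-- The complex Laplacian `∑ ∂²/∂z_j∂z̄_j` on polynomials. -/
noncomputable def polyLaplacian {n : ℕ} (P : ZPoly n) : ZPoly n :=
  ∑ j, pderiv (.inl j) (pderiv (.inr j) P)

namespace IsBihom

variable {n p q p' q' : ℕ} {P Q : ZPoly n}

lemma sub (hP : IsBihom p q P) (hQ : IsBihom p q Q) : IsBihom p q (P - Q) :=
  IsWeightedHomogeneous.sub hP hQ

lemma smul (hP : IsBihom p q P) (c : ℂ) : IsBihom p q (c • P) :=
  (weightedHomogeneousSubmodule ℂ (biweight n) (p, q)).smul_mem c hP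

lemma mul (hP : IsBihom p q P) (hQ : IsBihom p' q' Q) : IsBihom (p + p') (q + q') (P * Q) :=
  IsWeightedHomogeneous.mul hP hQ

lemma zero : IsBihom p q (0 : ZPoly n) := isWeightedHomogeneous_zero _ _ _

lemma sum {ι : Type*} (s : Finset ι) (f : ι → ZPoly n) (h : ∀ i ∈ s, IsBihom p q (f i)) :
    IsBihom p q (∑ i ∈ s, f i) := IsWeightedHomogeneous.sum s f _ h

lemma X_inl (j : Fin n) : IsBihom 1 0 (X (.inl j) : ZPoly n) := isWeightedHomogeneous_X _ _ _

lemma X_inr (j : Fin n) : IsBihom 0 1 (X (.inr j) : ZPoly n) := isWeightedHomogeneous_X _ _ _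

lemma normSqPoly : IsBihom 1 1 (normSqPoly n) :=
  sum _ _ fun j _ => (X_inl j).mul (X_inr j)

lemma normSq_mul (hP : IsBihom p q P) : IsBihom (p + 1) (q + 1) (_root_.normSqPoly n * P) := by
  rw [add_comm p, add_comm q]; exact normSqPoly.mul hP

lemma inl_mul (hP : IsBihom p q P) (j : Fin n) : IsBihom (p + 1) q (X (.inl j) * P) := by
  have := (X_inl j).mul hP
  rwa [add_comm 1 p, zero_add] at this

lemma inr_mul (hP : IsBihom p q P) (j : Fin n) : IsBihom p (q + 1) (X (.inr j) * P) := by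
  have := (X_inr j).mul hP
  rwa [add_comm 1 q, zero_add] at this

lemma pderiv_inl (hP : IsBihom (p + 1) q P) (j : Fin n) : IsBihom p q (pderiv (.inl j) P) :=
  IsWeightedHomogeneous.pderiv hP (by simp [biweight])

lemma pderiv_inr (hP : IsBihom p (q + 1) P) (j : Fin n) : IsBihom p q (pderiv (.inr j) P) :=
  IsWeightedHomogeneous.pderiv hP (by simp [biweight])

lemma weight_fst (d : (Fin n ⊕ Fin n) →₀ ℕ) :
    (Finsupp.weight (biweight n) d).1 = Finsupp.weight (Prod.fst ∘ biweight n) d := by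
  simp [Finsupp.weight_apply, Finsupp.sum, Prod.fst_sum]

lemma weight_snd (d : (Fin n ⊕ Fin n) →₀ ℕ) :
    (Finsupp.weight (biweight n) d).2 = Finsupp.weight (Prod.snd ∘ biweight n) d := by
  simp [Finsupp.weight_apply, Finsupp.sum, Prod.snd_sum]

/-- Euler's identity in `z`. -/
lemma euler_inl (hP : IsBihom p q P) : ∑ j, X (.inl j) * pderiv (.inl j) P = (p : ℂ) • P := by
  have h : IsWeightedHomogeneous (Prod.fst ∘ biweight n) P p := by
    intro d hd
    rw [← weight_fst, hP hd]
  have := h.sum_weight_X_mul_pderiv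
  simpa [biweight, Fintype.sum_sum_type, ← Nat.cast_smul_eq_nsmul ℂ] using this

/-- Euler's identity in `z̄`. -/
lemma euler_inr (hP : IsBihom p q P) : ∑ j, X (.inr j) * pderiv (.inr j) P = (q : ℂ) • P := by
  have h : IsWeightedHomogeneous (Prod.snd ∘ biweight n) P q := by
    intro d hd
    rw [← weight_snd, hP hd]
  have := h.sum_weight_X_mul_pderiv
  simpa [biweight, Fintype.sum_sum_type, ← Nat.cast_smul_eq_nsmul ℂ] using this

lemma pderiv_inl_eq_zero (hP : IsBihom 0 q P) (j : Fin n) : pderiv (.inl j) P = 0 := by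
  by_contra h
  obtain ⟨d, hd⟩ := MvPolynomial.ne_zero_iff.mp h
  rw [coeff_pderiv] at hd
  have h1 := congrArg Prod.fst (hP (left_ne_zero_of_mul hd))
  rw [map_add] at h1
  simp [biweight, Finsupp.weight_single] at h1

lemma pderiv_inr_eq_zero (hP : IsBihom p 0 P) (j : Fin n) : pderiv (.inr j) P = 0 := by
  by_contra h
  obtain ⟨d, hd⟩ := MvPolynomial.ne_zero_iff.mp h
  rw [coeff_pderiv] at hd
  have h1 := congrArg Prod.snd (hP (left_ne_zero_of_mul hd))
  rw [map_add] at h1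
  simp [biweight, Finsupp.weight_single] at h1

lemma polyLaplacian (hP : IsBihom (p + 1) (q + 1) P) : IsBihom p q (_root_.polyLaplacian P) :=
  sum _ _ fun j _ => (hP.pderiv_inr j).pderiv_inl j

end IsBihom

lemma pderiv_pderiv_comm {σ : Type*} (i j : σ) (P : MvPolynomial σ ℂ) :
    pderiv i (pderiv j P) = pderiv j (pderiv i P) := by
  classical
  have h : ⁅pderiv (R := ℂ) i, pderiv j⁆ = 0 := MvPolynomial.derivation_ext fun k => by
    rw [Derivation.commutator_apply, pderiv_X, pderiv_X, Pi.single_apply, Pi.single_apply]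
    split_ifs <;> simp
  have := DFunLike.congr_fun h P
  rwa [Derivation.commutator_apply, Derivation.zero_apply, sub_eq_zero] at this

lemma polyLaplacian_sub {n : ℕ} (P Q : ZPoly n) :
    polyLaplacian (P - Q) = polyLaplacian P - polyLaplacian Q := by
  simp [polyLaplacian, Finset.sum_sub_distrib]

lemma polyLaplacian_smul {n : ℕ} (c : ℂ) (P : ZPoly n) :
    polyLaplacian (c • P) = c • polyLaplacian P := by
  simp [polyLaplacian, Finset.smul_sum]

lemma pderiv_inl_normSqPoly {n : ℕ} (j : Fin n) : pderiv (.inl j) (normSqPoly n) = X (.inr j) := by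
  simp [normSqPoly, pderiv_X, Pi.single_apply]

lemma pderiv_inr_normSqPoly {n : ℕ} (j : Fin n) : pderiv (.inr j) (normSqPoly n) = X (.inl j) := by
  simp [normSqPoly, pderiv_X, Pi.single_apply]

/-- `Δ(|z|² Q) = |z|² Δ Q + (n + p + q) Q` for `Q` of bidegree `(p, q)`. -/
lemma polyLaplacian_normSq_mul {n p q : ℕ} {Q : ZPoly n} (hQ : IsBihom p q Q) :
    polyLaplacian (normSqPoly n * Q) =
      normSqPoly n * polyLaplacian Q + ((n + p + q : ℕ) : ℂ) • Q := by
  have : ∀ j : Fin n, pderiv (.inl j) (pderiv (.inr j) (normSqPoly n * Q)) =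
      normSqPoly n * pderiv (.inl j) (pderiv (.inr j) Q) + (X (.inr j) * pderiv (.inr j) Q) +
        (X (.inl j) * pderiv (.inl j) Q) + Q := by
    intro j
    simp only [Derivation.leibniz, pderiv_inr_normSqPoly, map_add, smul_eq_mul,
      pderiv_inl_normSqPoly, pderiv_X_self]
    ring
  simp only [polyLaplacian, this, Finset.sum_add_distrib, ← Finset.mul_sum, hQ.euler_inl,
    hQ.euler_inr]
  simp [← Nat.cast_smul_eq_nsmul ℂ, add_smul]
  abel

/-- The operator `|z|² Δ + κ` is surjective on each bidegree when `κ > 0`. Applying `Δ` to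
`|z|² Δ Q + κ Q = T` gives an equation of the same kind for `Δ Q`, in a lower bidegree. -/
lemma fischer_solve {n p₀ q₀ : ℕ} (h0 : p₀ = 0 ∨ q₀ = 0) (hn : 1 ≤ n) (i : ℕ) :
    ∀ κ : ℕ, 0 < κ → ∀ T : ZPoly n, IsBihom (p₀ + i) (q₀ + i) T → ∃ Q : ZPoly n,
      IsBihom (p₀ + i) (q₀ + i) Q ∧ normSqPoly n * polyLaplacian Q + (κ : ℂ) • Q = T := by
  induction i with
  | zero =>
    intro κ hκ T hT
    have hz : ∀ Q : ZPoly n, IsBihom p₀ q₀ Q → polyLaplacian Q = 0 := by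
      intro Q hQ
      refine Finset.sum_eq_zero fun j _ => ?_
      rcases h0 with rfl | rfl
      · cases q₀ with
        | zero => rw [hQ.pderiv_inr_eq_zero, map_zero]
        | succ q => exact (hQ.pderiv_inr j).pderiv_inl_eq_zero j
      · rw [hQ.pderiv_inr_eq_zero, map_zero]
    refine ⟨(κ : ℂ)⁻¹ • T, hT.smul _, ?_⟩
    have : (κ : ℂ) ≠ 0 := by exact_mod_cast hκ.ne'
    rw [hz _ (hT.smul _), mul_zero, zero_add, smul_smul, mul_inv_cancel₀ this, one_smul]
  | succ i ih =>
    intro κ hκ T hT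
    obtain ⟨Y, hY, hYe⟩ := ih (κ + (n + (p₀ + i) + (q₀ + i))) (by omega) _
      (IsBihom.polyLaplacian (p := p₀ + i) (q := q₀ + i) hT)
    have hk : (κ : ℂ) ≠ 0 := by exact_mod_cast hκ.ne'
    refine ⟨(κ : ℂ)⁻¹ • (T - normSqPoly n * Y), (hT.sub hY.normSq_mul).smul _, ?_⟩
    have : polyLaplacian ((κ : ℂ)⁻¹ • (T - normSqPoly n * Y)) = Y := by
      rw [polyLaplacian_smul, polyLaplacian_sub, polyLaplacian_normSq_mul hY, ← hYe]
      rw [Nat.cast_add κ, add_smul]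
      rw [show ∀ a b c : ZPoly n, a + (b + c) - (a + c) = b from fun a b c => by ring]
      rw [smul_smul, inv_mul_cancel₀ hk, one_smul]
    rw [this, smul_smul, mul_inv_cancel₀ hk, one_smul]
    ring

/-- The Fischer decomposition as an induction principle. On polynomials of the bidegrees
`(p₀ + i, q₀ + i)` with `p₀ = 0` or `q₀ = 0`, a linear condition that is stable under
multiplication by `|z|²` holds as soon as it holds for harmonic polynomials. -/
lemma fischer_induction {n p₀ q₀ : ℕ} (h0 : p₀ = 0 ∨ q₀ = 0) (hn : 1 ≤ n) (V : ZPoly n → Prop)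
    (hadd : ∀ P Q, V P → V Q → V (P + Q)) (hmul : ∀ P, V P → V (normSqPoly n * P))
    (hharm : ∀ i h, IsBihom (p₀ + i) (q₀ + i) h → polyLaplacian h = 0 → V h) (i : ℕ) :
    ∀ P : ZPoly n, IsBihom (p₀ + i) (q₀ + i) P → V P := by
  induction i with
  | zero =>
    intro P hP
    refine hharm 0 P hP (Finset.sum_eq_zero fun j _ => ?_)
    simp only [add_zero] at hP
    rcases h0 with rfl | rfl
    · cases q₀ with
      | zero => rw [hP.pderiv_inr_eq_zero, map_zero]
      | succ q => exact (hP.pderiv_inr j).pderiv_inl_eq_zero j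
    · rw [hP.pderiv_inr_eq_zero, map_zero]
  | succ i ih =>
    intro P hP
    obtain ⟨Y, hY, hYe⟩ := fischer_solve h0 hn i (n + (p₀ + i) + (q₀ + i)) (by omega) _
      (IsBihom.polyLaplacian (p := p₀ + i) (q := q₀ + i) hP)
    have : P = (P - normSqPoly n * Y) + normSqPoly n * Y := by ring
    rw [this]
    refine hadd _ _ (hharm (i + 1) _ (hP.sub hY.normSq_mul) ?_) (hmul _ (ih Y hY))
    rw [polyLaplacian_sub, polyLaplacian_normSq_mul hY, hYe, sub_self]

/-! ### Radial test functions -/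

/-- Smooth functions on `ℝ` whose support lies in a compact subinterval of `(0, 1)`. -/
structure IsRadialTest (χ : ℝ → ℝ) : Prop where
  smooth : ContDiff ℝ ∞ χ
  supp : ∃ a b, 0 < a ∧ a < b ∧ b < 1 ∧ ∀ t, χ t ≠ 0 → t ∈ Icc a b

namespace IsRadialTest

variable {χ η : ℝ → ℝ}

lemma deriv_eq_zero {a b : ℝ} (h : ∀ t, χ t ≠ 0 → t ∈ Icc a b) (t : ℝ) (ht : deriv χ t ≠ 0) :
    t ∈ Icc a b := by
  by_contra hc
  have : (Icc a b)ᶜ ∈ 𝓝 t := isClosed_Icc.isOpen_compl.mem_nhds hc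
  have h0 : χ =ᶠ[𝓝 t] fun _ => 0 := by
    filter_upwards [this] with x hx
    by_contra h1
    exact hx (h x h1)
  exact ht (by rw [h0.deriv_eq]; simp)

lemma deriv (h : IsRadialTest χ) : IsRadialTest (deriv χ) := by
  obtain ⟨a, b, ha, hab, hb, hs⟩ := h.supp
  exact ⟨h.smooth.iterate_deriv 1, a, b, ha, hab, hb, deriv_eq_zero hs⟩

lemma mul_left (h : IsRadialTest χ) (hη : ContDiff ℝ ∞ η) : IsRadialTest (fun t => η t * χ t) := by
  obtain ⟨a, b, ha, hab, hb, hs⟩ := h.supp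
  exact ⟨hη.mul h.smooth, a, b, ha, hab, hb, fun t ht => hs t (right_ne_zero_of_mul ht)⟩

lemma add (h : IsRadialTest χ) (h' : IsRadialTest η) : IsRadialTest (fun t => χ t + η t) := by
  obtain ⟨a, b, ha, hab, hb, hs⟩ := h.supp
  obtain ⟨a', b', ha', hab', hb', hs'⟩ := h'.supp
  refine ⟨h.smooth.add h'.smooth, min a a', max b b', lt_min ha ha', by
    exact (min_le_left _ _).trans_lt (hab.trans_le (le_max_left _ _)), max_lt hb hb',
    fun t ht => ?_⟩
  by_cases h0 : χ t = 0
  · have := hs' t (by intro h1; exact ht (by simp [h0, h1]))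
    exact ⟨(min_le_right _ _).trans this.1, this.2.trans (le_max_right _ _)⟩
  · have := hs t h0
    exact ⟨(min_le_left _ _).trans this.1, this.2.trans (le_max_left _ _)⟩

lemma differentiable (h : IsRadialTest χ) : Differentiable ℝ χ := h.smooth.differentiable (by simp)

end IsRadialTest

/-- The function `χ(|z|⁴) P(z, z̄)`. The fourth power of the norm is the variable in which the
radial equation becomes hypergeometric. -/
noncomputable def radialMul {n : ℕ} (χ : ℝ → ℝ) (P : ZPoly n) (z : EuclideanSpace ℂ (Fin n)) : ℂ :=
  (χ (‖z‖ ^ 4) : ℂ) * ev P z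

section radialMul

variable {n : ℕ} {χ η : ℝ → ℝ}

lemma hasFDerivAt_radial (hχ : Differentiable ℝ χ) (z : EuclideanSpace ℂ (Fin n)) :
    DifferentiableAt ℝ (fun x : EuclideanSpace ℂ (Fin n) => (χ (‖x‖ ^ 4) : ℂ)) z ∧
    ∀ y, fderiv ℝ (fun x : EuclideanSpace ℂ (Fin n) => (χ (‖x‖ ^ 4) : ℂ)) z y =
      ((deriv χ (‖z‖ ^ 4) * (2 * ‖z‖ ^ 2 * (2 * (inner ℂ z y : ℂ).re)) : ℝ) : ℂ) := by
  have h1 : HasFDerivAt (fun x : EuclideanSpace ℂ (Fin n) => ‖x‖ ^ 2)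
      (2 • (innerSL ℝ z)) z := (hasStrictFDerivAt_norm_sq z).hasFDerivAt
  have h2 := (h1.pow 2)
  have h2' : HasFDerivAt (fun x : EuclideanSpace ℂ (Fin n) => ‖x‖ ^ 4)
      ((2 • (‖z‖ ^ 2) ^ (2 - 1)) • 2 • (innerSL ℝ z)) z := by
    refine h2.congr_of_eventuallyEq (Eventually.of_forall fun x => ?_)
    ring
  have h3 := ((hχ (‖z‖ ^ 4)).hasDerivAt.comp_hasFDerivAt z h2')
  have h4 := (Complex.ofRealCLM.hasFDerivAt (x := χ (‖z‖ ^ 4))).comp z h3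
  refine ⟨h4.differentiableAt, fun y => ?_⟩
  have h5 : (fun x : EuclideanSpace ℂ (Fin n) => (χ (‖x‖ ^ 4) : ℂ)) =
    (Complex.ofRealCLM ∘ χ ∘ fun x : EuclideanSpace ℂ (Fin n) => ‖x‖ ^ 4) := rfl
  rw [h5, h4.fderiv]
  have h6 : (inner ℝ z y : ℝ) = (inner ℂ z y : ℂ).re := by
    simp [PiLp.inner_apply]
  simp [h6]

lemma dz_radial (hχ : Differentiable ℝ χ) (j : Fin n) (z : EuclideanSpace ℂ (Fin n)) :
    dz j (fun x : EuclideanSpace ℂ (Fin n) => (χ (‖x‖ ^ 4) : ℂ)) z =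
      2 * ((deriv χ (‖z‖ ^ 4) : ℝ) : ℂ) * ((‖z‖ ^ 2 : ℝ) : ℂ) * conj (z j) := by
  rw [dz, (hasFDerivAt_radial hχ z).2, (hasFDerivAt_radial hχ z).2]
  rw [EuclideanSpace.inner_single_right, EuclideanSpace.inner_single_right]
  apply Complex.ext <;> simp [pow_two] <;> ring

lemma dzbar_radial (hχ : Differentiable ℝ χ) (j : Fin n) (z : EuclideanSpace ℂ (Fin n)) :
    dzbar j (fun x : EuclideanSpace ℂ (Fin n) => (χ (‖x‖ ^ 4) : ℂ)) z =
      2 * ((deriv χ (‖z‖ ^ 4) : ℝ) : ℂ) * ((‖z‖ ^ 2 : ℝ) : ℂ) * z j := by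
  rw [dzbar, (hasFDerivAt_radial hχ z).2, (hasFDerivAt_radial hχ z).2]
  rw [EuclideanSpace.inner_single_right, EuclideanSpace.inner_single_right]
  apply Complex.ext <;> simp [pow_two] <;> ring

lemma differentiable_radialMul (hχ : Differentiable ℝ χ) (P : ZPoly n) :
    Differentiable ℝ (radialMul χ P) :=
  fun z => (hasFDerivAt_radial hχ z).1.mul (differentiableAt_ev P z)

lemma dz_radialMul (hχ : Differentiable ℝ χ) (P : ZPoly n) (j : Fin n) :
    dz j (radialMul χ P) = fun z => 2 * radialMul (deriv χ) (normSqPoly n * (X (.inr j) * P)) z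
      + radialMul χ (pderiv (.inl j) P) z := by
  ext z
  have h : radialMul χ P = fun x => (χ (‖x‖ ^ 4) : ℂ) * ev P x := rfl
  rw [h, dz_mul j (hasFDerivAt_radial hχ z).1 (differentiableAt_ev P z), dz_radial hχ, dz_ev]
  simp only [radialMul, ev_mul, ev_inr, ev_normSqPoly]
  ring

lemma dzbar_radialMul (hχ : Differentiable ℝ χ) (P : ZPoly n) (j : Fin n) :
    dzbar j (radialMul χ P) = fun z => 2 * radialMul (deriv χ) (normSqPoly n * (X (.inl j) * P)) z
      + radialMul χ (pderiv (.inr j) P) z := by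
  ext z
  have h : radialMul χ P = fun x => (χ (‖x‖ ^ 4) : ℂ) * ev P x := rfl
  rw [h, dzbar_mul j (hasFDerivAt_radial hχ z).1 (differentiableAt_ev P z), dzbar_radial hχ,
    dzbar_ev]
  simp only [radialMul, ev_mul, ev_inl, ev_normSqPoly]
  ring

/-- `2 t χ' + c χ`: the effect on the radial factor of `∑ ∂_j z_j`. -/
noncomputable def eulerOp (c : ℝ) (χ : ℝ → ℝ) (t : ℝ) : ℝ := 2 * t * deriv χ t + c * χ t

lemma IsRadialTest.eulerOp (h : IsRadialTest χ) (c : ℝ) : IsRadialTest (eulerOp c χ) :=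
  (h.deriv.mul_left (η := fun t => 2 * t) (by fun_prop)).add
    (h.mul_left (η := fun _ => c) (by fun_prop))

lemma sum_dz_inl_radialMul (hχ : Differentiable ℝ χ) {p q : ℕ} {Q : ZPoly n} (hQ : IsBihom p q Q)
    (z : EuclideanSpace ℂ (Fin n)) :
    ∑ j, dz j (radialMul χ (X (.inl j) * Q)) z = radialMul (eulerOp (n + p) χ) Q z := by
  have h1 : ∀ j : Fin n, dz j (radialMul χ (X (.inl j) * Q)) z =
      2 * ((deriv χ (‖z‖ ^ 4) : ℝ) : ℂ) * ev (normSqPoly n) z * ev Q z *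
          (ev (X (.inl j) * X (.inr j)) z) + χ (‖z‖ ^ 4) * ev Q z +
        χ (‖z‖ ^ 4) * ev (X (.inl j) * pderiv (.inl j) Q) z := by
    intro j
    rw [dz_radialMul hχ]
    simp only [radialMul, ev_mul, Derivation.leibniz, pderiv_X_self, smul_eq_mul, ev_add, mul_one]
    ring
  simp only [h1, Finset.sum_add_distrib, ← Finset.mul_sum, ← ev_sum, hQ.euler_inl]
  rw [← normSqPoly, ev_normSqPoly]
  simp [radialMul, eulerOp]
  ring

lemma sum_dzbar_inr_radialMul (hχ : Differentiable ℝ χ) {p q : ℕ} {Q : ZPoly n}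
    (hQ : IsBihom p q Q) (z : EuclideanSpace ℂ (Fin n)) :
    ∑ j, dzbar j (radialMul χ (X (.inr j) * Q)) z = radialMul (eulerOp (n + q) χ) Q z := by
  have h1 : ∀ j : Fin n, dzbar j (radialMul χ (X (.inr j) * Q)) z =
      2 * ((deriv χ (‖z‖ ^ 4) : ℝ) : ℂ) * ev (normSqPoly n) z * ev Q z *
          (ev (X (.inl j) * X (.inr j)) z) + χ (‖z‖ ^ 4) * ev Q z +
        χ (‖z‖ ^ 4) * ev (X (.inr j) * pderiv (.inr j) Q) z := by
    intro j
    rw [dzbar_radialMul hχ]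
    simp only [radialMul, ev_mul, Derivation.leibniz, pderiv_X_self, smul_eq_mul, ev_add, mul_one]
    ring
  simp only [h1, Finset.sum_add_distrib, ← Finset.mul_sum, ← ev_sum, hQ.euler_inr]
  rw [← normSqPoly, ev_normSqPoly]
  simp [radialMul, eulerOp]
  ring

lemma contDiff_radialMul (hχ : ContDiff ℝ ∞ χ) (P : ZPoly n) : ContDiff ℝ ∞ (radialMul χ P) := by
  have h : radialMul χ P = fun x => (Complex.ofRealCLM (χ ((‖x‖ ^ 2) ^ 2))) * ev P x := by
    ext x; simp only [radialMul, Complex.ofRealCLM_apply]; ring_nf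
  rw [h]
  exact (Complex.ofRealCLM.contDiff.comp (hχ.comp ((contDiff_norm_sq ℝ).pow 2))).mul (contDiff_ev P)

lemma norm_pow_mem {a b : ℝ} (hb : b < 1) {z : EuclideanSpace ℂ (Fin n)}
    (hz : ‖z‖ ^ 4 ∈ Icc a b) : z ∈ ball (0 : EuclideanSpace ℂ (Fin n)) 1 := by
  rw [mem_ball_zero_iff]
  by_contra h
  push Not at h
  have := one_le_pow₀ h (n := 4)
  linarith [hz.2]

lemma tsupport_radialMul_subset {a b : ℝ} (h : ∀ t, χ t ≠ 0 → t ∈ Icc a b) (P : ZPoly n) :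
    tsupport (radialMul χ P) ⊆ {z | ‖z‖ ^ 4 ∈ Icc a b} := by
  refine closure_minimal (fun z hz => ?_) (isClosed_Icc.preimage (by fun_prop))
  refine h _ fun h0 => hz ?_
  simp [radialMul, h0]

lemma IsRadialTest.tsupport_subset (h : IsRadialTest χ) (P : ZPoly n) :
    tsupport (radialMul χ P) ⊆ ball 0 1 := by
  obtain ⟨a, b, -, -, hb, hs⟩ := h.supp
  exact (tsupport_radialMul_subset hs P).trans fun z hz => norm_pow_mem hb hz

end radialMul

/-! ### Integration by parts -/

section IBP

variable {n : ℕ} {v Φ : EuclideanSpace ℂ (Fin n) → ℂ}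

lemma continuous_mul_of_tsupport (hv : ContinuousOn v (ball 0 1)) (hΦ : Continuous Φ)
    (hs : tsupport Φ ⊆ ball 0 1) : Continuous fun z => v z * Φ z := by
  rw [continuous_iff_continuousAt]
  intro z
  by_cases hz : z ∈ tsupport Φ
  · exact (hv.continuousAt (isOpen_ball.mem_nhds (hs hz))).mul hΦ.continuousAt
  · have : (fun z => v z * Φ z) =ᶠ[𝓝 z] fun _ => 0 := by
      filter_upwards [(isClosed_tsupport Φ).isOpen_compl.mem_nhds hz] with x hx
      rw [image_eq_zero_of_notMem_tsupport hx, mul_zero]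
    exact continuousAt_const.congr this.symm

lemma hasCompactSupport_of_tsupport (hs : tsupport Φ ⊆ ball 0 1) : HasCompactSupport Φ :=
  (isCompact_closedBall 0 1).of_isClosed_subset (isClosed_tsupport _)
    (hs.trans ball_subset_closedBall)

lemma integrable_mul_of_tsupport (hv : ContinuousOn v (ball 0 1)) (hΦ : Continuous Φ)
    (hs : tsupport Φ ⊆ ball 0 1) : Integrable (fun z => v z * Φ z) :=
  (continuous_mul_of_tsupport hv hΦ hs).integrable_of_hasCompactSupport
    (hasCompactSupport_of_tsupport hs).mul_left

lemma continuousOn_fderiv_apply (hv : ContDiffOn ℝ 1 v (ball 0 1)) (y : EuclideanSpace ℂ (Fin n)) :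
    ContinuousOn (fun z => fderiv ℝ v z y) (ball 0 1) :=
  (hv.continuousOn_fderiv_of_isOpen isOpen_ball le_rfl).clm_apply continuousOn_const

lemma tsupport_fderiv_apply (hs : tsupport Φ ⊆ ball 0 1) (y : EuclideanSpace ℂ (Fin n)) :
    tsupport (fun z => fderiv ℝ Φ z y) ⊆ ball 0 1 :=
  (closure_minimal (fun z hz => support_fderiv_subset ℝ (f := Φ) (by
    intro h; exact hz (by simp [h]))) (isClosed_tsupport Φ)).trans hs

lemma integral_fderiv_mul (hv : ContDiffOn ℝ 1 v (ball 0 1)) (hΦ : ContDiff ℝ 1 Φ)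
    (hs : tsupport Φ ⊆ ball 0 1) (y : EuclideanSpace ℂ (Fin n)) :
    ∫ z, fderiv ℝ v z y * Φ z = - ∫ z, v z * fderiv ℝ Φ z y := by
  rw [integral_mul_fderiv_eq_neg_fderiv_mul_of_integrable (f := v) (g := Φ) (v := y), neg_neg]
  · exact integrable_mul_of_tsupport (continuousOn_fderiv_apply hv y) hΦ.continuous hs
  · exact integrable_mul_of_tsupport hv.continuousOn
      ((hΦ.continuous_fderiv (by simp)).clm_apply continuous_const) (tsupport_fderiv_apply hs y)
  · exact integrable_mul_of_tsupport hv.continuousOn hΦ.continuous hs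
  · exact fun x hx => (hv.differentiableOn (by simp)).differentiableAt
      (isOpen_ball.mem_nhds (hs hx))
  · exact fun x _ => hΦ.differentiable (by simp) x

lemma integral_dz_mul (hv : ContDiffOn ℝ 1 v (ball 0 1)) (hΦ : ContDiff ℝ 1 Φ)
    (hs : tsupport Φ ⊆ ball 0 1) (j : Fin n) :
    ∫ z, dz j v z * Φ z = - ∫ z, v z * dz j Φ z := by
  have i1 : ∀ y, Integrable (fun z => fderiv ℝ v z y * Φ z) := fun y =>
    integrable_mul_of_tsupport (continuousOn_fderiv_apply hv y) hΦ.continuous hs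
  have i2 : ∀ y, Integrable (fun z => v z * fderiv ℝ Φ z y) := fun y =>
    integrable_mul_of_tsupport hv.continuousOn
      ((hΦ.continuous_fderiv (by simp)).clm_apply continuous_const) (tsupport_fderiv_apply hs y)
  have e1 : ∀ z, dz j v z * Φ z = (1 / 2 : ℂ) * (fderiv ℝ v z (EuclideanSpace.single j 1) * Φ z)
      - (1 / 2 * Complex.I) * (fderiv ℝ v z (EuclideanSpace.single j Complex.I) * Φ z) := by
    intro z; simp only [dz]; ring
  have e2 : ∀ z, v z * dz j Φ z = (1 / 2 : ℂ) * (v z * fderiv ℝ Φ z (EuclideanSpace.single j 1))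
      - (1 / 2 * Complex.I) * (v z * fderiv ℝ Φ z (EuclideanSpace.single j Complex.I)) := by
    intro z; simp only [dz]; ring
  simp only [e1, e2]
  rw [integral_sub ((i1 _).const_mul _) ((i1 _).const_mul _),
    integral_sub ((i2 _).const_mul _) ((i2 _).const_mul _)]
  simp only [integral_const_mul, integral_fderiv_mul hv hΦ hs]
  ring

lemma integral_dzbar_mul (hv : ContDiffOn ℝ 1 v (ball 0 1)) (hΦ : ContDiff ℝ 1 Φ)
    (hs : tsupport Φ ⊆ ball 0 1) (j : Fin n) :
    ∫ z, dzbar j v z * Φ z = - ∫ z, v z * dzbar j Φ z := by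
  have i1 : ∀ y, Integrable (fun z => fderiv ℝ v z y * Φ z) := fun y =>
    integrable_mul_of_tsupport (continuousOn_fderiv_apply hv y) hΦ.continuous hs
  have i2 : ∀ y, Integrable (fun z => v z * fderiv ℝ Φ z y) := fun y =>
    integrable_mul_of_tsupport hv.continuousOn
      ((hΦ.continuous_fderiv (by simp)).clm_apply continuous_const) (tsupport_fderiv_apply hs y)
  have e1 : ∀ z, dzbar j v z * Φ z =
      (1 / 2 : ℂ) * (fderiv ℝ v z (EuclideanSpace.single j 1) * Φ z)
      + (1 / 2 * Complex.I) * (fderiv ℝ v z (EuclideanSpace.single j Complex.I) * Φ z) := by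
    intro z; simp only [dzbar]; ring
  have e2 : ∀ z, v z * dzbar j Φ z = (1 / 2 : ℂ) * (v z * fderiv ℝ Φ z (EuclideanSpace.single j 1))
      + (1 / 2 * Complex.I) * (v z * fderiv ℝ Φ z (EuclideanSpace.single j Complex.I)) := by
    intro z; simp only [dzbar]; ring
  simp only [e1, e2]
  rw [integral_add ((i1 _).const_mul _) ((i1 _).const_mul _),
    integral_add ((i2 _).const_mul _) ((i2 _).const_mul _)]
  simp only [integral_const_mul, integral_fderiv_mul hv hΦ hs]
  ring

lemma contDiffOn_dzbar (hv : ContDiffOn ℝ 2 v (ball 0 1)) (k : Fin n) :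
    ContDiffOn ℝ 1 (dzbar k v) (ball 0 1) := by
  have h := hv.fderiv_of_isOpen isOpen_ball (m := 1) (by norm_num)
  exact contDiffOn_const.mul ((h.clm_apply contDiffOn_const).add
    (contDiffOn_const.mul (h.clm_apply contDiffOn_const)))

lemma continuousOn_dz (hv : ContDiffOn ℝ 1 v (ball 0 1)) (k : Fin n) :
    ContinuousOn (dz k v) (ball 0 1) :=
  continuousOn_const.mul ((continuousOn_fderiv_apply hv _).sub
    (continuousOn_const.mul (continuousOn_fderiv_apply hv _)))

lemma contDiff_dz (hΦ : ContDiff ℝ ∞ Φ) (k : Fin n) : ContDiff ℝ ∞ (dz k Φ) := by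
  have h := hΦ.fderiv_right (m := ∞) (by simp)
  exact contDiff_const.mul ((h.clm_apply contDiff_const).sub
    (contDiff_const.mul (h.clm_apply contDiff_const)))

lemma contDiff_dzbar (hΦ : ContDiff ℝ ∞ Φ) (k : Fin n) : ContDiff ℝ ∞ (dzbar k Φ) := by
  have h := hΦ.fderiv_right (m := ∞) (by simp)
  exact contDiff_const.mul ((h.clm_apply contDiff_const).add
    (contDiff_const.mul (h.clm_apply contDiff_const)))

lemma tsupport_dz (hs : tsupport Φ ⊆ ball 0 1) (k : Fin n) : tsupport (dz k Φ) ⊆ ball 0 1 :=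
  (closure_minimal (fun z hz => support_fderiv_subset ℝ (f := Φ) (by
    intro h; exact hz (by simp [dz, h]))) (isClosed_tsupport Φ)).trans hs

lemma tsupport_dzbar (hs : tsupport Φ ⊆ ball 0 1) (k : Fin n) :
    tsupport (dzbar k Φ) ⊆ ball 0 1 :=
  (closure_minimal (fun z hz => support_fderiv_subset ℝ (f := Φ) (by
    intro h; exact hz (by simp [dzbar, h]))) (isClosed_tsupport Φ)).trans hs

lemma integral_dz_dzbar_mul (hv : ContDiffOn ℝ 2 v (ball 0 1)) (hΦ : ContDiff ℝ ∞ Φ)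
    (hs : tsupport Φ ⊆ ball 0 1) (j k : Fin n) :
    ∫ z, dz j (dzbar k v) z * Φ z = ∫ z, v z * dzbar k (dz j Φ) z := by
  rw [integral_dz_mul (contDiffOn_dzbar hv k) (hΦ.of_le (by simp)) hs,
    integral_dzbar_mul (hv.of_le (by norm_num)) ((contDiff_dz hΦ j).of_le (by simp))
    (tsupport_dz hs j), neg_neg]

end IBP

/-! ### The weak form of the radial equation -/

/-- The radial factor of the formal adjoint of `modLaplacian` on functions `χ(|z|⁴) h` with `h`
harmonic of bidegree `(p, q)`. -/
noncomputable def adjointRadial (n p q : ℕ) (χ : ℝ → ℝ) (t : ℝ) : ℝ :=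
  2 * eulerOp (n + p + q + 1) (deriv χ) t - eulerOp (n + q + 1) (eulerOp (n + p + 1) χ) t

section weak

variable {n : ℕ} {u : EuclideanSpace ℂ (Fin n) → ℂ} {χ : ℝ → ℝ} {p q : ℕ} {h : ZPoly n}

lemma IsRadialTest.adjointRadial (hχ : IsRadialTest χ) : IsRadialTest (adjointRadial n p q χ) := by
  have := ((hχ.deriv.eulerOp (n + p + q + 1)).mul_left (η := fun _ => 2) contDiff_const).add
    (((hχ.eulerOp (n + p + 1)).eulerOp (n + q + 1)).mul_left (η := fun _ => -1) contDiff_const)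
  convert this using 2
  simp only [_root_.adjointRadial]; ring

lemma sum_dzbar_dz_radialMul (hχ : IsRadialTest χ) (hh : IsBihom p q h)
    (hD : polyLaplacian h = 0) (z : EuclideanSpace ℂ (Fin n)) :
    ∑ j, dzbar j (dz j (radialMul χ h)) z =
      radialMul (fun t => 2 * eulerOp (n + p + q + 1) (deriv χ) t) (normSqPoly n * h) z := by
  have e : ∀ j : Fin n, dzbar j (dz j (radialMul χ h)) z =
      2 * dzbar j (radialMul (deriv χ) (X (.inr j) * (normSqPoly n * h))) z +
      (2 * ((deriv χ (‖z‖ ^ 4) : ℝ) : ℂ) * ev (normSqPoly n) z *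
        ev (X (.inl j) * pderiv (.inl j) h) z +
        χ (‖z‖ ^ 4) * ev (pderiv (.inl j) (pderiv (.inr j) h)) z) := by
    intro j
    have hc : (pderiv (.inr j) (pderiv (.inl j) h)) = pderiv (.inl j) (pderiv (.inr j) h) :=
      pderiv_pderiv_comm _ _ _
    rw [dz_radialMul hχ.differentiable, dzbar_add j
      ((differentiable_radialMul hχ.deriv.differentiable _ z).const_mul _)
      (differentiable_radialMul hχ.differentiable _ z),
      dzbar_mul j (differentiableAt_const _) (differentiable_radialMul hχ.deriv.differentiable _ z),
      dzbar_const, dzbar_radialMul hχ.differentiable, hc]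
    rw [show normSqPoly n * (X (.inr j) * h) = X (.inr j) * (normSqPoly n * h) by ring]
    simp only [radialMul, ev_mul]
    ring
  simp only [e, Finset.sum_add_distrib, ← Finset.mul_sum, ← ev_sum]
  rw [sum_dzbar_inr_radialMul hχ.deriv.differentiable hh.normSq_mul, hh.euler_inl,
    ← polyLaplacian, hD]
  simp only [radialMul, eulerOp, ev_mul, ev_smul, ev_zero]
  push_cast
  ring

lemma sum_sum_dzbar_dz_radialMul (hχ : IsRadialTest χ) (hh : IsBihom p q h)
    (z : EuclideanSpace ℂ (Fin n)) :
    ∑ j, ∑ k, dzbar k (dz j (radialMul χ (X (.inl j) * (X (.inr k) * (normSqPoly n * h))))) z =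
      radialMul (eulerOp (n + q + 1) (eulerOp (n + p + 1) χ)) (normSqPoly n * h) z := by
  rw [Finset.sum_comm]
  have e : ∀ k : Fin n,
      ∑ j, dzbar k (dz j (radialMul χ (X (.inl j) * (X (.inr k) * (normSqPoly n * h))))) z =
      dzbar k (radialMul (eulerOp (n + p + 1) χ) (X (.inr k) * (normSqPoly n * h))) z := by
    intro k
    have hs : ∀ (s : Finset (Fin n)) (f : Fin n → EuclideanSpace ℂ (Fin n) → ℂ),
        (∀ j, DifferentiableAt ℝ (f j) z) →
        ∑ j ∈ s, dzbar k (f j) z = dzbar k (fun x => ∑ j ∈ s, f j x) z := by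
      intro s f hf
      induction s using Finset.induction_on with
      | empty => simp [dzbar_const]
      | insert a s ha ih =>
        simp only [Finset.sum_insert ha]
        rw [dzbar_add k (hf a) (DifferentiableAt.fun_sum fun i _ => hf i), ih]
    rw [hs]
    · congr 1
      ext x
      rw [sum_dz_inl_radialMul hχ.differentiable (hh.normSq_mul.inr_mul k)]
      push_cast
      rw [add_assoc]
    · intro j
      exact (contDiff_dz (contDiff_radialMul hχ.smooth _) j).differentiable (by simp) z
  simp only [e]
  rw [sum_dzbar_inr_radialMul (hχ.eulerOp _).differentiable hh.normSq_mul]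
  push_cast
  rw [← add_assoc]

/-- Solutions are orthogonal to the formal adjoint of `modLaplacian` applied to `χ(|z|⁴) h`. -/
lemma integral_adjointRadial (hu : ContDiffOn ℝ 2 u (ball 0 1))
    (hΔ : ∀ z ∈ ball (0 : EuclideanSpace ℂ (Fin n)) 1, modLaplacian u z = 0)
    (hχ : IsRadialTest χ) (hh : IsBihom p q h) (hD : polyLaplacian h = 0) :
    ∫ z, u z * radialMul (adjointRadial n p q χ) (normSqPoly n * h) z = 0 := by
  set F : Fin n → Fin n → EuclideanSpace ℂ (Fin n) → ℂ := fun j k =>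
    radialMul χ (if j = k then h else 0) with hF
  set G : Fin n → Fin n → EuclideanSpace ℂ (Fin n) → ℂ := fun j k =>
    radialMul χ (X (.inl j) * (X (.inr k) * (normSqPoly n * h))) with hG
  have hcont : ∀ j k, ContinuousOn (dz j (dzbar k u)) (ball 0 1) := fun j k =>
    continuousOn_dz (contDiffOn_dzbar hu k) j
  have iL : ∀ j k (P : ZPoly n), Integrable fun z => dz j (dzbar k u) z * radialMul χ P z :=
    fun j k P => integrable_mul_of_tsupport (hcont j k) (contDiff_radialMul hχ.smooth P).continuous
      (hχ.tsupport_subset P)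
  have iR : ∀ j k (P : ZPoly n), Integrable fun z => u z * dzbar k (dz j (radialMul χ P)) z :=
    fun j k P => integrable_mul_of_tsupport hu.continuousOn
      (contDiff_dzbar (contDiff_dz (contDiff_radialMul hχ.smooth P) j) k).continuous
      (tsupport_dzbar (tsupport_dz (hχ.tsupport_subset P) j) k)
  have h1 : ∀ z, ∑ j, ∑ k, (dz j (dzbar k u) z * F j k z - dz j (dzbar k u) z * G j k z) = 0 := by
    intro z
    by_cases hz : z ∈ ball (0 : EuclideanSpace ℂ (Fin n)) 1
    · have := hΔ z hz
      rw [modLaplacian] at this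
      have h2 := congrArg (fun w => w * radialMul χ h z) this
      simp only [zero_mul, Finset.sum_mul] at h2
      rw [← h2]
      refine Finset.sum_congr rfl fun j _ => Finset.sum_congr rfl fun k _ => ?_
      simp only [hF, hG, radialMul, ev_mul, ev_inl, ev_inr, ev_normSqPoly]
      split_ifs <;> simp <;> ring
    · have h0 : ∀ P : ZPoly n, radialMul χ P z = 0 := fun P =>
        image_eq_zero_of_notMem_tsupport fun hc => hz (hχ.tsupport_subset P hc)
      simp [hF, hG, h0]
  have h2 : ∀ z, u z * radialMul (adjointRadial n p q χ) (normSqPoly n * h) z =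
      ∑ j, ∑ k, (u z * dzbar k (dz j (F j k)) z - u z * dzbar k (dz j (G j k)) z) := by
    intro z
    have e1 : ∑ j, ∑ k, u z * dzbar k (dz j (F j k)) z =
        u z * ∑ j, dzbar j (dz j (radialMul χ h)) z := by
      rw [Finset.mul_sum]
      refine Finset.sum_congr rfl fun j _ => ?_
      rw [Finset.sum_eq_single j]
      · simp [hF]
      · intro k _ hk
        have : F j k = fun _ => 0 := by ext x; simp [hF, hk.symm, radialMul]
        have h' : dz j (fun _ : EuclideanSpace ℂ (Fin n) => (0 : ℂ)) = fun _ => 0 := by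
          ext x; exact dz_const j 0
        rw [this, h', dzbar_const, mul_zero]
      · simp
    simp only [Finset.sum_sub_distrib]
    rw [e1, sum_dzbar_dz_radialMul hχ hh hD]
    simp only [← Finset.mul_sum]
    rw [sum_sum_dzbar_dz_radialMul hχ hh]
    simp only [radialMul, adjointRadial]
    push_cast
    ring
  simp only [h2]
  have iR' : ∀ j k, Integrable fun z =>
      u z * dzbar k (dz j (F j k)) z - u z * dzbar k (dz j (G j k)) z :=
    fun j k => (iR j k _).sub (iR j k _)
  have iL' : ∀ j k, Integrable fun z =>
      dz j (dzbar k u) z * F j k z - dz j (dzbar k u) z * G j k z :=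
    fun j k => (iL j k _).sub (iL j k _)
  rw [integral_finsetSum _ fun j _ => integrable_finsetSum _ fun k _ => iR' j k]
  have h3 : (0 : ℂ) = ∫ z, ∑ j, ∑ k,
      (dz j (dzbar k u) z * F j k z - dz j (dzbar k u) z * G j k z) := by
    simp only [h1, integral_zero]
  rw [h3, integral_finsetSum _ fun j _ => integrable_finsetSum _ fun k _ => iL' j k]
  refine Finset.sum_congr rfl fun j _ => ?_
  rw [integral_finsetSum _ fun k _ => iR' j k, integral_finsetSum _ fun k _ => iL' j k]
  refine Finset.sum_congr rfl fun k _ => ?_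
  rw [integral_sub (iR _ _ _) (iR _ _ _), integral_sub (iL _ _ _) (iL _ _ _)]
  rw [integral_dz_dzbar_mul hu (contDiff_radialMul hχ.smooth _) (hχ.tsupport_subset _),
    integral_dz_dzbar_mul hu (contDiff_radialMul hχ.smooth _) (hχ.tsupport_subset _)]

end weak

/-! ### The hypergeometric equation -/

/-- `f`, with derivative `f₁`, solves `t (1 - t) f'' + (c - (a + b + 1) t) f' - a b f = 0` on
`(0, 1)`. -/
structure IsHypergeomSol (a b c : ℝ) (f f₁ : ℝ → ℝ) : Prop where
  hasDerivAt : ∀ t ∈ Ioo (0 : ℝ) 1, HasDerivAt f (f₁ t) t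
  hasDerivAt' : ∀ t ∈ Ioo (0 : ℝ) 1,
    HasDerivAt f₁ ((a * b * f t - (c - (a + b + 1) * t) * f₁ t) / (t * (1 - t))) t

/-- `t ^ c (1 - t) ^ (a + b - c + 1) f'`, the flux of the equation in Sturm–Liouville form. -/
noncomputable def hypergeomFlux (a b c : ℝ) (f₁ : ℝ → ℝ) (t : ℝ) : ℝ :=
  t ^ c * (1 - t) ^ (a + b - c + 1) * f₁ t

namespace IsHypergeomSol

variable {a b c s C : ℝ} {f f₁ : ℝ → ℝ}

lemma neg (h : IsHypergeomSol a b c f f₁) : IsHypergeomSol a b c (-f) (-f₁) where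
  hasDerivAt t ht := (h.hasDerivAt t ht).neg
  hasDerivAt' t ht := by
    convert! (h.hasDerivAt' t ht).neg using 1
    simp only [Pi.neg_apply]; ring

/-- The derivative of a solution solves the equation with all three parameters shifted by one. -/
lemma deriv (h : IsHypergeomSol a b c f f₁) : IsHypergeomSol (a + 1) (b + 1) (c + 1) f₁
    (fun t => (a * b * f t - (c - (a + b + 1) * t) * f₁ t) / (t * (1 - t))) where
  hasDerivAt := h.hasDerivAt'
  hasDerivAt' t ht := by
    have ht0 : t ≠ 0 := ht.1.ne'
    have ht1 : 1 - t ≠ 0 := (sub_pos.2 ht.2).ne'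
    have hD : HasDerivAt (fun t : ℝ => t * (1 - t)) (1 * (1 - t) + t * (0 - 1)) t :=
      (hasDerivAt_id t).mul ((hasDerivAt_const t (1 : ℝ)).sub (hasDerivAt_id t))
    have hB : HasDerivAt (fun t : ℝ => c - (a + b + 1) * t) (0 - (a + b + 1) * 1) t :=
      (hasDerivAt_const t c).sub ((hasDerivAt_id t).const_mul _)
    have hN := (((h.hasDerivAt t ht).const_mul (a * b)).sub (hB.mul (h.hasDerivAt' t ht)))
    convert! hN.div hD (mul_ne_zero ht0 ht1) using 1
    simp only [Pi.sub_apply, Pi.mul_apply]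
    field_simp
    ring

lemma hasDerivAt_flux (h : IsHypergeomSol a b c f f₁) {t : ℝ} (ht : t ∈ Ioo (0 : ℝ) 1) :
    HasDerivAt (hypergeomFlux a b c f₁)
      (a * b * (t ^ (c - 1) * (1 - t) ^ (a + b - c)) * f t) t := by
  have ht0 : t ≠ 0 := ht.1.ne'
  have ht1 : 1 - t ≠ 0 := (sub_pos.2 ht.2).ne'
  have h1 : HasDerivAt (fun t : ℝ => t ^ c) (c * t ^ (c - 1)) t :=
    Real.hasDerivAt_rpow_const (Or.inl ht0)
  have h2 : HasDerivAt (fun t : ℝ => (1 - t) ^ (a + b - c + 1))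
      ((0 - 1) * (a + b - c + 1) * (1 - t) ^ (a + b - c + 1 - 1)) t :=
    ((hasDerivAt_const t (1 : ℝ)).sub (hasDerivAt_id t)).rpow_const (Or.inl ht1)
  have h3 := (h1.mul h2).mul (h.hasDerivAt' t ht)
  convert! h3 using 1
  have e1 : t ^ c = t * t ^ (c - 1) := by
    rw [Real.rpow_sub_one ht0]; field_simp
  have e2 : (1 - t) ^ (a + b - c + 1) = (1 - t) * (1 - t) ^ (a + b - c) := by
    rw [Real.rpow_add_one ht1]; ring
  simp only [Pi.mul_apply]
  rw [e1, e2, add_sub_cancel_right]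
  field_simp
  ring

lemma continuousOn (h : IsHypergeomSol a b c f f₁) : ContinuousOn f (Ioo 0 1) :=
  fun t ht => (h.hasDerivAt t ht).continuousAt.continuousWithinAt

end IsHypergeomSol

lemma exists_one_sub_rpow_bounds (y : ℝ) :
    ∃ m M : ℝ, 0 < m ∧ 0 < M ∧ ∀ t ∈ Ioc (0 : ℝ) (1 / 2), m ≤ (1 - t) ^ y ∧ (1 - t) ^ y ≤ M := by
  have hc : ContinuousOn (fun t : ℝ => (1 - t) ^ y) (Icc 0 (1 / 2)) := by
    intro t ht
    exact ((continuous_const.sub continuous_id).continuousAt.rpow_const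
      (Or.inl (by simp only [id]; linarith [ht.2] : (1 : ℝ) - id t ≠ 0))).continuousWithinAt
  obtain ⟨x, hx, hxm⟩ := isCompact_Icc.exists_isMinOn ⟨0, by norm_num⟩ hc
  obtain ⟨x', hx', hxM⟩ := isCompact_Icc.exists_isMaxOn ⟨0, by norm_num⟩ hc
  exact ⟨_, _, Real.rpow_pos_of_pos (by linarith [hx.2]) y,
    Real.rpow_pos_of_pos (by linarith [hx'.2]) y,
    fun t ht => ⟨hxm ⟨ht.1.le, ht.2⟩, hxM ⟨ht.1.le, ht.2⟩⟩⟩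

lemma monotoneOn_of_hasDerivAt_nonneg {D : Set ℝ} (hD : Convex ℝ D) {g g' : ℝ → ℝ}
    (hg : ∀ t ∈ D, HasDerivAt g (g' t) t) (hn : ∀ t ∈ D, 0 ≤ g' t) : MonotoneOn g D :=
  monotoneOn_of_deriv_nonneg hD (fun t ht => (hg t ht).continuousAt.continuousWithinAt)
    (fun t ht => (hg t (interior_subset ht)).differentiableAt.differentiableWithinAt)
    fun t ht => by rw [(hg t (interior_subset ht)).deriv]; exact hn t (interior_subset ht)

lemma tendsto_rpow_zero {y : ℝ} (hy : 0 < y) : Tendsto (fun t : ℝ => t ^ y) (𝓝[>] 0) (𝓝 0) := by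
  have := (Real.continuousAt_rpow_const (0 : ℝ) y (Or.inr hy.le)).tendsto
  rw [Real.zero_rpow hy.ne'] at this
  exact this.mono_left nhdsWithin_le_nhds

namespace IsHypergeomSol

variable {a b c s C : ℝ} {f f₁ : ℝ → ℝ}

/-- A flux that does not vanish at `0` would force `f` to grow like `t ^ (1 - c)`. -/
lemma flux_le (h : IsHypergeomSol a b c f f₁) (hab : 0 ≤ a * b) (hs : 0 ≤ s) (hsc : s < c - 1)
    (hf : ∀ t ∈ Ioc (0 : ℝ) (1 / 2), |f t| ≤ C * t ^ (-s)) :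
    ∃ K, ∀ t ∈ Ioc (0 : ℝ) (1 / 2), hypergeomFlux a b c f₁ t ≤ K * t ^ (c - s) := by
  obtain ⟨_, M, _, hM, hMb⟩ := exists_one_sub_rpow_bounds (a + b - c)
  obtain ⟨m, _, hm, _, hmb⟩ := exists_one_sub_rpow_bounds (-(a + b - c + 1))
  have hκ : 0 < c - s := by linarith
  have hsub : ∀ t ∈ Ioc (0 : ℝ) (1 / 2), t ∈ Ioo (0 : ℝ) 1 := fun t ht =>
    ⟨ht.1, by linarith [ht.2]⟩
  set K := a * b * M * C / (c - s) with hK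
  refine ⟨K, fun t₀ ht₀ => ?_⟩
  -- `K t ^ (c - s)` grows at least as fast as the flux, so a flux exceeding it at `t₀` exceeds it
  -- by at least the same amount `δ` on `(0, t₀]`. Then `f' ≥ δ m t ^ (-c)`, hence
  -- `f + η t ^ (1 - c)` is nondecreasing, which contradicts the growth bound as `s < c - 1`.
  by_contra hlt
  push Not at hlt
  set W := hypergeomFlux a b c f₁
  set δ := W t₀ - K * t₀ ^ (c - s) with hδ
  have hδ0 : 0 < δ := sub_pos.2 hlt
  have hanti : MonotoneOn (fun t => K * t ^ (c - s) - W t) (Ioc 0 (1 / 2)) := by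
    refine monotoneOn_of_hasDerivAt_nonneg (convex_Ioc _ _) (fun t ht =>
      ((Real.hasDerivAt_rpow_const (Or.inl ht.1.ne')).const_mul K).sub
        (h.hasDerivAt_flux (hsub t ht))) fun t ht => ?_
    have hp : 0 < t ^ (c - 1) := Real.rpow_pos_of_pos ht.1 _
    have e : t ^ (c - s - 1) = t ^ (c - 1) * t ^ (-s) := by
      rw [← Real.rpow_add ht.1]; ring_nf
    have e2 : K * ((c - s) * t ^ (c - s - 1)) = a * b * (t ^ (c - 1) * M) * (C * t ^ (-s)) := by
      rw [e, hK]; field_simp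
    rw [e2, sub_nonneg]
    calc a * b * (t ^ (c - 1) * (1 - t) ^ (a + b - c)) * f t
        ≤ a * b * (t ^ (c - 1) * (1 - t) ^ (a + b - c)) * (C * t ^ (-s)) := by
          refine mul_le_mul_of_nonneg_left ((le_abs_self _).trans (hf t ht)) ?_
          exact mul_nonneg hab (mul_nonneg hp.le (Real.rpow_nonneg (by linarith [ht.2]) _))
      _ ≤ _ := by
          refine mul_le_mul_of_nonneg_right ?_ ((abs_nonneg _).trans (hf t ht))
          exact mul_le_mul_of_nonneg_left (mul_le_mul_of_nonneg_left (hMb t ht).2 hp.le) hab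
  have hW : ∀ t ∈ Ioc 0 t₀, δ ≤ W t := by
    intro t ht
    have h1 := hanti ⟨ht.1, ht.2.trans ht₀.2⟩ ht₀ ht.2
    have hK0 : 0 ≤ K * t ^ (c - s) := by
      have hC : 0 ≤ C := by
        have := (abs_nonneg _).trans (hf t₀ ht₀)
        exact nonneg_of_mul_nonneg_left this (Real.rpow_pos_of_pos ht₀.1 _)
      have := Real.rpow_nonneg ht.1.le (c - s)
      positivity
    simp only at h1
    linarith
  set η := δ * m / (c - 1) with hη
  have hη0 : 0 < η := div_pos (mul_pos hδ0 hm) (by linarith)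
  have hmono : MonotoneOn (fun t => f t + η * t ^ (1 - c)) (Ioc 0 t₀) := by
    refine monotoneOn_of_hasDerivAt_nonneg (convex_Ioc _ _) (fun t ht =>
      (h.hasDerivAt t (hsub t ⟨ht.1, ht.2.trans ht₀.2⟩)).add
      ((Real.hasDerivAt_rpow_const (Or.inl ht.1.ne')).const_mul η)) fun t ht => ?_
    have ht' : t ∈ Ioc (0 : ℝ) (1 / 2) := ⟨ht.1, ht.2.trans ht₀.2⟩
    have hf1 : f₁ t = W t * t ^ (-c) * (1 - t) ^ (-(a + b - c + 1)) := by
      have p1 : 0 < t ^ c := Real.rpow_pos_of_pos ht.1 _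
      have p2 : 0 < (1 - t) ^ (a + b - c + 1) := Real.rpow_pos_of_pos (by linarith [ht'.2]) _
      simp only [W, hypergeomFlux]
      rw [Real.rpow_neg ht.1.le, Real.rpow_neg (by linarith [ht'.2])]
      field_simp
    have e : η * ((1 - c) * t ^ (1 - c - 1)) = - (δ * t ^ (-c) * m) := by
      rw [hη, show 1 - c - 1 = -c by ring]
      have : c - 1 ≠ 0 := by linarith
      field_simp
      ring
    rw [e, hf1, ← sub_eq_add_neg, sub_nonneg]
    have p1 : 0 < t ^ (-c) := Real.rpow_pos_of_pos ht.1 _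
    refine mul_le_mul (mul_le_mul_of_nonneg_right (hW t ht) p1.le) (hmb t ht').1 hm.le ?_
    exact mul_nonneg (hδ0.le.trans (hW t ht)) p1.le
  set G := f t₀ + η * t₀ ^ (1 - c)
  have hle : ∀ᶠ t in 𝓝[>] (0 : ℝ), η ≤ G * t ^ (c - 1) + C * t ^ (c - 1 - s) := by
    filter_upwards [Ioo_mem_nhdsGT ht₀.1] with t ht
    have h1 := hmono ⟨ht.1, ht.2.le⟩ ⟨ht₀.1, le_rfl⟩ ht.2.le
    have h2 := neg_le_of_abs_le (hf t ⟨ht.1, ht.2.le.trans ht₀.2⟩)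
    have h3 : η * t ^ (1 - c) ≤ G + C * t ^ (-s) := by simp only at h1; linarith
    have p : 0 < t ^ (c - 1) := Real.rpow_pos_of_pos ht.1 _
    have h4 := mul_le_mul_of_nonneg_right h3 p.le
    have e1 : η * t ^ (1 - c) * t ^ (c - 1) = η := by
      rw [mul_assoc, ← Real.rpow_add ht.1]; simp
    have e2 : (G + C * t ^ (-s)) * t ^ (c - 1) = G * t ^ (c - 1) + C * t ^ (c - 1 - s) := by
      rw [add_mul, mul_assoc C, ← Real.rpow_add ht.1]; ring_nf
    rwa [e1, e2] at h4
  have ht : Tendsto (fun t : ℝ => G * t ^ (c - 1) + C * t ^ (c - 1 - s)) (𝓝[>] 0)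
      (𝓝 (G * 0 + C * 0)) :=
    ((tendsto_rpow_zero (by linarith)).const_mul G).add
      ((tendsto_rpow_zero (by linarith)).const_mul C)
  have := ge_of_tendsto ht hle
  simp only [mul_zero, add_zero] at this
  linarith

lemma abs_flux_le (h : IsHypergeomSol a b c f f₁) (hab : 0 ≤ a * b) (hs : 0 ≤ s)
    (hsc : s < c - 1) (hf : ∀ t ∈ Ioc (0 : ℝ) (1 / 2), |f t| ≤ C * t ^ (-s)) :
    ∃ K, ∀ t ∈ Ioc (0 : ℝ) (1 / 2), |hypergeomFlux a b c f₁ t| ≤ K * t ^ (c - s) := by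
  obtain ⟨K, hK⟩ := h.flux_le hab hs hsc hf
  obtain ⟨K', hK'⟩ := h.neg.flux_le hab hs hsc (C := C) (by simpa using hf)
  refine ⟨max K K', fun t ht => abs_le'.2 ⟨(hK t ht).trans ?_, ?_⟩⟩
  · exact mul_le_mul_of_nonneg_right (le_max_left _ _) (Real.rpow_nonneg ht.1.le _)
  · have : -hypergeomFlux a b c f₁ t = hypergeomFlux a b c (-f₁) t := by simp [hypergeomFlux]
    rw [this]
    exact (hK' t ht).trans
      (mul_le_mul_of_nonneg_right (le_max_right _ _) (Real.rpow_nonneg ht.1.le _))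

/-- Energy monotonicity: `f · flux` is nondecreasing and tends to `0` at `0`. -/
lemma mul_flux_nonneg (h : IsHypergeomSol a b c f f₁) (hab : 0 ≤ a * b) (hs : 0 ≤ s)
    (hsc : s < c - 1) (hsc' : 2 * s < c)
    (hf : ∀ t ∈ Ioc (0 : ℝ) (1 / 2), |f t| ≤ C * t ^ (-s)) {t : ℝ} (ht : t ∈ Ioo (0 : ℝ) 1) :
    0 ≤ f t * hypergeomFlux a b c f₁ t := by
  obtain ⟨K, hK⟩ := h.abs_flux_le hab hs hsc hf
  set W := hypergeomFlux a b c f₁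
  have hmono : MonotoneOn (fun t => f t * W t) (Ioo 0 1) := by
    refine monotoneOn_of_hasDerivAt_nonneg (convex_Ioo _ _) (fun t ht =>
      (h.hasDerivAt t ht).mul (h.hasDerivAt_flux ht)) fun t ht => ?_
    have p1 : 0 ≤ t ^ c := Real.rpow_nonneg ht.1.le _
    have p2 : 0 ≤ (1 - t) ^ (a + b - c + 1) := Real.rpow_nonneg (by linarith [ht.2]) _
    have p3 : 0 ≤ t ^ (c - 1) := Real.rpow_nonneg ht.1.le _
    have p4 : 0 ≤ (1 - t) ^ (a + b - c) := Real.rpow_nonneg (by linarith [ht.2]) _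
    have e : f₁ t * W t + f t * (a * b * (t ^ (c - 1) * (1 - t) ^ (a + b - c)) * f t) =
        t ^ c * (1 - t) ^ (a + b - c + 1) * (f₁ t) ^ 2 +
          a * b * (t ^ (c - 1) * (1 - t) ^ (a + b - c)) * (f t) ^ 2 := by
      simp only [W, hypergeomFlux]; ring
    rw [e]
    positivity
  have hlim : Tendsto (fun x => f x * W x) (𝓝[>] 0) (𝓝 0) := by
    have hz : Tendsto (fun x : ℝ => C * K * x ^ (c - 2 * s)) (𝓝[>] 0) (𝓝 (C * K * 0)) :=
      (tendsto_rpow_zero (by linarith)).const_mul _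
    rw [mul_zero] at hz
    refine squeeze_zero_norm' ?_ hz
    filter_upwards [Ioo_mem_nhdsGT (show (0 : ℝ) < 1 / 2 by norm_num)] with x hx
    rw [norm_mul, Real.norm_eq_abs, Real.norm_eq_abs]
    have hx' : x ∈ Ioc (0 : ℝ) (1 / 2) := ⟨hx.1, hx.2.le⟩
    calc |f x| * |W x| ≤ (C * x ^ (-s)) * (K * x ^ (c - s)) :=
          mul_le_mul (hf x hx') (hK x hx') (abs_nonneg _) ((abs_nonneg _).trans (hf x hx'))
      _ = C * K * (x ^ (-s) * x ^ (c - s)) := by ring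
      _ = C * K * x ^ (c - 2 * s) := by rw [← Real.rpow_add hx.1]; ring_nf
  refine le_of_tendsto hlim ?_
  filter_upwards [Ioo_mem_nhdsGT ht.1] with x hx
  exact hmono ⟨hx.1, hx.2.trans ht.2⟩ ht hx.2.le

/-- The absolute value of a solution is nondecreasing, because `f f' ≥ 0`. -/
lemma abs_mono (h : IsHypergeomSol a b c f f₁) (hab : 0 ≤ a * b) (hs : 0 ≤ s)
    (hsc : s < c - 1) (hsc' : 2 * s < c)
    (hf : ∀ t ∈ Ioc (0 : ℝ) (1 / 2), |f t| ≤ C * t ^ (-s)) :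
    MonotoneOn (fun t => |f t|) (Ioo 0 1) := by
  have hmono : MonotoneOn (fun t => f t * f t) (Ioo 0 1) := by
    refine monotoneOn_of_hasDerivAt_nonneg (convex_Ioo _ _) (fun t ht =>
      (h.hasDerivAt t ht).mul (h.hasDerivAt t ht)) fun t ht => ?_
    have p1 : 0 < t ^ c * (1 - t) ^ (a + b - c + 1) :=
      mul_pos (Real.rpow_pos_of_pos ht.1 _) (Real.rpow_pos_of_pos (by linarith [ht.2]) _)
    have h1 := h.mul_flux_nonneg hab hs hsc hsc' hf ht
    have e : f t * hypergeomFlux a b c f₁ t =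
        (f t * f₁ t) * (t ^ c * (1 - t) ^ (a + b - c + 1)) := by
      simp only [hypergeomFlux]; ring
    rw [e] at h1
    have := nonneg_of_mul_nonneg_left h1 p1
    linarith
  intro x hx y hy hxy
  exact sq_le_sq.1 (by simpa [pow_two] using hmono hx hy hxy)

/-- A solution that grows more slowly at `0` than the singular solution `t ^ (1 - c)` is bounded. -/
lemma bounded_of_growth (h : IsHypergeomSol a b c f f₁) (hab : 0 ≤ a * b) (hs : 0 ≤ s)
    (hsc : s < c - 1) (hsc' : 2 * s < c)
    (hf : ∀ t ∈ Ioc (0 : ℝ) (1 / 2), |f t| ≤ C * t ^ (-s)) :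
    ∀ t ∈ Ioc (0 : ℝ) (1 / 2), |f t| ≤ |f (1 / 2)| := fun t ht =>
  h.abs_mono hab hs hsc hsc' hf ⟨ht.1, by linarith [ht.2]⟩ ⟨by norm_num, by norm_num⟩ ht.2

/-- If `a b = 0` the flux is constant, and the growth bound makes it vanish. -/
lemma eq_const_of_mul_eq_zero (h : IsHypergeomSol a b c f f₁) (hab : a * b = 0) (hs : 0 ≤ s)
    (hsc : s < c - 1) (hf : ∀ t ∈ Ioc (0 : ℝ) (1 / 2), |f t| ≤ C * t ^ (-s)) :
    ∀ t ∈ Ioo (0 : ℝ) 1, f t = f (1 / 2) := by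
  obtain ⟨K, hK⟩ := h.abs_flux_le hab.ge hs hsc hf
  set W := hypergeomFlux a b c f₁
  have hconst : ∀ x ∈ Ioo (0 : ℝ) 1, ∀ y ∈ Ioo (0 : ℝ) 1, W x = W y := by
    intro x hx y hy
    refine isOpen_Ioo.is_const_of_deriv_eq_zero isPreconnected_Ioo
      (fun t ht => (h.hasDerivAt_flux ht).differentiableAt.differentiableWithinAt)
      (fun t ht => ?_) hx hy
    rw [(h.hasDerivAt_flux ht).deriv, hab]; simp
  have hhalf : (1 / 2 : ℝ) ∈ Ioo (0 : ℝ) 1 := ⟨by norm_num, by norm_num⟩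
  have hz : |W (1 / 2)| ≤ 0 := by
    have hz : Tendsto (fun x : ℝ => K * x ^ (c - s)) (𝓝[>] 0) (𝓝 (K * 0)) :=
      (tendsto_rpow_zero (by linarith)).const_mul _
    rw [mul_zero] at hz
    refine ge_of_tendsto hz ?_
    filter_upwards [Ioo_mem_nhdsGT (show (0 : ℝ) < 1 / 2 by norm_num)] with x hx
    rw [hconst (1 / 2) hhalf x ⟨hx.1, by linarith [hx.2]⟩]
    exact hK x ⟨hx.1, hx.2.le⟩
  have hW0 : W (1 / 2) = 0 := abs_nonpos_iff.1 hz
  have hf1 : ∀ t ∈ Ioo (0 : ℝ) 1, f₁ t = 0 := by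
    intro t ht
    have h1 : W t = 0 := by rw [hconst t ht (1 / 2) hhalf, hW0]
    have p1 : 0 < t ^ c * (1 - t) ^ (a + b - c + 1) :=
      mul_pos (Real.rpow_pos_of_pos ht.1 _) (Real.rpow_pos_of_pos (by linarith [ht.2]) _)
    exact (mul_eq_zero.1 h1).resolve_left p1.ne'
  intro t ht
  refine isOpen_Ioo.is_const_of_deriv_eq_zero isPreconnected_Ioo
    (fun t ht => (h.hasDerivAt t ht).differentiableAt.differentiableWithinAt)
    (fun t ht => ?_) ht hhalf
  rw [(h.hasDerivAt t ht).deriv, hf1 t ht]; rfl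

lemma deriv_bounded (h : IsHypergeomSol a b c f f₁) (hab : 0 ≤ a * b) (hc : 1 < c)
    (hf : ∀ t ∈ Ioc (0 : ℝ) (1 / 2), |f t| ≤ C) :
    ∃ C', ∀ t ∈ Ioc (0 : ℝ) (1 / 2), |f₁ t| ≤ C' := by
  obtain ⟨K, hK⟩ := h.abs_flux_le (s := 0) (C := C) hab le_rfl (by linarith) (by simpa using hf)
  obtain ⟨_, M, _, hM, hMb⟩ := exists_one_sub_rpow_bounds (-(a + b - c + 1))
  refine ⟨K * M, fun t ht => ?_⟩
  have p1 : 0 < t ^ c := Real.rpow_pos_of_pos ht.1 _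
  have p2 : 0 < (1 - t) ^ (a + b - c + 1) := Real.rpow_pos_of_pos (by linarith [ht.2]) _
  have h1 := hK t ht
  rw [sub_zero, hypergeomFlux, abs_mul, abs_mul, abs_of_pos p1, abs_of_pos p2, mul_assoc,
    mul_comm K, mul_le_mul_iff_right₀ p1] at h1
  have h2 := (hMb t ht).2
  rw [Real.rpow_neg (by linarith [ht.2])] at h2
  have hK0 : 0 ≤ K := (by positivity : (0 : ℝ) ≤ (1 - t) ^ (a + b - c + 1) * |f₁ t|).trans h1
  calc |f₁ t| = ((1 - t) ^ (a + b - c + 1) * |f₁ t|) * ((1 - t) ^ (a + b - c + 1))⁻¹ := by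
        field_simp
    _ ≤ K * M := mul_le_mul h1 h2 (by positivity) hK0

/-- A positive value forces the derivative to be at least a multiple of
`(1 - t) ^ (-(a + b - c + 1))` near `1`. -/
lemma deriv_lower_bound_of_pos (h : IsHypergeomSol a b c f f₁) (ha : 0 < a) (hb : 0 < b)
    (hc : 1 < c) (hf : ∀ t ∈ Ioc (0 : ℝ) (1 / 2), |f t| ≤ C) {t₁ : ℝ} (ht₁ : t₁ ∈ Ioo (0 : ℝ) 1)
    (hpos : 0 < f t₁) :
    ∃ ε > 0, ∃ t₀ ∈ Ioo (0 : ℝ) 1, ∀ t ∈ Ico t₀ 1, ε * (1 - t) ^ (-(a + b - c + 1)) ≤ f₁ t := by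
  have hab : 0 < a * b := mul_pos ha hb
  have hf' : ∀ t ∈ Ioc (0 : ℝ) (1 / 2), |f t| ≤ C * t ^ (-(0 : ℝ)) := by simpa using hf
  have hmono := h.abs_mono hab.le le_rfl (by linarith) (by linarith) hf'
  have hsub : ∀ t ∈ Ico t₁ 1, t ∈ Ioo (0 : ℝ) 1 := fun t ht => ⟨ht₁.1.trans_le ht.1, ht.2⟩
  have hfpos : ∀ t ∈ Ico t₁ 1, 0 < f t := by
    intro t ht
    by_contra hneg
    push Not at hneg
    obtain ⟨x, hx, hx0⟩ := intermediate_value_Icc' ht.1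
      (h.continuousOn.mono fun y hy => hsub y ⟨hy.1, hy.2.trans_lt ht.2⟩) ⟨hneg, hpos.le⟩
    have := hmono ht₁ (hsub x ⟨hx.1, hx.2.trans_lt ht.2⟩) hx.1
    simp only [hx0, abs_zero, abs_of_pos hpos] at this
    linarith
  -- Beyond `t₁` the solution is positive, so its flux is nonnegative and increasing.
  set W := hypergeomFlux a b c f₁
  have hWpos : ∀ t ∈ Ico t₁ 1, 0 ≤ W t := fun t ht =>
    nonneg_of_mul_nonneg_right (h.mul_flux_nonneg hab.le le_rfl (by linarith) (by linarith) hf'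
      (hsub t ht)) (hfpos t ht)
  have hWmono : StrictMonoOn W (Ico t₁ 1) := by
    refine strictMonoOn_of_deriv_pos (convex_Ico _ _)
      (fun t ht => (h.hasDerivAt_flux (hsub t ht)).continuousAt.continuousWithinAt) fun t ht => ?_
    have ht' := interior_subset ht
    rw [(h.hasDerivAt_flux (hsub t ht')).deriv]
    have p1 := hfpos t ht'
    have p2 : 0 < t ^ (c - 1) := Real.rpow_pos_of_pos (hsub t ht').1 _
    have p3 : 0 < (1 - t) ^ (a + b - c) := Real.rpow_pos_of_pos (by linarith [ht'.2]) _
    positivity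
  have hm1 : t₁ < (t₁ + 1) / 2 := by linarith [ht₁.2]
  have hm2 : (t₁ + 1) / 2 < 1 := by linarith [ht₁.2]
  refine ⟨W ((t₁ + 1) / 2), ?_, (t₁ + 1) / 2, ⟨by linarith [ht₁.1], hm2⟩, fun t ht => ?_⟩
  · exact (hWpos t₁ ⟨le_rfl, ht₁.2⟩).trans_lt (hWmono ⟨le_rfl, ht₁.2⟩ ⟨hm1.le, hm2⟩ hm1)
  · have ht1 : t ∈ Ico t₁ 1 := ⟨hm1.le.trans ht.1, ht.2⟩
    have ht0 := hsub t ht1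
    have h1 : W ((t₁ + 1) / 2) ≤ W t := hWmono.monotoneOn ⟨hm1.le, hm2⟩ ht1 ht.1
    have p2 : 0 < (1 - t) ^ (a + b - c + 1) := Real.rpow_pos_of_pos (by linarith [ht.2]) _
    have p1 : 0 < t ^ c := Real.rpow_pos_of_pos ht0.1 _
    have p3 : t ^ c ≤ 1 := Real.rpow_le_one ht0.1.le ht0.2.le (by linarith)
    have hf1 : 0 ≤ f₁ t := by
      have h2 := hWpos t ht1
      exact nonneg_of_mul_nonneg_right h2 (mul_pos p1 p2)
    rw [Real.rpow_neg (by linarith [ht.2]), ← div_eq_mul_inv, div_le_iff₀ p2]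
    calc W ((t₁ + 1) / 2) ≤ W t := h1
      _ = t ^ c * ((1 - t) ^ (a + b - c + 1) * f₁ t) := by simp only [W, hypergeomFlux]; ring
      _ ≤ 1 * ((1 - t) ^ (a + b - c + 1) * f₁ t) :=
          mul_le_mul_of_nonneg_right p3 (by positivity)
      _ = f₁ t * (1 - t) ^ (a + b - c + 1) := by ring

lemma deriv_lower_bound (h : IsHypergeomSol a b c f f₁) (ha : 0 < a) (hb : 0 < b)
    (hc : 1 < c) (hf : ∀ t ∈ Ioc (0 : ℝ) (1 / 2), |f t| ≤ C) {t₁ : ℝ} (ht₁ : t₁ ∈ Ioo (0 : ℝ) 1)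
    (hne : f t₁ ≠ 0) :
    ∃ σ : ℝ, |σ| = 1 ∧ ∃ ε > 0, ∃ t₀ ∈ Ioo (0 : ℝ) 1,
      ∀ t ∈ Ico t₀ 1, ε * (1 - t) ^ (-(a + b - c + 1)) ≤ σ * f₁ t := by
  rcases hne.lt_or_gt with hneg | hpos
  · obtain ⟨ε, hε, t₀, ht₀, hb⟩ := h.neg.deriv_lower_bound_of_pos ha hb hc (C := C)
      (by simpa using hf) ht₁ (by simpa using hneg)
    exact ⟨-1, by simp, ε, hε, t₀, ht₀, fun t ht => by simpa using hb t ht⟩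
  · obtain ⟨ε, hε, t₀, ht₀, hb⟩ := h.deriv_lower_bound_of_pos ha hb hc hf ht₁ hpos
    exact ⟨1, by simp, ε, hε, t₀, ht₀, fun t ht => by simpa using hb t ht⟩

end IsHypergeomSol

/-- The successive derivatives of a solution, computed from the differential equation: the `i`-th
pair is `(f⁽ⁱ⁾, f⁽ⁱ⁺¹⁾)`. -/
noncomputable def hypergeomDerivs (a b c : ℝ) (f f₁ : ℝ → ℝ) : ℕ → (ℝ → ℝ) × (ℝ → ℝ)
  | 0 => (f, f₁)
  | i + 1 => ((hypergeomDerivs a b c f f₁ i).2, fun t =>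
      ((a + i) * (b + i) * (hypergeomDerivs a b c f f₁ i).1 t -
        ((c + i) - ((a + i) + (b + i) + 1) * t) * (hypergeomDerivs a b c f f₁ i).2 t) /
        (t * (1 - t)))

namespace IsHypergeomSol

variable {a b c s C : ℝ} {f f₁ : ℝ → ℝ}

lemma hypergeomDerivs (h : IsHypergeomSol a b c f f₁) (i : ℕ) :
    IsHypergeomSol (a + i) (b + i) (c + i) (_root_.hypergeomDerivs a b c f f₁ i).1
      (_root_.hypergeomDerivs a b c f f₁ i).2 := by
  induction i with
  | zero => simpa [_root_.hypergeomDerivs] using h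
  | succ i ih =>
    have := ih.deriv
    push_cast
    simpa only [add_assoc, _root_.hypergeomDerivs] using this

/-- If `f⁽ᵐ⁾((1 + t) / 2) - f⁽ᵐ⁾(t) = o((1 - t) ^ γ)` at `1` with `γ = c - a - b - m`, then
the solution vanishes: otherwise `f⁽ᵐ⁺¹⁾` is at least a multiple of `(1 - t) ^ (γ - 1)`. -/
lemma eq_zero_of_isLittleO (h : IsHypergeomSol a b c f f₁) (ha : 0 < a) (hb : 0 < b)
    (hs : 0 ≤ s) (hsc : s < c - 1) (hsc' : 2 * s < c)
    (hf : ∀ t ∈ Ioc (0 : ℝ) (1 / 2), |f t| ≤ C * t ^ (-s)) {m : ℕ} {γ : ℝ} (hγ1 : γ ≤ 1)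
    (hγ : γ = c - a - b - m) {fs : ℕ → ℝ → ℝ} (hfs0 : ∀ t ∈ Ioo (0 : ℝ) 1, fs 0 t = f t)
    (hfs : ∀ i < m, ∀ t ∈ Ioo (0 : ℝ) 1, HasDerivAt (fs i) (fs (i + 1) t) t)
    (ho : (fun t => fs m ((1 + t) / 2) - fs m t) =o[𝓝[<] 1] fun t : ℝ => (1 - t) ^ γ) :
    ∀ t ∈ Ioo (0 : ℝ) 1, f t = 0 := by
  by_contra hcon
  push Not at hcon
  obtain ⟨t₁, ht₁, hne⟩ := hcon
  have hbd := h.bounded_of_growth (mul_pos ha hb).le hs hsc hsc' hf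
  have hc : 1 < c := by linarith
  -- Each derivative of `f` is again a bounded nonzero solution, with shifted parameters, so that
  -- `deriv_lower_bound` applies to all of them.
  set g := _root_.hypergeomDerivs a b c f f₁ with hg
  have hsol := h.hypergeomDerivs
  have key : ∀ i : ℕ, (∃ C', ∀ t ∈ Ioc (0 : ℝ) (1 / 2), |(g i).1 t| ≤ C') ∧
      ∃ t ∈ Ioo (0 : ℝ) 1, (g i).1 t ≠ 0 := by
    intro i
    induction i with
    | zero => exact ⟨⟨_, hbd⟩, t₁, ht₁, hne⟩
    | succ i ih =>
      obtain ⟨⟨C', hC'⟩, t, ht, htne⟩ := ih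
      have hai : 0 < a + i := by positivity
      have hbi : 0 < b + i := by positivity
      have hci : 1 < c + i := by have : (0 : ℝ) ≤ i := i.cast_nonneg; linarith
      refine ⟨(hsol i).deriv_bounded (mul_pos hai hbi).le hci hC', ?_⟩
      obtain ⟨σ, hσ, ε, hε, t₀, ht₀, hb⟩ := (hsol i).deriv_lower_bound hai hbi hci hC' ht htne
      refine ⟨t₀, ht₀, fun h0 => ?_⟩
      have h1 := hb t₀ ⟨le_rfl, ht₀.2⟩
      have h2 : (g i).2 t₀ = 0 := h0
      rw [h2, mul_zero] at h1
      have := mul_pos hε (Real.rpow_pos_of_pos (sub_pos.2 ht₀.2)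
        (-(a + i + (b + i) - (c + i) + 1)))
      linarith
  have hfsg : ∀ i ≤ m, ∀ t ∈ Ioo (0 : ℝ) 1, fs i t = (g i).1 t := by
    intro i
    induction i with
    | zero => exact fun _ t ht => hfs0 t ht
    | succ i ih =>
      intro hi t ht
      have h1 := hfs i (by omega) t ht
      have h2 : HasDerivAt (fs i) ((g i).2 t) t := by
        refine ((hsol i).hasDerivAt t ht).congr_of_eventuallyEq ?_
        filter_upwards [isOpen_Ioo.mem_nhds ht] with x hx
        exact ih (by omega) x hx
      exact h1.unique h2
  obtain ⟨⟨C', hC'⟩, t, ht, htne⟩ := key m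
  obtain ⟨σ, hσ, ε, hε, t₀, ht₀, hbl⟩ := (hsol m).deriv_lower_bound (by positivity) (by positivity)
    (by have : (0 : ℝ) ≤ m := m.cast_nonneg; linarith) hC' ht htne
  have hexp : -(a + m + (b + m) - (c + m) + 1) = γ - 1 := by rw [hγ]; ring
  rw [hexp] at hbl
  have hev := (ho.def (show 0 < ε / 4 by positivity)).and (Ioo_mem_nhdsLT ht₀.2)
  obtain ⟨x, hx, hx0⟩ := hev.exists
  have hx1 : x < (1 + x) / 2 := by linarith [hx0.2]
  have hx2 : (1 + x) / 2 < 1 := by linarith [hx0.2]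
  have hxI : ∀ y ∈ Icc x ((1 + x) / 2), y ∈ Ioo (0 : ℝ) 1 := fun y hy =>
    ⟨ht₀.1.trans (hx0.1.trans_le hy.1), hy.2.trans_lt hx2⟩
  -- The mean value theorem on `[x, (1 + x) / 2]` gives an increment of at least
  -- `(ε / 2) (1 - x) ^ γ`, twice what the hypothesis allows.
  obtain ⟨ξ, hξ, hξe⟩ := exists_hasDerivAt_eq_slope (g m).1 (g m).2 hx1
    ((hsol m).continuousOn.mono hxI) fun y hy => (hsol m).hasDerivAt y (hxI y ⟨hy.1.le, hy.2.le⟩)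
  rw [hfsg m le_rfl _ (hxI _ ⟨hx1.le, le_rfl⟩), hfsg m le_rfl _ (hxI _ ⟨le_rfl, hx1.le⟩)] at hx
  have hp : 0 < (1 - x) ^ γ := Real.rpow_pos_of_pos (by linarith) _
  rw [Real.norm_of_nonneg hp.le, Real.norm_eq_abs] at hx
  have hd : (g m).1 ((1 + x) / 2) - (g m).1 x = (g m).2 ξ * ((1 - x) / 2) := by
    rw [hξe, show (1 + x) / 2 - x = (1 - x) / 2 by ring, div_mul_cancel₀ _ (by linarith)]
  have h1 := hbl ξ ⟨hx0.1.le.trans hξ.1.le, hξ.2.trans hx2⟩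
  have h2 : σ * (g m).2 ξ ≤ |(g m).2 ξ| := by
    refine (le_abs_self _).trans_eq ?_
    rw [abs_mul, hσ, one_mul]
  have h3 : (1 - x) ^ (γ - 1) ≤ (1 - ξ) ^ (γ - 1) :=
    Real.rpow_le_rpow_of_nonpos (by linarith [hξ.2]) (by linarith [hξ.1]) (by linarith)
  have h4 : ε * (1 - x) ^ (γ - 1) ≤ |(g m).2 ξ| :=
    (mul_le_mul_of_nonneg_left h3 hε.le).trans (h1.trans h2)
  have h5 : (1 - x) ^ γ = (1 - x) ^ (γ - 1) * (1 - x) := by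
    rw [← Real.rpow_add_one (by linarith : (1 - x) ≠ 0)]; ring_nf
  have hpx : 0 < (1 - x) / 2 := by linarith
  rw [hd, abs_mul, abs_of_pos hpx] at hx
  have h6 := mul_le_mul_of_nonneg_right h4 hpx.le
  have : ε / 2 * (1 - x) ^ γ ≤ ε / 4 * (1 - x) ^ γ := by
    calc ε / 2 * (1 - x) ^ γ = ε * (1 - x) ^ (γ - 1) * ((1 - x) / 2) := by rw [h5]; ring
      _ ≤ _ := h6.trans hx
  nlinarith

end IsHypergeomSol

/-! ### Integrals over spheres -/

section sphere

variable {n : ℕ}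

/-- The unit sphere of `ℂⁿ`. -/
abbrev USphere (n : ℕ) := sphere (0 : EuclideanSpace ℂ (Fin n)) 1

/-- The surface measure on the unit sphere of `ℂⁿ`. -/
noncomputable abbrev surf (n : ℕ) : Measure (USphere n) :=
  (volume : Measure (EuclideanSpace ℂ (Fin n))).toSphere

lemma smul_mem_ball {ρ : ℝ} (hρ : ρ ∈ Ioo (0 : ℝ) 1) (ζ : USphere n) :
    ρ • (ζ : EuclideanSpace ℂ (Fin n)) ∈ ball (0 : EuclideanSpace ℂ (Fin n)) 1 := by
  rw [mem_ball_zero_iff, norm_smul, norm_eq_of_mem_sphere, mul_one, Real.norm_of_nonneg hρ.1.le]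
  exact hρ.2

lemma continuousOn_integral_sphere {K : ℝ → USphere n → ℂ}
    (hK : ContinuousOn (Function.uncurry K) (Ioo 0 1 ×ˢ univ)) :
    ContinuousOn (fun ρ => ∫ ζ, K ρ ζ ∂(surf n)) (Ioo 0 1) := by
  rw [continuousOn_iff_continuous_domRestrict]
  have hc : Continuous (Function.uncurry fun (ρ : Ioo (0 : ℝ) 1) (ζ : USphere n) => K ρ ζ) :=
    hK.comp_continuous (f := fun x : Ioo (0 : ℝ) 1 × USphere n => ((x.1 : ℝ), x.2))
      (by fun_prop) fun x => ⟨x.1.2, mem_univ _⟩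
  have : LocallyCompactSpace (Ioo (0 : ℝ) 1) := isOpen_Ioo.locallyCompactSpace
  have := continuous_parametric_integral_of_continuous (μ := surf n) hc isCompact_univ
  simpa only [Measure.restrict_univ] using! this

lemma hasDerivAt_integral_sphere {K K' : ℝ → USphere n → ℂ}
    (hK : ContinuousOn (Function.uncurry K) (Ioo 0 1 ×ˢ univ))
    (hK' : ContinuousOn (Function.uncurry K') (Ioo 0 1 ×ˢ univ))
    (hd : ∀ ρ ∈ Ioo (0 : ℝ) 1, ∀ ζ, HasDerivAt (fun r => K r ζ) (K' ρ ζ) ρ)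
    {ρ : ℝ} (hρ : ρ ∈ Ioo (0 : ℝ) 1) :
    HasDerivAt (fun r => ∫ ζ, K r ζ ∂(surf n)) (∫ ζ, K' ρ ζ ∂(surf n)) ρ := by
  obtain ⟨a, b, hab, hsub⟩ : ∃ a b, ρ ∈ Ioo a b ∧ Icc a b ⊆ Ioo (0 : ℝ) 1 :=
    ⟨ρ / 2, (ρ + 1) / 2, ⟨by linarith [hρ.1], by linarith [hρ.2]⟩,
      fun x hx => ⟨by linarith [hx.1, hρ.1], by linarith [hx.2, hρ.2]⟩⟩
  have hcomp : IsCompact (Icc a b ×ˢ (univ : Set (USphere n))) := isCompact_Icc.prod isCompact_univ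
  obtain ⟨M, hM⟩ := hcomp.exists_bound_of_continuousOn (hK'.mono (prod_mono_left hsub))
  have hslice : ∀ {G : ℝ → USphere n → ℂ}, ContinuousOn (Function.uncurry G) (Ioo 0 1 ×ˢ univ) →
      ∀ r ∈ Ioo (0 : ℝ) 1, Continuous (G r) := fun hG r hr =>
    hG.comp_continuous (f := fun ζ : USphere n => (r, ζ)) (by fun_prop) fun ζ => ⟨hr, mem_univ _⟩
  refine (hasDerivAt_integral_of_dominated_loc_of_deriv_le (s := Ioo a b) (bound := fun _ => M)
    (Ioo_mem_nhds hab.1 hab.2) ?_ ?_ ?_ ?_ ?_ ?_).2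
  · filter_upwards [isOpen_Ioo.mem_nhds hρ] with r hr
    exact (hslice hK r hr).aestronglyMeasurable
  · exact (hslice hK ρ hρ).integrable_of_hasCompactSupport (HasCompactSupport.of_compactSpace _)
  · exact (hslice hK' ρ hρ).aestronglyMeasurable
  · exact Eventually.of_forall fun ζ r hr => hM (r, ζ) ⟨⟨hr.1.le, hr.2.le⟩, mem_univ _⟩
  · exact integrable_const _
  · exact Eventually.of_forall fun ζ r hr => hd r (hsub ⟨hr.1.le, hr.2.le⟩) ζ

lemma finrank_real_euclidean : Module.finrank ℝ (EuclideanSpace ℂ (Fin n)) = 2 * n := by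
  rw [finrank_real_of_complex, finrank_euclideanSpace_fin]

/-- Integration in polar coordinates. -/
lemma integral_polar (hn : 1 ≤ n) {g : EuclideanSpace ℂ (Fin n) → ℂ} (hg : Integrable g) :
    ∫ z, g z = ∫ ρ in Ioi (0 : ℝ), ρ ^ (2 * n - 1) • ∫ ζ : USphere n, g (ρ • ζ) ∂(surf n) := by
  have : Nonempty (Fin n) := ⟨⟨0, hn⟩⟩
  have hmp :=
    (volume : Measure (EuclideanSpace ℂ (Fin n))).measurePreserving_homeomorphUnitSphereProd
  rw [finrank_real_euclidean] at hmp
  have hcomp : ∀ x : ({(0 : EuclideanSpace ℂ (Fin n))}ᶜ : Set (EuclideanSpace ℂ (Fin n))),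
      (fun y : USphere n × Ioi (0 : ℝ) => g ((y.2 : ℝ) • (y.1 : EuclideanSpace ℂ (Fin n))))
        (homeomorphUnitSphereProd (EuclideanSpace ℂ (Fin n)) x) = g x := by
    intro x
    have hx : ‖(x : EuclideanSpace ℂ (Fin n))‖ ≠ 0 := norm_ne_zero_iff.2 x.2
    simp [smul_smul, mul_inv_cancel₀ hx]
  have hint : Integrable
      (fun y : USphere n × Ioi (0 : ℝ) => g ((y.2 : ℝ) • (y.1 : EuclideanSpace ℂ (Fin n))))
      ((surf n).prod (.volumeIoiPow (2 * n - 1))) := by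
    rw [← hmp.integrable_comp_emb (Homeomorph.measurableEmbedding _)]
    have : ((fun y : USphere n × Ioi (0 : ℝ) => g ((y.2 : ℝ) • (y.1 : EuclideanSpace ℂ (Fin n)))) ∘
        (homeomorphUnitSphereProd (EuclideanSpace ℂ (Fin n)))) =
        fun x : ({(0 : EuclideanSpace ℂ (Fin n))}ᶜ : Set (EuclideanSpace ℂ (Fin n))) => g x :=
      funext hcomp
    rw [this]
    have hI : IntegrableOn g ({(0 : EuclideanSpace ℂ (Fin n))}ᶜ) := hg.integrableOn
    exact (integrableOn_iff_comap_subtypeVal (measurableSet_singleton _).compl).1 hI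
  calc ∫ z, g z =
        ∫ x : ({(0 : EuclideanSpace ℂ (Fin n))}ᶜ : Set (EuclideanSpace ℂ (Fin n))), g x
          ∂((volume : Measure (EuclideanSpace ℂ (Fin n))).comap (↑)) := by
        rw [integral_subtype_comap (measurableSet_singleton _).compl g, restrict_compl_singleton]
    _ = ∫ y : USphere n × Ioi (0 : ℝ), g ((y.2 : ℝ) • (y.1 : EuclideanSpace ℂ (Fin n)))
          ∂((surf n).prod (.volumeIoiPow (2 * n - 1))) := by
        rw [← hmp.integral_comp (Homeomorph.measurableEmbedding _)]
        exact integral_congr_ae (Eventually.of_forall fun x => (hcomp x).symm)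
    _ = ∫ r : Ioi (0 : ℝ), (∫ ζ : USphere n, g ((r : ℝ) • (ζ : EuclideanSpace ℂ (Fin n))) ∂(surf n))
          ∂(.volumeIoiPow (2 * n - 1)) := integral_prod_symm _ hint
    _ = _ := by
        simp only [Measure.volumeIoiPow, ENNReal.ofReal]
        rw [integral_withDensity_eq_integral_smul,
          integral_subtype_comap measurableSet_Ioi fun a : ℝ => Real.toNNReal (a ^ (2 * n - 1)) •
            ∫ ζ : USphere n, g (a • (ζ : EuclideanSpace ℂ (Fin n))) ∂(surf n)]
        · refine setIntegral_congr_fun measurableSet_Ioi fun x hx => ?_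
          rw [NNReal.smul_def, Real.coe_toNNReal _ (pow_nonneg (le_of_lt hx) _)]
        · exact (measurable_subtype_coe.pow_const _).real_toNNReal

end sphere

lemma IsBihom.ev_smul {n p q : ℕ} {P : ZPoly n} (hP : IsBihom p q P) (ρ : ℝ)
    (z : EuclideanSpace ℂ (Fin n)) : ev P (ρ • z) = (ρ : ℂ) ^ (p + q) * ev P z := by
  rw [ev, ev, eval_eq', eval_eq', Finset.mul_sum]
  refine Finset.sum_congr rfl fun d hd => ?_
  have hd' : Finsupp.weight (biweight n) d = (p, q) := hP (mem_support_iff.1 hd)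
  have hx : ∀ i, (Sum.elim (fun j => (ρ • z) j) (fun j => conj ((ρ • z) j)) : Fin n ⊕ Fin n → ℂ) i
      = ρ * Sum.elim (fun j => z j) (fun j => conj (z j)) i := by
    rintro (i | i) <;> simp
  have hsum : ∑ i, d i = p + q := by
    have h1 := congrArg Prod.fst hd'
    have h2 := congrArg Prod.snd hd'
    rw [weight_fst] at h1
    rw [weight_snd] at h2
    rw [Finsupp.weight_apply, Finsupp.sum_fintype _ _ (by simp)] at h1 h2
    rw [Fintype.sum_sum_type] at h1 h2 ⊢
    simp [biweight] at h1 h2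
    rw [h1, h2]
  simp only [hx, mul_pow, Finset.prod_mul_distrib, Finset.prod_pow_eq_pow_sum, hsum]
  ring

/-- The `i`-th derivative in `ρ` of the moment `∫ u(ρζ) P(ζ) dσ(ζ)` over the unit sphere. -/
noncomputable def moment {n : ℕ} (u : EuclideanSpace ℂ (Fin n) → ℂ) (P : ZPoly n) (i : ℕ) (ρ : ℝ) :
    ℂ :=
  ∫ ζ : USphere n, iteratedFDeriv ℝ i u (ρ • (ζ : EuclideanSpace ℂ (Fin n)))
    (fun _ => (ζ : EuclideanSpace ℂ (Fin n))) * ev P ζ ∂(surf n)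

section moment

variable {n : ℕ} {u : EuclideanSpace ℂ (Fin n) → ℂ} {m : ℕ} {P : ZPoly n}

lemma moment_zero (ρ : ℝ) : moment u P 0 ρ =
    ∫ ζ : USphere n, u (ρ • (ζ : EuclideanSpace ℂ (Fin n))) * ev P ζ ∂(surf n) := by
  simp [moment]

lemma continuousOn_iteratedFDeriv_ball (hu : ContDiffOn ℝ m u (ball 0 1)) {i : ℕ} (hi : i ≤ m) :
    ContinuousOn (iteratedFDeriv ℝ i u) (ball 0 1) :=
  (hu.continuousOn_iteratedFDerivWithin (by exact_mod_cast hi) isOpen_ball.uniqueDiffOn).congr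
    fun _ hx => (iteratedFDerivWithin_of_isOpen i isOpen_ball hx).symm

lemma differentiableAt_iteratedFDeriv_ball (hu : ContDiffOn ℝ m u (ball 0 1)) {i : ℕ} (hi : i < m)
    {x : EuclideanSpace ℂ (Fin n)} (hx : x ∈ ball (0 : EuclideanSpace ℂ (Fin n)) 1) :
    DifferentiableAt ℝ (iteratedFDeriv ℝ i u) x := by
  have h1 := (hu.differentiableOn_iteratedFDerivWithin (by exact_mod_cast hi)
    isOpen_ball.uniqueDiffOn).differentiableAt (isOpen_ball.mem_nhds hx)
  refine h1.congr_of_eventuallyEq ?_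
  filter_upwards [isOpen_ball.mem_nhds hx] with y hy
  exact (iteratedFDerivWithin_of_isOpen i isOpen_ball hy).symm

lemma continuousOn_moment_kernel (hu : ContDiffOn ℝ m u (ball 0 1)) {i : ℕ} (hi : i ≤ m) :
    ContinuousOn (Function.uncurry fun (ρ : ℝ) (ζ : USphere n) =>
      iteratedFDeriv ℝ i u (ρ • (ζ : EuclideanSpace ℂ (Fin n)))
        (fun _ => (ζ : EuclideanSpace ℂ (Fin n))) * ev P ζ) (Ioo 0 1 ×ˢ univ) := by
  have h1 : ContinuousOn (fun x : ℝ × USphere n =>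
      iteratedFDeriv ℝ i u (x.1 • (x.2 : EuclideanSpace ℂ (Fin n)))) (Ioo 0 1 ×ˢ univ) :=
    (continuousOn_iteratedFDeriv_ball hu hi).comp (by fun_prop) fun x hx => smul_mem_ball hx.1 _
  have h2 : ContinuousOn (fun x : ℝ × USphere n =>
      (fun _ : Fin i => (x.2 : EuclideanSpace ℂ (Fin n)))) (Ioo 0 1 ×ˢ univ) := by fun_prop
  have h3 : Continuous fun x : ℝ × USphere n => ev P (x.2 : EuclideanSpace ℂ (Fin n)) :=
    (continuous_ev P).comp (by fun_prop)
  exact (h1.eval h2).mul h3.continuousOn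

lemma continuousOn_moment (hu : ContDiffOn ℝ m u (ball 0 1)) {i : ℕ} (hi : i ≤ m) :
    ContinuousOn (moment u P i) (Ioo 0 1) :=
  continuousOn_integral_sphere (continuousOn_moment_kernel hu hi)

lemma hasDerivAt_moment (hu : ContDiffOn ℝ m u (ball 0 1)) {i : ℕ} (hi : i < m) {ρ : ℝ}
    (hρ : ρ ∈ Ioo (0 : ℝ) 1) : HasDerivAt (moment u P i) (moment u P (i + 1) ρ) ρ := by
  refine hasDerivAt_integral_sphere (continuousOn_moment_kernel hu hi.le)
    (continuousOn_moment_kernel hu hi) (fun r hr ζ => ?_) hρ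
  refine HasDerivAt.mul_const ?_ _
  have h1 : HasDerivAt (fun r : ℝ => r • (ζ : EuclideanSpace ℂ (Fin n)))
      ((1 : ℝ) • (ζ : EuclideanSpace ℂ (Fin n))) r := (hasDerivAt_id r).smul_const _
  have h2 := (differentiableAt_iteratedFDeriv_ball hu hi
    (smul_mem_ball hr ζ)).hasFDerivAt.comp_hasDerivAt r h1
  have h3 := ((ContinuousMultilinearMap.apply ℝ (fun _ : Fin i => EuclideanSpace ℂ (Fin n)) ℂ
    (fun _ => (ζ : EuclideanSpace ℂ (Fin n)))).hasFDerivAt).comp_hasDerivAt r h2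
  rw [one_smul] at h3
  exact h3

end moment

/-- Integration against `φ(|z|⁴) P` in the radial variable `t = |z|⁴`. -/
lemma integral_mul_radialMul {n : ℕ} (hn : 1 ≤ n) {u : EuclideanSpace ℂ (Fin n) → ℂ}
    (hu : ContinuousOn u (ball 0 1)) {φ : ℝ → ℝ} (hφ : IsRadialTest φ) {p q : ℕ} {P : ZPoly n}
    (hP : IsBihom p q P) :
    ∫ z, u z * radialMul φ P z = ∫ t in Ioi (0 : ℝ),
      ((1 / 4 * t ^ ((p + q + 2 * n : ℝ) / 4 - 1) * φ t : ℝ) : ℂ) *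
        moment u P 0 (t ^ (1 / 4 : ℝ)) := by
  rw [integral_polar hn (integrable_mul_of_tsupport hu (contDiff_radialMul hφ.smooth P).continuous
    (hφ.tsupport_subset P)), ← integral_comp_rpow_Ioi_of_pos (p := (1 / 4 : ℝ)) (by norm_num)]
  refine setIntegral_congr_fun measurableSet_Ioi fun t ht => ?_
  have ht : 0 < t := ht
  set ρ := t ^ (1 / 4 : ℝ) with hρ
  have hρ0 : 0 < ρ := Real.rpow_pos_of_pos ht _
  have hρ4 : ρ ^ 4 = t := by
    rw [hρ, ← Real.rpow_natCast, ← Real.rpow_mul ht.le]; norm_num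
  have h1 : ∀ ζ : USphere n, u (ρ • (ζ : EuclideanSpace ℂ (Fin n))) *
      radialMul φ P (ρ • (ζ : EuclideanSpace ℂ (Fin n))) =
      ((φ t : ℂ) * (ρ : ℂ) ^ (p + q)) *
        (u (ρ • (ζ : EuclideanSpace ℂ (Fin n))) * ev P ζ) := by
    intro ζ
    rw [radialMul, norm_smul, norm_eq_of_mem_sphere, mul_one, Real.norm_of_nonneg hρ0.le, hρ4,
      hP.ev_smul]
    ring
  simp only [h1, integral_const_mul, ← moment_zero, Complex.real_smul]
  have h2 : (t : ℝ) ^ ((p + q + 2 * n : ℝ) / 4 - 1) =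
      t ^ (1 / 4 - 1 : ℝ) * ρ ^ (2 * n - 1) * ρ ^ (p + q) := by
    rw [hρ, ← Real.rpow_natCast, ← Real.rpow_natCast, ← Real.rpow_mul ht.le, ← Real.rpow_mul ht.le,
      ← Real.rpow_add ht, ← Real.rpow_add ht, Nat.cast_sub (by omega)]
    push_cast
    ring_nf
  rw [h2]
  push_cast
  ring

/-! ### The radial profile and its equation -/

/-- The function `t ^ (-s) F(t ^ (1/4))`. With `F` the moment of `u` against a harmonic polynomial
of total degree `4 s`, this is the radial factor of the corresponding component of `u`, in the
variable `t = |z|⁴`. -/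
noncomputable def radialProfile (s : ℝ) (F : ℝ → ℂ) (t : ℝ) : ℂ :=
  ((t ^ (-s) : ℝ) : ℂ) * F (t ^ (1 / 4 : ℝ))

lemma rpow_quarter_mem {t : ℝ} (ht : t ∈ Ioo (0 : ℝ) 1) : t ^ (1 / 4 : ℝ) ∈ Ioo (0 : ℝ) 1 :=
  ⟨Real.rpow_pos_of_pos ht.1 _, Real.rpow_lt_one ht.1.le ht.2 (by norm_num)⟩

/-- `g` is a combination of `F₀, …, F_j` at `t ^ (1/4)`, with coefficients smooth on `(0, ∞)`. -/
def IsProfileComb (F : ℕ → ℝ → ℂ) (j : ℕ) (g : ℝ → ℂ) : Prop :=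
  ∃ c : ℕ → ℝ → ℝ, (∀ i, ContDiffOn ℝ ∞ (c i) (Ioi 0)) ∧ ∀ t ∈ Ioo (0 : ℝ) 1,
    g t = ∑ i ∈ Finset.range (j + 1), (c i t : ℂ) * F i (t ^ (1 / 4 : ℝ))

section profile

variable {F : ℕ → ℝ → ℂ} {m j : ℕ} {s : ℝ} {g : ℝ → ℂ}

lemma contDiffOn_rpow_Ioi (y : ℝ) : ContDiffOn ℝ ∞ (fun t : ℝ => t ^ y) (Ioi 0) :=
  fun _ ht => (Real.contDiffAt_rpow_const_of_ne (ne_of_gt ht)).contDiffWithinAt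

lemma isProfileComb_radialProfile : IsProfileComb F 0 (radialProfile s (F 0)) :=
  ⟨fun _ t => t ^ (-s), fun _ => contDiffOn_rpow_Ioi _, by simp [radialProfile]⟩

lemma IsProfileComb.congr (h : IsProfileComb F j g) {g' : ℝ → ℂ}
    (hg : ∀ t ∈ Ioo (0 : ℝ) 1, g' t = g t) : IsProfileComb F j g' := by
  obtain ⟨c, hc, he⟩ := h
  exact ⟨c, hc, fun t ht => (hg t ht).trans (he t ht)⟩

lemma IsProfileComb.exists_deriv (h : IsProfileComb F j g) (hj : j < m)
    (hF : ∀ i < m, ∀ ρ ∈ Ioo (0 : ℝ) 1, HasDerivAt (F i) (F (i + 1) ρ) ρ) :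
    ∃ g', (∀ t ∈ Ioo (0 : ℝ) 1, HasDerivAt g (g' t) t) ∧ IsProfileComb F (j + 1) g' := by
  obtain ⟨c, hc, he⟩ := h
  set g' : ℝ → ℂ := fun t => ∑ i ∈ Finset.range (j + 1), (((deriv (c i) t : ℝ) : ℂ) *
    F i (t ^ (1 / 4 : ℝ)) + (c i t : ℂ) *
      (((1 / 4 * t ^ (1 / 4 - 1 : ℝ) : ℝ) : ℂ) * F (i + 1) (t ^ (1 / 4 : ℝ)))) with hg'
  refine ⟨g', fun t ht => ?_, ?_⟩
  · have h1 : HasDerivAt (fun t => ∑ i ∈ Finset.range (j + 1), (c i t : ℂ) * F i (t ^ (1 / 4 : ℝ)))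
        (g' t) t := by
      refine HasDerivAt.fun_sum fun i hi => ?_
      have hci : HasDerivAt (c i) (deriv (c i) t) t :=
        (((hc i).contDiffAt (Ioi_mem_nhds ht.1)).differentiableAt (by simp)).hasDerivAt
      have hr : HasDerivAt (fun t : ℝ => t ^ (1 / 4 : ℝ)) (1 / 4 * t ^ (1 / 4 - 1 : ℝ)) t :=
        Real.hasDerivAt_rpow_const (Or.inl ht.1.ne')
      have hFi := (hF i (by simp at hi; omega) _ (rpow_quarter_mem ht)).scomp t hr
      exact hci.ofReal_comp.mul hFi
    refine h1.congr_of_eventuallyEq ?_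
    filter_upwards [isOpen_Ioo.mem_nhds ht] with x hx using he x hx
  · refine ⟨fun i t => (if i < j + 1 then deriv (c i) t else 0) +
      (if i = 0 then 0 else c (i - 1) t * (1 / 4 * t ^ (1 / 4 - 1 : ℝ))), fun i => ?_,
      fun t ht => ?_⟩
    · refine ContDiffOn.add ?_ ?_
      · split_ifs
        · exact (hc i).deriv_of_isOpen isOpen_Ioi (by simp)
        · exact contDiffOn_const
      · split_ifs
        · exact contDiffOn_const
        · exact (hc _).mul (contDiffOn_const.mul (contDiffOn_rpow_Ioi _))
    · simp only [Complex.ofReal_add, add_mul, Finset.sum_add_distrib, hg']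
      congr 1
      · rw [Finset.sum_range_succ (n := j + 1)]
        simp only [lt_irrefl, if_false, Complex.ofReal_zero, zero_mul, add_zero]
        exact Finset.sum_congr rfl fun i hi => by rw [if_pos (Finset.mem_range.1 hi)]
      · rw [Finset.sum_range_succ' (n := j + 1)]
        simp
        exact Finset.sum_congr rfl fun i _ => by ring

lemma isProfileComb_iteratedDeriv
    (hF : ∀ i < m, ∀ ρ ∈ Ioo (0 : ℝ) 1, HasDerivAt (F i) (F (i + 1) ρ) ρ) (hj : j ≤ m) :
    IsProfileComb F j (iteratedDeriv j (radialProfile s (F 0))) := by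
  induction j with
  | zero => rw [iteratedDeriv_zero]; exact isProfileComb_radialProfile
  | succ j ih =>
    obtain ⟨g', hg', hc⟩ := (ih (by omega)).exists_deriv (by omega) hF
    refine hc.congr fun t ht => ?_
    rw [iteratedDeriv_succ, (hg' t ht).deriv]

lemma hasDerivAt_iteratedDeriv_profile
    (hF : ∀ i < m, ∀ ρ ∈ Ioo (0 : ℝ) 1, HasDerivAt (F i) (F (i + 1) ρ) ρ) (hj : j < m) {t : ℝ}
    (ht : t ∈ Ioo (0 : ℝ) 1) :
    HasDerivAt (iteratedDeriv j (radialProfile s (F 0)))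
      (iteratedDeriv (j + 1) (radialProfile s (F 0)) t) t := by
  obtain ⟨g', hg', -⟩ := (isProfileComb_iteratedDeriv (s := s) hF hj.le).exists_deriv hj hF
  rw [iteratedDeriv_succ]
  exact (hg' t ht).differentiableAt.hasDerivAt

lemma IsProfileComb.continuousOn (h : IsProfileComb F j g)
    (hF : ∀ i ≤ j, ContinuousOn (F i) (Ioo 0 1)) : ContinuousOn g (Ioo 0 1) := by
  obtain ⟨c, hc, he⟩ := h
  refine ContinuousOn.congr (continuousOn_finsetSum _ fun i hi => ?_) he
  refine ContinuousOn.mul (Complex.continuous_ofReal.comp_continuousOn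
    ((hc i).continuousOn.mono Ioo_subset_Ioi_self)) ?_
  exact (hF i (by simp at hi; omega)).comp
    ((contDiffOn_rpow_Ioi _).continuousOn.mono Ioo_subset_Ioi_self) fun t ht => rpow_quarter_mem ht

end profile

lemma isRadialTest_of_tsupport {g : ℝ → ℝ} (hg : ContDiff ℝ ∞ g) (hc : HasCompactSupport g)
    (hs : tsupport g ⊆ Ioo 0 1) : IsRadialTest g := by
  refine ⟨hg, ?_⟩
  rcases (tsupport g).eq_empty_or_nonempty with he | hne
  · refine ⟨1 / 3, 1 / 2, by norm_num, by norm_num, by norm_num, fun t ht => ?_⟩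
    exact absurd (subset_tsupport g ht) (by simp [he])
  · have h1 := (IsCompact.isLeast_sInf hc hne)
    have h2 := (IsCompact.isGreatest_sSup hc hne)
    have h3 := hs h1.1
    have h4 := hs h2.1
    have h5 := h1.2 h2.1
    refine ⟨sInf (tsupport g) / 2, sSup (tsupport g), by linarith [h3.1], by linarith [h3.1],
      h4.2, fun t ht => ?_⟩
    have := h1.2 (subset_tsupport g ht)
    exact ⟨by linarith [h3.1], h2.2 (subset_tsupport g ht)⟩

/-- A twice differentiable function solving the hypergeometric equation weakly solves it
pointwise. -/
lemma hypergeom_of_weak {a b c : ℝ} {f f₁ f₂ : ℝ → ℂ}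
    (h₁ : ∀ t ∈ Ioo (0 : ℝ) 1, HasDerivAt f (f₁ t) t)
    (h₂ : ∀ t ∈ Ioo (0 : ℝ) 1, HasDerivAt f₁ (f₂ t) t) (hc₂ : ContinuousOn f₂ (Ioo 0 1))
    (hw : ∀ χ : ℝ → ℝ, IsRadialTest χ → ∫ t in Ioi (0 : ℝ), ((t ^ (c - 1) *
      (t * (1 - t) * deriv (deriv χ) t + (c - (1 + 2 * c - a - b) * t) * deriv χ t
        - (c - a) * (c - b) * χ t) : ℝ) : ℂ) * f t = 0) :
    ∀ t ∈ Ioo (0 : ℝ) 1,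
      t * (1 - t) * f₂ t + (c - (a + b + 1) * t) * f₁ t - a * b * f t = 0 := by
  have hcf : ContinuousOn f (Ioo 0 1) := fun t ht => (h₁ t ht).continuousAt.continuousWithinAt
  have hcf₁ : ContinuousOn f₁ (Ioo 0 1) := fun t ht => (h₂ t ht).continuousAt.continuousWithinAt
  have hpow : ContinuousOn (fun t : ℝ => t ^ (c - 1)) (Ioo 0 1) :=
    (contDiffOn_rpow_Ioi _).continuousOn.mono Ioo_subset_Ioi_self
  set k : ℝ → ℂ := fun t => ((t ^ (c - 1) : ℝ) : ℂ) *
    (t * (1 - t) * f₂ t + (c - (a + b + 1) * t) * f₁ t - a * b * f t) with hk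
  have hkc : ContinuousOn k (Ioo 0 1) := by
    refine (Complex.continuous_ofReal.comp_continuousOn hpow).mul ?_
    refine ((ContinuousOn.mul (by fun_prop) hc₂).add (ContinuousOn.mul (by fun_prop) hcf₁)).sub
      (ContinuousOn.mul (by fun_prop) hcf)
  have hint : ∀ χ : ℝ → ℝ, IsRadialTest χ → ∫ t, χ t • k t = 0 := by
    intro χ hχ
    obtain ⟨α, β, hα, hαβ, hβ, hsupp⟩ := hχ.supp
    have hz0 : ∀ t, t ∉ Icc α β → χ t = 0 := fun t ht => by
      by_contra h; exact ht (hsupp t h)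
    have hz1 : ∀ t, t ∉ Icc α β → deriv χ t = 0 := fun t ht => by
      by_contra h; exact ht (IsRadialTest.deriv_eq_zero hsupp t h)
    have hz2 : ∀ t, t ∉ Icc α β → deriv (deriv χ) t = 0 := fun t ht => by
      by_contra h
      exact ht (IsRadialTest.deriv_eq_zero (IsRadialTest.deriv_eq_zero hsupp) t h)
    set α' := α / 2
    set β' := (1 + β) / 2
    have hα' : 0 < α' := by simp only [α']; linarith
    have hα'α : α' < α := by simp only [α']; linarith
    have hββ' : β < β' := by simp only [β']; linarith
    have hβ' : β' < 1 := by simp only [β']; linarith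
    have hsub : Icc α' β' ⊆ Ioo (0 : ℝ) 1 := fun t ht =>
      ⟨hα'.trans_le ht.1, ht.2.trans_lt hβ'⟩
    set L : ℝ → ℂ := fun t => ((t ^ (c - 1) * (t * (1 - t) * deriv (deriv χ) t
      + (c - (1 + 2 * c - a - b) * t) * deriv χ t - (c - a) * (c - b) * χ t) : ℝ) : ℂ) * f t with hL
    -- Both integrals reduce to `[α', β']`, and the integrands differ there by the derivative of
    -- a function vanishing at the endpoints.
    set H : ℝ → ℂ := fun t => ((t ^ c : ℝ) : ℂ) * (((1 - t : ℝ) : ℂ) *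
      (f t * ((deriv χ t : ℝ) : ℂ) - f₁ t * ((χ t : ℝ) : ℂ)) +
        (a + b - c) * (((χ t : ℝ) : ℂ) * f t)) with hH
    have hHd : ∀ t ∈ Ioo (0 : ℝ) 1, HasDerivAt H (L t - χ t • k t) t := by
      intro t ht
      have d0 : HasDerivAt (fun t : ℝ => ((t ^ c : ℝ) : ℂ)) ((c * t ^ (c - 1) : ℝ) : ℂ) t :=
        (Real.hasDerivAt_rpow_const (Or.inl ht.1.ne')).ofReal_comp
      have d1 : HasDerivAt (fun t : ℝ => ((1 - t : ℝ) : ℂ)) ((0 - 1 : ℝ) : ℂ) t :=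
        ((hasDerivAt_const t (1 : ℝ)).sub (hasDerivAt_id t)).ofReal_comp
      have d2 : HasDerivAt (fun t : ℝ => ((χ t : ℝ) : ℂ)) ((deriv χ t : ℝ) : ℂ) t :=
        (hχ.differentiable t).hasDerivAt.ofReal_comp
      have d3 : HasDerivAt (fun t : ℝ => ((deriv χ t : ℝ) : ℂ)) ((deriv (deriv χ) t : ℝ) : ℂ) t :=
        (hχ.deriv.differentiable t).hasDerivAt.ofReal_comp
      have d := d0.mul ((d1.mul (((h₁ t ht).mul d3).sub ((h₂ t ht).mul d2))).add
        ((d2.mul (h₁ t ht)).const_mul ((a : ℂ) + b - c)))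
      convert! d using 1
      have e : t ^ c = t * t ^ (c - 1) := by
        rw [Real.rpow_sub_one ht.1.ne']; field_simp [ht.1.ne']
      simp only [hL, hk, Complex.real_smul, Pi.mul_apply, Pi.sub_apply, Pi.add_apply, e]
      push_cast
      ring
    have hzL : ∀ t, t ∉ Icc α β → L t = 0 := fun t ht => by
      simp [hL, hz0 t ht, hz1 t ht, hz2 t ht]
    have hzk : ∀ t, t ∉ Icc α β → χ t • k t = 0 := fun t ht => by simp [hz0 t ht]
    have hLc : ContinuousOn L (Icc α' β') := by
      refine ContinuousOn.mul (Complex.continuous_ofReal.comp_continuousOn ?_) (hcf.mono hsub)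
      have := hχ.deriv.deriv.smooth.continuous
      have := hχ.deriv.smooth.continuous
      have := hχ.smooth.continuous
      exact (hpow.mono hsub).mul (by fun_prop)
    have hχk : ContinuousOn (fun t => χ t • k t) (Icc α' β') :=
      hχ.smooth.continuous.continuousOn.smul (hkc.mono hsub)
    have hle : α' ≤ β' := by linarith
    have hi : ∀ G : ℝ → ℂ, (∀ t, t ∉ Icc α β → G t = 0) →
        ∫ t in Ioi (0 : ℝ), G t = ∫ t in α'..β', G t := by
      intro G hG
      rw [intervalIntegral.integral_of_le hle]
      refine (setIntegral_eq_of_subset_of_forall_sdiff_eq_zero measurableSet_Ioi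
        (fun t ht => hα'.trans ht.1) fun t ht => hG t fun hc => ht.2 ?_)
      exact ⟨hα'α.trans_le hc.1, hc.2.trans hββ'.le⟩
    have hi' : ∫ t, χ t • k t = ∫ t in α'..β', χ t • k t := by
      rw [← hi _ hzk]
      refine (setIntegral_eq_integral_of_forall_compl_eq_zero fun t ht => hzk t fun hc => ht ?_).symm
      exact hα.trans_le hc.1
    have hI := intervalIntegral.integral_eq_sub_of_hasDerivAt (f := H) (a := α') (b := β')
      (f' := fun t => L t - χ t • k t) (fun t ht => hHd t (hsub (by rwa [uIcc_of_le hle] at ht)))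
      (ContinuousOn.intervalIntegrable (by rw [uIcc_of_le hle]; exact hLc.sub hχk))
    have hends : ∀ t, t ∉ Icc α β → H t = 0 := fun t ht => by
      simp [hH, hz0 t ht, hz1 t ht]
    rw [hends β' (fun h => by linarith [h.2]), hends α' (fun h => by linarith [h.1]),
      intervalIntegral.integral_sub
        (ContinuousOn.intervalIntegrable (by rwa [uIcc_of_le hle]))
        (ContinuousOn.intervalIntegrable (by rwa [uIcc_of_le hle])), ← hi L hzL, hw χ hχ, ← hi',
      sub_zero, zero_sub, neg_eq_zero] at hI
    exact hI
  have hae := isOpen_Ioo.ae_eq_zero_of_integral_contDiff_smul_eq_zero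
    (hkc.locallyIntegrableOn measurableSet_Ioo) fun g hg hgc hgs =>
      hint g (isRadialTest_of_tsupport hg hgc hgs)
  have hzero : EqOn k (fun _ => 0) (Ioo 0 1) := by
    refine Measure.eqOn_open_of_ae_eq (μ := volume) ?_ isOpen_Ioo hkc continuousOn_const
    exact (ae_restrict_iff' measurableSet_Ioo).2 hae
  intro t ht
  have h1 := hzero ht
  simp only [hk, mul_eq_zero, Complex.ofReal_eq_zero] at h1
  exact h1.resolve_left (Real.rpow_pos_of_pos ht.1 _).ne'

lemma moment_normSq_mul {n : ℕ} (u : EuclideanSpace ℂ (Fin n) → ℂ) (P : ZPoly n) (i : ℕ) (ρ : ℝ) :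
    moment u (normSqPoly n * P) i ρ = moment u P i ρ := by
  simp [moment, ev_normSqPoly]

/-- The radial profile of a solution of `modLaplacian u = 0` against a harmonic polynomial of
bidegree `(p, q)` solves the hypergeometric equation with parameters `p / 2`, `q / 2` and
`(n + p + q + 1) / 2`. -/
lemma hypergeom_radialProfile {n : ℕ} (hn : 1 ≤ n) {u : EuclideanSpace ℂ (Fin n) → ℂ}
    (hu : ContDiffOn ℝ 2 u (ball 0 1))
    (hΔ : ∀ z ∈ ball (0 : EuclideanSpace ℂ (Fin n)) 1, modLaplacian u z = 0) {p q : ℕ}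
    {h : ZPoly n} (hh : IsBihom p q h) (hD : polyLaplacian h = 0) {f : ℝ → ℂ}
    (hf : f = radialProfile ((p + q : ℝ) / 4) (moment u h 0)) :
    ∀ t ∈ Ioo (0 : ℝ) 1, t * (1 - t) * iteratedDeriv 2 f t +
      (((n + p + q + 1) / 2 : ℝ) - ((p / 2 : ℝ) + (q / 2 : ℝ) + 1) * t) * iteratedDeriv 1 f t -
        (p / 2 : ℝ) * (q / 2 : ℝ) * f t = 0 := by
  have hF : ∀ i < 2, ∀ ρ ∈ Ioo (0 : ℝ) 1,
      HasDerivAt (moment u h i) (moment u h (i + 1) ρ) ρ := fun i hi ρ hρ =>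
    hasDerivAt_moment hu hi hρ
  have hd : ∀ j < 2, ∀ t ∈ Ioo (0 : ℝ) 1,
      HasDerivAt (iteratedDeriv j f) (iteratedDeriv (j + 1) f t) t := fun j hj t ht => by
    rw [hf]; exact hasDerivAt_iteratedDeriv_profile hF hj ht
  refine hypergeom_of_weak (fun t ht => by simpa using hd 0 (by norm_num) t ht)
    (hd 1 (by norm_num)) ?_ fun χ hχ => ?_
  · rw [hf]
    exact (isProfileComb_iteratedDeriv hF le_rfl).continuousOn fun i hi => continuousOn_moment hu hi
  · have h1 := integral_adjointRadial hu hΔ hχ hh hD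
    rw [integral_mul_radialMul hn hu.continuousOn hχ.adjointRadial hh.normSq_mul] at h1
    rw [← h1]
    refine setIntegral_congr_fun measurableSet_Ioi fun t ht => ?_
    have ht : 0 < t := ht
    -- In the variable `t = |z|⁴` the adjoint is, up to the factor `4`, the formal adjoint of the
    -- hypergeometric operator, whose weight `t ^ (c - 1)` comes from the volume element.
    have hE : adjointRadial n p q χ t = 4 * (t * (1 - t) * deriv (deriv χ) t +
        ((n + p + q + 1) / 2 - (1 + 2 * ((n + p + q + 1) / 2) - p / 2 - q / 2) * t) * deriv χ t
        - ((n + p + q + 1) / 2 - p / 2) * ((n + p + q + 1) / 2 - q / 2) * χ t) := by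
      have hd : HasDerivAt (eulerOp (n + p + 1) χ)
          (2 * 1 * deriv χ t + 2 * t * deriv (deriv χ) t + (n + p + 1) * deriv χ t) t :=
        ((((hasDerivAt_id t).const_mul (2 : ℝ))).mul (hχ.deriv.differentiable t).hasDerivAt).add
          ((hχ.differentiable t).hasDerivAt.const_mul _)
      rw [adjointRadial, eulerOp, eulerOp, hd.deriv, eulerOp]
      ring
    simp only [hE, hf, radialProfile, moment_normSq_mul]
    have hpow : t ^ (((p + 1 : ℕ) + (q + 1 : ℕ) + 2 * n : ℝ) / 4 - 1) =
        t ^ ((n + p + q + 1 : ℝ) / 2 - 1) * t ^ (-((p + q : ℝ) / 4)) := by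
      rw [← Real.rpow_add ht]; push_cast; ring_nf
    rw [hpow]
    push_cast
    ring

/-! ### Regularity up to the boundary -/

/-- The derivatives of `u` up to order `m` are bounded on the unit ball and have modulus of
continuity `o(δ ^ γ)` there. With `γ = 0` this is uniform continuity. -/
structure BoundaryReg {n : ℕ} (u : EuclideanSpace ℂ (Fin n) → ℂ) (m : ℕ) (γ : ℝ) : Prop where
  contDiffOn : ContDiffOn ℝ m u (ball 0 1)
  bounded : ∀ i ≤ m, ∃ C, ∀ x ∈ ball (0 : EuclideanSpace ℂ (Fin n)) 1, ‖iteratedFDeriv ℝ i u x‖ ≤ C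
  modulus : ∀ i ≤ m, ∀ ε > 0, ∃ δ > 0, ∀ x ∈ ball (0 : EuclideanSpace ℂ (Fin n)) 1,
    ∀ y ∈ ball (0 : EuclideanSpace ℂ (Fin n)) 1, ‖x - y‖ < δ →
      ‖iteratedFDeriv ℝ i u x - iteratedFDeriv ℝ i u y‖ ≤ ε * ‖x - y‖ ^ γ

/-- `g` is bounded near `1⁻` and `g((1 + t) / 2) - g(t) = o((1 - t) ^ γ)`. This is the trace of the
regularity of `u` at the boundary that is left in the radial variable: it passes to products, and
it is incompatible with `|g'| ≥ ε (1 - t) ^ (γ - 1)`. -/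
structure MidpointReg (γ : ℝ) (g : ℝ → ℂ) : Prop where
  bounded : ∃ C, ∀ᶠ t in 𝓝[<] (1 : ℝ), ‖g t‖ ≤ C
  isLittleO : (fun t => g ((1 + t) / 2) - g t) =o[𝓝[<] 1] fun t : ℝ => (1 - t) ^ γ

lemma tendsto_midpoint : Tendsto (fun t : ℝ => (1 + t) / 2) (𝓝[<] 1) (𝓝[<] 1) := by
  refine tendsto_nhdsWithin_of_tendsto_nhds_of_eventually_within _ ?_ ?_
  · have : Tendsto (fun t : ℝ => (1 + t) / 2) (𝓝 1) (𝓝 ((1 + 1) / 2)) :=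
      (Continuous.tendsto (by fun_prop) 1)
    norm_num at this
    exact this.mono_left nhdsWithin_le_nhds
  · filter_upwards [self_mem_nhdsWithin] with t ht
    have : t < 1 := ht
    simp only [mem_Iio]; linarith

namespace MidpointReg

variable {γ : ℝ} {g g' : ℝ → ℂ}

lemma congr (h : MidpointReg γ g) (he : ∀ t ∈ Ioo (0 : ℝ) 1, g' t = g t) : MidpointReg γ g' := by
  have hev : ∀ᶠ t in 𝓝[<] (1 : ℝ), g' t = g t := by
    filter_upwards [Ioo_mem_nhdsLT (zero_lt_one (α := ℝ))] with t ht using he t ht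
  obtain ⟨C, hC⟩ := h.bounded
  refine ⟨⟨C, ?_⟩, h.isLittleO.congr' ?_ EventuallyEq.rfl⟩
  · filter_upwards [hev, hC] with t h1 h2 using h1 ▸ h2
  · filter_upwards [hev, tendsto_midpoint.eventually hev] with t h1 h2 using by rw [h1, h2]

lemma add (h : MidpointReg γ g) (h' : MidpointReg γ g') : MidpointReg γ fun t => g t + g' t := by
  obtain ⟨C, hC⟩ := h.bounded
  obtain ⟨C', hC'⟩ := h'.bounded
  refine ⟨⟨C + C', ?_⟩, (h.isLittleO.add h'.isLittleO).congr_left fun t => by ring⟩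
  filter_upwards [hC, hC'] with t h1 h2 using (norm_add_le _ _).trans (add_le_add h1 h2)

lemma zero : MidpointReg γ fun _ => 0 :=
  ⟨⟨0, by simp⟩, by simp⟩

lemma sum {ι : Type*} (s : Finset ι) (f : ι → ℝ → ℂ) (h : ∀ i ∈ s, MidpointReg γ (f i)) :
    MidpointReg γ fun t => ∑ i ∈ s, f i t := by
  classical
  induction s using Finset.induction_on with
  | empty => simpa using zero
  | insert a s ha ih =>
    simp only [Finset.sum_insert ha]
    exact (h a (by simp)).add (ih fun i hi => h i (by simp [hi]))

lemma mul (h : MidpointReg γ g) (h' : MidpointReg γ g') : MidpointReg γ fun t => g t * g' t := by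
  obtain ⟨C, hC⟩ := h.bounded
  obtain ⟨C', hC'⟩ := h'.bounded
  have b1 : (fun t => g ((1 + t) / 2)) =O[𝓝[<] 1] fun _ => (1 : ℝ) :=
    Asymptotics.IsBigO.of_bound C (by
      filter_upwards [tendsto_midpoint.eventually hC] with t ht; simpa using ht)
  have b2 : g' =O[𝓝[<] 1] fun _ => (1 : ℝ) :=
    Asymptotics.IsBigO.of_bound C' (by filter_upwards [hC'] with t ht; simpa using ht)
  refine ⟨⟨C * C', ?_⟩, ?_⟩
  · filter_upwards [hC, hC'] with t h1 h2
    rw [norm_mul]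
    exact mul_le_mul h1 h2 (norm_nonneg _) ((norm_nonneg _).trans h1)
  · have o1 := b1.mul_isLittleO h'.isLittleO
    have o2 := h.isLittleO.mul_isBigO b2
    simp only [one_mul, mul_one] at o1 o2
    exact (o1.add o2).congr_left fun t => by ring

lemma of_differentiableAt (hγ : γ < 1) {c : ℝ → ℝ} (hc : DifferentiableAt ℝ c 1) :
    MidpointReg γ fun t => (c t : ℂ) := by
  refine ⟨⟨‖c 1‖ + 1, ?_⟩, ?_⟩
  · have : ∀ᶠ t in 𝓝 (1 : ℝ), ‖c t‖ < ‖c 1‖ + 1 :=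
      hc.continuousAt.norm.eventually (gt_mem_nhds (by linarith))
    filter_upwards [nhdsWithin_le_nhds this] with t ht
    rw [Complex.norm_real]; exact ht.le
  · have h1 : (fun t => c t - c 1) =O[𝓝[<] 1] fun t : ℝ => 1 - t := by
      refine (hc.isBigO_sub.mono nhdsWithin_le_nhds).trans ?_
      exact Asymptotics.IsBigO.of_bound 1 (Eventually.of_forall fun t => by
        rw [one_mul, norm_sub_rev])
    have h2 : (fun t => c ((1 + t) / 2) - c 1) =O[𝓝[<] 1] fun t : ℝ => 1 - t := by
      refine (h1.comp_tendsto tendsto_midpoint).trans ?_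
      refine Asymptotics.IsBigO.of_bound 1 (Eventually.of_forall fun t => ?_)
      simp only [Function.comp_apply, Real.norm_eq_abs]
      rw [show 1 - (1 + t) / 2 = (1 - t) / 2 by ring, abs_div, abs_two, one_mul]
      linarith [abs_nonneg (1 - t)]
    have h3 : (fun t => c ((1 + t) / 2) - c t) =O[𝓝[<] 1] fun t : ℝ => 1 - t :=
      (h2.sub h1).congr_left fun t => by ring
    have h4 : (fun t : ℝ => 1 - t) =o[𝓝[<] 1] fun t : ℝ => (1 - t) ^ γ := by
      have hz : Tendsto (fun t : ℝ => 1 - t) (𝓝[<] 1) (𝓝[>] 0) := by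
        refine tendsto_nhdsWithin_of_tendsto_nhds_of_eventually_within _ ?_ ?_
        · have : Tendsto (fun t : ℝ => 1 - t) (𝓝 1) (𝓝 (1 - 1)) :=
            (Continuous.tendsto (by fun_prop) 1)
          rw [sub_self] at this
          exact this.mono_left nhdsWithin_le_nhds
        · filter_upwards [self_mem_nhdsWithin] with t ht
          exact sub_pos.2 (mem_Iio.1 ht)
      have hl := (tendsto_rpow_zero (sub_pos.2 hγ)).comp hz
      refine (Asymptotics.isLittleO_iff_tendsto' ?_).2 (hl.congr' ?_)
      · filter_upwards [self_mem_nhdsWithin] with t ht h0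
        exact absurd h0 (Real.rpow_pos_of_pos (sub_pos.2 ht) _).ne'
      · filter_upwards [self_mem_nhdsWithin] with t ht
        have : 0 < 1 - t := sub_pos.2 ht
        simp only [Function.comp_apply]
        rw [Real.rpow_sub this, Real.rpow_one]
    refine (h3.trans_isLittleO h4).norm_left.congr_left (fun t => ?_) |>.of_norm_left
    rw [← Complex.ofReal_sub, Complex.norm_real]

end MidpointReg

/-- The substitution `ρ = t ^ (1/4)` is Lipschitz away from `0`. -/
lemma rpow_quarter_sub_le {x y : ℝ} (hx : 1 / 16 < x) (hxy : x ≤ y) :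
    |y ^ (1 / 4 : ℝ) - x ^ (1 / 4 : ℝ)| ≤ 2 * (y - x) := by
  have hx0 : 0 < x := by linarith
  have hy0 : 0 < y := by linarith
  set a := x ^ (1 / 4 : ℝ) with ha
  set b := y ^ (1 / 4 : ℝ) with hb
  have ha4 : a ^ 4 = x := by rw [ha, ← Real.rpow_natCast, ← Real.rpow_mul hx0.le]; norm_num
  have hb4 : b ^ 4 = y := by rw [hb, ← Real.rpow_natCast, ← Real.rpow_mul hy0.le]; norm_num
  have hab : a ≤ b := Real.rpow_le_rpow hx0.le hxy (by norm_num)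
  have ha2 : 1 / 2 ≤ a := by
    by_contra hlt
    push Not at hlt
    have : a ^ 4 ≤ (1 / 2) ^ 4 := pow_le_pow_left₀ (Real.rpow_nonneg hx0.le _) hlt.le 4
    rw [ha4] at this; norm_num at this; linarith
  rw [abs_of_nonneg (sub_nonneg.2 hab), ← ha4, ← hb4]
  have e : b ^ 4 - a ^ 4 = (b - a) * (b ^ 3 + b ^ 2 * a + b * a ^ 2 + a ^ 3) := by ring
  have hb2 : 1 / 2 ≤ b := ha2.trans hab
  have h3 : (1 / 2 : ℝ) ^ 3 ≤ a ^ 3 := pow_le_pow_left₀ (by norm_num) ha2 3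
  have h4 : (1 / 2 : ℝ) ^ 3 ≤ b ^ 3 := pow_le_pow_left₀ (by norm_num) hb2 3
  have h5 : (1 / 2 : ℝ) ^ 2 * (1 / 2) ≤ b ^ 2 * a :=
    mul_le_mul (pow_le_pow_left₀ (by norm_num) hb2 2) ha2 (by norm_num) (by positivity)
  have h6 : (1 / 2 : ℝ) * (1 / 2) ^ 2 ≤ b * a ^ 2 :=
    mul_le_mul hb2 (pow_le_pow_left₀ (by norm_num) ha2 2) (by norm_num) (by linarith)
  rw [e]
  nlinarith [sub_nonneg.2 hab]

/-! ### Moments of solutions -/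

section vanishing

variable {n : ℕ} {u : EuclideanSpace ℂ (Fin n) → ℂ} {m : ℕ} {γ : ℝ} {P : ZPoly n}

lemma norm_moment_sub_le {i : ℕ} {ρ ρ' B : ℝ} (hu : ContDiffOn ℝ m u (ball 0 1)) (hi : i ≤ m)
    (hρ : ρ ∈ Ioo (0 : ℝ) 1) (hρ' : ρ' ∈ Ioo (0 : ℝ) 1)
    (hB : ∀ ζ : USphere n, ‖iteratedFDeriv ℝ i u (ρ • (ζ : EuclideanSpace ℂ (Fin n))) -
      iteratedFDeriv ℝ i u (ρ' • (ζ : EuclideanSpace ℂ (Fin n)))‖ ≤ B) :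
    ‖moment u P i ρ - moment u P i ρ'‖ ≤ B * ∫ ζ : USphere n, ‖ev P ζ‖ ∂(surf n) := by
  have hI : ∀ r ∈ Ioo (0 : ℝ) 1, Integrable (fun ζ : USphere n =>
      iteratedFDeriv ℝ i u (r • (ζ : EuclideanSpace ℂ (Fin n)))
        (fun _ => (ζ : EuclideanSpace ℂ (Fin n))) * ev P ζ) (surf n) := fun r hr =>
    ((continuousOn_moment_kernel hu hi).comp_continuous (f := fun ζ : USphere n => (r, ζ))
      (by fun_prop) fun ζ => ⟨hr, mem_univ _⟩).integrable_of_hasCompactSupport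
        (HasCompactSupport.of_compactSpace _)
  have hP : Integrable (fun ζ : USphere n => ‖ev P ζ‖) (surf n) :=
    (((continuous_ev P).comp continuous_subtype_val).norm).integrable_of_hasCompactSupport
      (HasCompactSupport.of_compactSpace _)
  rw [moment, moment, ← integral_sub (hI ρ hρ) (hI ρ' hρ'), ← integral_const_mul]
  refine norm_integral_le_of_norm_le (hP.const_mul B) (Eventually.of_forall fun ζ => ?_)
  rw [← sub_mul, norm_mul, ← _root_.sub_apply]
  refine mul_le_mul_of_nonneg_right ((ContinuousMultilinearMap.le_opNorm _ _).trans ?_)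
    (norm_nonneg _)
  simpa [norm_eq_of_mem_sphere] using hB ζ

lemma norm_moment_le {i : ℕ} {ρ B : ℝ}
    (hB : ∀ ζ : USphere n, ‖iteratedFDeriv ℝ i u (ρ • (ζ : EuclideanSpace ℂ (Fin n)))‖ ≤ B) :
    ‖moment u P i ρ‖ ≤ B * ∫ ζ : USphere n, ‖ev P ζ‖ ∂(surf n) := by
  have hP : Integrable (fun ζ : USphere n => ‖ev P ζ‖) (surf n) :=
    (((continuous_ev P).comp continuous_subtype_val).norm).integrable_of_hasCompactSupport
      (HasCompactSupport.of_compactSpace _)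
  rw [moment, ← integral_const_mul]
  refine norm_integral_le_of_norm_le (hP.const_mul B) (Eventually.of_forall fun ζ => ?_)
  rw [norm_mul]
  refine mul_le_mul_of_nonneg_right ((ContinuousMultilinearMap.le_opNorm _ _).trans ?_)
    (norm_nonneg _)
  simpa [norm_eq_of_mem_sphere] using hB ζ

lemma BoundaryReg.midpointReg_moment (hr : BoundaryReg u m γ) (hγ : 0 ≤ γ) {i : ℕ} (hi : i ≤ m) :
    MidpointReg γ fun t => moment u P i (t ^ (1 / 4 : ℝ)) := by
  have hev : ∀ᶠ t in 𝓝[<] (1 : ℝ), t ∈ Ioo (1 / 16 : ℝ) 1 := Ioo_mem_nhdsLT (by norm_num)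
  set A := ∫ ζ : USphere n, ‖ev P ζ‖ ∂(surf n)
  have hA : 0 ≤ A := integral_nonneg fun ζ => norm_nonneg _
  constructor
  · obtain ⟨C, hC⟩ := hr.bounded i hi
    refine ⟨C * A, ?_⟩
    filter_upwards [hev] with t ht
    exact norm_moment_le fun ζ => hC _
      (smul_mem_ball (rpow_quarter_mem ⟨by linarith [ht.1], ht.2⟩) ζ)
  · rw [Asymptotics.isLittleO_iff]
    intro ε hε
    obtain ⟨δ, hδ, hmod⟩ := hr.modulus i hi (ε / (A + 1)) (by positivity)
    have hev2 : ∀ᶠ t in 𝓝[<] (1 : ℝ), t ∈ Ioo (1 - δ) 1 := Ioo_mem_nhdsLT (by linarith)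
    filter_upwards [hev, hev2] with t ht ht2
    have ht0 : t ∈ Ioo (0 : ℝ) 1 := ⟨by linarith [ht.1], ht.2⟩
    have hmid0 : (1 + t) / 2 ∈ Ioo (0 : ℝ) 1 := ⟨by linarith [ht.1], by linarith [ht.2]⟩
    have hdist := rpow_quarter_sub_le ht.1 (by linarith [ht.2] : t ≤ (1 + t) / 2)
    have h2 : 2 * ((1 + t) / 2 - t) = 1 - t := by ring
    rw [h2] at hdist
    set a := ((1 + t) / 2) ^ (1 / 4 : ℝ) with ha
    set b := t ^ (1 / 4 : ℝ) with hb
    have hpos : 0 < 1 - t := by linarith [ht.2]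
    have hB : ∀ ζ : USphere n, ‖iteratedFDeriv ℝ i u (a • (ζ : EuclideanSpace ℂ (Fin n))) -
        iteratedFDeriv ℝ i u (b • (ζ : EuclideanSpace ℂ (Fin n)))‖ ≤
          ε / (A + 1) * (1 - t) ^ γ := by
      intro ζ
      have hn : ‖a • (ζ : EuclideanSpace ℂ (Fin n)) - b • (ζ : EuclideanSpace ℂ (Fin n))‖ =
          |a - b| := by
        rw [← sub_smul, norm_smul, norm_eq_of_mem_sphere, mul_one, Real.norm_eq_abs]
      refine (hmod _ (smul_mem_ball (rpow_quarter_mem hmid0) ζ) _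
        (smul_mem_ball (rpow_quarter_mem ht0) ζ) ?_).trans ?_
      · rw [hn]; linarith [ht2.1]
      · rw [hn]
        exact mul_le_mul_of_nonneg_left (Real.rpow_le_rpow (abs_nonneg _) hdist hγ) (by positivity)
    refine (norm_moment_sub_le hr.contDiffOn hi (rpow_quarter_mem hmid0) (rpow_quarter_mem ht0)
      hB).trans ?_
    rw [Real.norm_of_nonneg (Real.rpow_nonneg hpos.le _)]
    have hp := Real.rpow_nonneg hpos.le γ
    calc ε / (A + 1) * (1 - t) ^ γ * A = ε * (1 - t) ^ γ * (A / (A + 1)) := by ring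
      _ ≤ ε * (1 - t) ^ γ * 1 := by
          refine mul_le_mul_of_nonneg_left ?_ (by positivity)
          rw [div_le_one (by positivity)]; linarith
      _ = _ := mul_one _

lemma IsProfileComb.midpointReg {F : ℕ → ℝ → ℂ} {j : ℕ} {g : ℝ → ℂ} (h : IsProfileComb F j g)
    (hγ : γ < 1) (hF : ∀ i ≤ j, MidpointReg γ fun t => F i (t ^ (1 / 4 : ℝ))) :
    MidpointReg γ g := by
  obtain ⟨c, hc, he⟩ := h
  refine MidpointReg.congr (MidpointReg.sum _ _ fun i hi => MidpointReg.mul ?_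
    (hF i (by simp at hi; omega))) he
  exact MidpointReg.of_differentiableAt hγ
    (((hc i).contDiffAt (Ioi_mem_nhds one_pos)).differentiableAt (by simp))

/-- The images of the radial profile under a real-linear functional, such as the real and imaginary
parts, are hypergeometric solutions. -/
lemma isHypergeomSol_profile (hn : 1 ≤ n) (hu : ContDiffOn ℝ 2 u (ball 0 1))
    (hΔ : ∀ z ∈ ball (0 : EuclideanSpace ℂ (Fin n)) 1, modLaplacian u z = 0)
    {p q : ℕ} {h : ZPoly n} (hh : IsBihom p q h) (hD : polyLaplacian h = 0) (ℓ : ℂ →L[ℝ] ℝ) :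
    IsHypergeomSol (p / 2) (q / 2) ((n + p + q + 1) / 2)
      (fun t => ℓ (radialProfile ((p + q : ℝ) / 4) (moment u h 0) t))
      (fun t => ℓ (iteratedDeriv 1 (radialProfile ((p + q : ℝ) / 4) (moment u h 0)) t)) := by
  set f := radialProfile ((p + q : ℝ) / 4) (moment u h 0) with hf
  have hF : ∀ i < 2, ∀ ρ ∈ Ioo (0 : ℝ) 1,
      HasDerivAt (moment u h i) (moment u h (i + 1) ρ) ρ := fun i hi ρ hρ =>
    hasDerivAt_moment hu hi hρ
  have hd : ∀ j < 2, ∀ t ∈ Ioo (0 : ℝ) 1,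
      HasDerivAt (iteratedDeriv j f) (iteratedDeriv (j + 1) f t) t := fun j hj t ht => by
    rw [hf]; exact hasDerivAt_iteratedDeriv_profile hF hj ht
  refine ⟨fun t ht => ?_, fun t ht => ?_⟩
  · have := ℓ.hasFDerivAt.comp_hasDerivAt t (hd 0 (by norm_num) t ht)
    simpa using! this
  · have h1 := ℓ.hasFDerivAt.comp_hasDerivAt t (hd 1 (by norm_num) t ht)
    convert! h1 using 1
    have ho := hypergeom_radialProfile hn hu hΔ hh hD hf t ht
    have ht0 : t * (1 - t) ≠ 0 := mul_ne_zero ht.1.ne' (sub_pos.2 ht.2).ne'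
    rw [div_eq_iff ht0]
    have e : (t * (1 - t)) • iteratedDeriv (1 + 1) f t = (p / 2 * (q / 2) : ℝ) • f t -
        ((n + p + q + 1) / 2 - (p / 2 + q / 2 + 1) * t : ℝ) • iteratedDeriv 1 f t := by
      simp only [Complex.real_smul]
      push_cast at ho ⊢
      linear_combination ho
    have e2 := congrArg ℓ e
    simp only [map_smul, map_sub, smul_eq_mul] at e2
    linear_combination (-1 : ℝ) * e2

/-- The moments of a bounded function give a radial profile that is `O(t ^ (-(p + q) / 4))`, far
from the growth `t ^ (1 - c)` of the singular solutions. -/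
lemma profile_growth (p q : ℕ) (h : ZPoly n) (ℓ : ℂ →L[ℝ] ℝ)
    (hb : ∃ C, ∀ x ∈ ball (0 : EuclideanSpace ℂ (Fin n)) 1, ‖u x‖ ≤ C) :
    ∃ C, ∀ t ∈ Ioc (0 : ℝ) (1 / 2),
      |ℓ (radialProfile ((p + q : ℝ) / 4) (moment u h 0) t)| ≤ C * t ^ (-((p + q : ℝ) / 4)) := by
  obtain ⟨C, hC⟩ := hb
  refine ⟨‖ℓ‖ * (C * ∫ ζ : USphere n, ‖ev h ζ‖ ∂(surf n)), fun t ht => ?_⟩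
  rw [← Real.norm_eq_abs]
  refine (ℓ.le_opNorm _).trans ?_
  rw [mul_assoc]
  refine mul_le_mul_of_nonneg_left ?_ (norm_nonneg _)
  have hp := Real.rpow_nonneg ht.1.le (-((p + q : ℝ) / 4))
  rw [radialProfile, norm_mul, Complex.norm_real, Real.norm_of_nonneg hp, mul_comm]
  refine mul_le_mul_of_nonneg_right (norm_moment_le fun ζ => ?_) hp
  rw [norm_iteratedFDeriv_zero]
  exact hC _ (smul_mem_ball (rpow_quarter_mem ⟨ht.1, by linarith [ht.2]⟩) ζ)

/-- A solution that is regular enough at the boundary has vanishing moments against harmonic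
polynomials of bidegree `(p, q)` with `p, q ≥ 1`. -/
lemma moment_eq_zero (hn : 2 ≤ n) (hu : ContDiffOn ℝ 2 u (ball 0 1))
    (hΔ : ∀ z ∈ ball (0 : EuclideanSpace ℂ (Fin n)) 1, modLaplacian u z = 0)
    (hr : BoundaryReg u m γ) (hγ0 : 0 ≤ γ) (hγ1 : γ < 1) (hγ : γ = ((n : ℝ) + 1) / 2 - m)
    {p q : ℕ} {h : ZPoly n} (hh : IsBihom p q h) (hD : polyLaplacian h = 0)
    (hp : 0 < p) (hq : 0 < q) : ∀ ρ ∈ Ioo (0 : ℝ) 1, moment u h 0 ρ = 0 := by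
  set f := radialProfile ((p + q : ℝ) / 4) (moment u h 0) with hf
  have hp' : (0 : ℝ) < p := by exact_mod_cast hp
  have hq' : (0 : ℝ) < q := by exact_mod_cast hq
  have hn' : (2 : ℝ) ≤ n := by exact_mod_cast hn
  have hF : ∀ i < m, ∀ ρ ∈ Ioo (0 : ℝ) 1,
      HasDerivAt (moment u h i) (moment u h (i + 1) ρ) ρ := fun i hi ρ hρ =>
    hasDerivAt_moment hr.contDiffOn hi hρ
  have hmid : MidpointReg γ (iteratedDeriv m f) :=
    (isProfileComb_iteratedDeriv hF le_rfl).midpointReg hγ1 fun i hi =>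
      hr.midpointReg_moment hγ0 hi
  have hb : ∃ C, ∀ x ∈ ball (0 : EuclideanSpace ℂ (Fin n)) 1, ‖u x‖ ≤ C := by
    simpa using hr.bounded 0 (Nat.zero_le _)
  have hzero : ∀ ℓ : ℂ →L[ℝ] ℝ, ∀ t ∈ Ioo (0 : ℝ) 1, ℓ (f t) = 0 := by
    intro ℓ
    obtain ⟨C, hC⟩ := profile_growth p q h ℓ hb
    refine (isHypergeomSol_profile (by omega) hu hΔ hh hD ℓ).eq_zero_of_isLittleO (by positivity)
      (by positivity) (by positivity) (by linarith) (by linarith) hC hγ1.le (m := m)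
      (by rw [hγ]; ring) (fs := fun i t => ℓ (iteratedDeriv i f t)) (by simp [hf])
      (fun i hi t ht => ?_) ?_
    · exact ℓ.hasFDerivAt.comp_hasDerivAt t (hasDerivAt_iteratedDeriv_profile hF hi ht)
    · simp only [← map_sub]
      exact (ℓ.isBigO_comp _ _).trans_isLittleO hmid.isLittleO
  intro ρ hρ
  have ht : ρ ^ 4 ∈ Ioo (0 : ℝ) 1 := ⟨pow_pos hρ.1 4, pow_lt_one₀ hρ.1.le hρ.2 (by norm_num)⟩
  have hft : f (ρ ^ 4) = 0 := Complex.ext (hzero Complex.reCLM _ ht) (hzero Complex.imCLM _ ht)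
  have hq4 : (ρ ^ 4) ^ (1 / 4 : ℝ) = ρ := by
    rw [← Real.rpow_natCast, ← Real.rpow_mul hρ.1.le]; norm_num
  rw [hf, radialProfile, hq4, mul_eq_zero, Complex.ofReal_eq_zero] at hft
  exact hft.resolve_left (Real.rpow_pos_of_pos ht.1 _).ne'

/-- The moments of a bounded solution against polynomials of bidegree `(p, 0)` or `(0, q)` are
multiples of the corresponding power of the radius. -/
lemma moment_eq_mul_pow (hn : 2 ≤ n) (hu : ContDiffOn ℝ 2 u (ball 0 1))
    (hΔ : ∀ z ∈ ball (0 : EuclideanSpace ℂ (Fin n)) 1, modLaplacian u z = 0)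
    (hb : ∃ C, ∀ x ∈ ball (0 : EuclideanSpace ℂ (Fin n)) 1, ‖u x‖ ≤ C)
    {p q : ℕ} {h : ZPoly n} (hh : IsBihom p q h) (hD : polyLaplacian h = 0)
    (hpq : p = 0 ∨ q = 0) :
    ∃ K : ℂ, ∀ ρ ∈ Ioo (0 : ℝ) 1, moment u h 0 ρ = (ρ : ℂ) ^ (p + q) * K := by
  set f := radialProfile ((p + q : ℝ) / 4) (moment u h 0) with hf
  have hn' : (2 : ℝ) ≤ n := by exact_mod_cast hn
  have hp' : (0 : ℝ) ≤ p := p.cast_nonneg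
  have hq' : (0 : ℝ) ≤ q := q.cast_nonneg
  have hconst : ∀ ℓ : ℂ →L[ℝ] ℝ, ∀ t ∈ Ioo (0 : ℝ) 1, ℓ (f t) = ℓ (f (1 / 2)) := by
    intro ℓ
    obtain ⟨C, hC⟩ := profile_growth p q h ℓ hb
    exact (isHypergeomSol_profile (by omega) hu hΔ hh hD ℓ).eq_const_of_mul_eq_zero
      (by rcases hpq with rfl | rfl <;> simp) (by positivity) (by linarith) hC
  refine ⟨f (1 / 2), fun ρ hρ => ?_⟩
  have ht : ρ ^ 4 ∈ Ioo (0 : ℝ) 1 := ⟨pow_pos hρ.1 4, pow_lt_one₀ hρ.1.le hρ.2 (by norm_num)⟩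
  have hft : f (ρ ^ 4) = f (1 / 2) :=
    Complex.ext (hconst Complex.reCLM _ ht) (hconst Complex.imCLM _ ht)
  have hq4 : (ρ ^ 4) ^ (1 / 4 : ℝ) = ρ := by
    rw [← Real.rpow_natCast, ← Real.rpow_mul hρ.1.le]; norm_num
  have hs : (ρ ^ 4) ^ (-((p + q : ℝ) / 4)) = (ρ ^ (p + q))⁻¹ := by
    rw [← Real.rpow_natCast, ← Real.rpow_mul hρ.1.le, ← Real.rpow_natCast ρ (p + q),
      ← Real.rpow_neg hρ.1.le]
    push_cast
    ring_nf
  have hne : (ρ : ℂ) ^ (p + q) ≠ 0 := pow_ne_zero _ (by exact_mod_cast hρ.1.ne')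
  rw [← hft, hf, radialProfile, hq4, hs]
  push_cast
  field_simp

/-- A bihomogeneous pluriharmonic polynomial is orthogonal on the sphere to harmonic polynomials of
higher degree: its radial profile would otherwise be an unbounded negative power of `t`. -/
lemma moment_ev_eq_zero (hn : 2 ≤ n) {d i p q p' q' : ℕ} {U h : ZPoly n} (hU : IsBihom p' q' U)
    (hUΔ : ∀ z ∈ ball (0 : EuclideanSpace ℂ (Fin n)) 1, modLaplacian (ev U) z = 0)
    (hd : p' + q' = d) (hpq : p + q = d + 2 * i) (hi : 0 < i) (hh : IsBihom p q h)
    (hD : polyLaplacian h = 0) : ∀ ρ : ℝ, moment (ev U) h 0 ρ = 0 := by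
  set K := ∫ ζ : USphere n, ev U ζ * ev h ζ ∂(surf n) with hK
  have hmom : ∀ ρ : ℝ, moment (ev U) h 0 ρ = (ρ : ℂ) ^ d * K := by
    intro ρ
    rw [moment_zero, hK, ← integral_const_mul]
    refine integral_congr_ae (Eventually.of_forall fun ζ => ?_)
    change ev U (ρ • (ζ : EuclideanSpace ℂ (Fin n))) * _ = _
    rw [hU.ev_smul, hd]
    ring
  have hb : ∃ C, ∀ x ∈ ball (0 : EuclideanSpace ℂ (Fin n)) 1, ‖ev U x‖ ≤ C := by
    obtain ⟨C, hC⟩ := (isCompact_closedBall (0 : EuclideanSpace ℂ (Fin n)) 1)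
      |>.exists_bound_of_continuousOn (continuous_ev U).continuousOn
    exact ⟨C, fun x hx => hC x (ball_subset_closedBall hx)⟩
  have hn' : (2 : ℝ) ≤ n := by exact_mod_cast hn
  have hp' : (0 : ℝ) ≤ p := p.cast_nonneg
  have hq' : (0 : ℝ) ≤ q := q.cast_nonneg
  have hprof : ∀ t : ℝ, 0 < t → radialProfile ((p + q : ℝ) / 4) (moment (ev U) h 0) t =
      (t ^ (-(i / 2 : ℝ)) : ℝ) • K := by
    intro t ht
    have e : (p + q : ℝ) = d + 2 * i := by exact_mod_cast hpq
    have e1 : t ^ (-((p + q : ℝ) / 4)) * (t ^ (1 / 4 : ℝ)) ^ d = t ^ (-(i / 2 : ℝ)) := by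
      rw [← Real.rpow_natCast, ← Real.rpow_mul ht.le, ← Real.rpow_add ht, e]
      ring_nf
    rw [radialProfile, hmom, ← e1, Complex.real_smul]
    push_cast
    ring
  have hzero : ∀ ℓ : ℂ →L[ℝ] ℝ, ℓ K = 0 := by
    intro ℓ
    obtain ⟨C, hC⟩ := profile_growth p q h ℓ hb
    have hbd := (isHypergeomSol_profile (by omega) (contDiff_infty.1 (contDiff_ev U) 2).contDiffOn
      hUΔ hh hD ℓ).bounded_of_growth (by positivity) (by positivity) (by linarith) (by linarith) hC
    set B := |ℓ (radialProfile ((p + q : ℝ) / 4) (moment (ev U) h 0) (1 / 2))|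
    have hlim : Tendsto (fun t : ℝ => B * t ^ (i / 2 : ℝ)) (𝓝[>] 0) (𝓝 (B * 0)) :=
      (tendsto_rpow_zero (by positivity)).const_mul B
    rw [mul_zero] at hlim
    refine abs_nonpos_iff.1 (ge_of_tendsto hlim ?_)
    filter_upwards [Ioo_mem_nhdsGT (show (0 : ℝ) < 1 / 2 by norm_num)] with t ht
    have h1 := hbd t ⟨ht.1, ht.2.le⟩
    have hpos : 0 < t ^ (i / 2 : ℝ) := Real.rpow_pos_of_pos ht.1 _
    rw [hprof t ht.1, map_smul, smul_eq_mul, abs_mul, Real.rpow_neg ht.1.le,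
      abs_of_pos (inv_pos.2 hpos)] at h1
    rwa [inv_mul_le_iff₀ hpos, mul_comm] at h1
  have hK0 : K = 0 := Complex.ext (hzero Complex.reCLM) (hzero Complex.imCLM)
  intro ρ
  rw [hmom, hK0, mul_zero]

end vanishing

/-! ### Derivatives on the closed ball -/

section closedBall

variable {n : ℕ} {u : EuclideanSpace ℂ (Fin n) → ℂ} {m : ℕ} {γ : ℝ}

lemma uniqueDiffOn_closedBall :
    UniqueDiffOn ℝ (closedBall (0 : EuclideanSpace ℂ (Fin n)) 1) :=
  uniqueDiffOn_convex (convex_closedBall 0 1)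
    ⟨0, ball_subset_interior_closedBall (mem_ball_self one_pos)⟩

lemma iteratedFDeriv_eq_within (hu : ContDiffOn ℝ m u (closedBall 0 1)) {i : ℕ} (hi : i ≤ m)
    {x : EuclideanSpace ℂ (Fin n)} (hx : x ∈ ball (0 : EuclideanSpace ℂ (Fin n)) 1) :
    iteratedFDeriv ℝ i u x = iteratedFDerivWithin ℝ i u (closedBall 0 1) x := by
  refine (iteratedFDerivWithin_eq_iteratedFDeriv uniqueDiffOn_closedBall ?_
    (ball_subset_closedBall hx)).symm
  exact (hu.contDiffAt (mem_of_superset (isOpen_ball.mem_nhds hx) ball_subset_closedBall)).of_le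
    (by exact_mod_cast hi)

lemma continuousOn_iteratedFDeriv_closedBall (hu : ContDiffOn ℝ m u (closedBall 0 1)) {i : ℕ}
    (hi : i ≤ m) : ContinuousOn (iteratedFDerivWithin ℝ i u (closedBall 0 1)) (closedBall 0 1) :=
  hu.continuousOn_iteratedFDerivWithin (by exact_mod_cast hi) uniqueDiffOn_closedBall

/-- Functions that are `C^m` up to the boundary satisfy `BoundaryReg` as soon as the top order
derivatives have the required modulus of continuity: those of lower order are Lipschitz. -/
lemma BoundaryReg.of_closedBall (hu : ContDiffOn ℝ m u (closedBall 0 1)) (hγ : γ < 1)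
    (hm : ∀ ε > 0, ∃ δ > 0, ∀ x ∈ ball (0 : EuclideanSpace ℂ (Fin n)) 1,
      ∀ y ∈ ball (0 : EuclideanSpace ℂ (Fin n)) 1, ‖x - y‖ < δ →
      ‖iteratedFDeriv ℝ m u x - iteratedFDeriv ℝ m u y‖ ≤ ε * ‖x - y‖ ^ γ) :
    BoundaryReg u m γ := by
  have hb : ContDiffOn ℝ m u (ball 0 1) := hu.mono ball_subset_closedBall
  have hbd : ∀ i ≤ m, ∃ C, ∀ x ∈ ball (0 : EuclideanSpace ℂ (Fin n)) 1,
      ‖iteratedFDeriv ℝ i u x‖ ≤ C := by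
    intro i hi
    obtain ⟨C, hC⟩ := (isCompact_closedBall (0 : EuclideanSpace ℂ (Fin n)) 1)
      |>.exists_bound_of_continuousOn (continuousOn_iteratedFDeriv_closedBall hu hi)
    exact ⟨C, fun x hx => iteratedFDeriv_eq_within hu hi hx ▸ hC x (ball_subset_closedBall hx)⟩
  refine ⟨hb, hbd, fun i hi ε hε => ?_⟩
  rcases hi.eq_or_lt with rfl | hi
  · exact hm ε hε
  obtain ⟨C, hC⟩ := hbd (i + 1) hi
  have hC0 : 0 ≤ C := (norm_nonneg _).trans (hC 0 (mem_ball_self one_pos))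
  have hlim : Tendsto (fun r : ℝ => C * r ^ (1 - γ)) (𝓝[>] 0) (𝓝 (C * 0)) :=
    (tendsto_rpow_zero (by linarith)).const_mul C
  rw [mul_zero] at hlim
  obtain ⟨δ, hδ, hsub⟩ := mem_nhdsGT_iff_exists_Ioo_subset.1 (hlim.eventually (gt_mem_nhds hε))
  refine ⟨δ, hδ, fun x hx y hy hxy => ?_⟩
  rcases eq_or_ne x y with rfl | hne
  · simp only [sub_self, norm_zero]
    exact mul_nonneg hε.le (Real.rpow_nonneg le_rfl _)
  have hpos : 0 < ‖x - y‖ := norm_pos_iff.2 (sub_ne_zero.2 hne)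
  have h1 : C * ‖x - y‖ ^ (1 - γ) < ε := hsub ⟨hpos, hxy⟩
  have h2 := (convex_ball (0 : EuclideanSpace ℂ (Fin n)) 1).norm_image_sub_le_of_norm_fderiv_le
    (𝕜 := ℝ) (fun z hz => differentiableAt_iteratedFDeriv_ball hb hi hz)
    (fun z hz => (norm_fderiv_iteratedFDeriv (𝕜 := ℝ) (f := u) (n := i)).trans_le (hC z hz)) hy hx
  calc _ ≤ C * ‖x - y‖ := h2
    _ = C * ‖x - y‖ ^ (1 - γ) * ‖x - y‖ ^ γ := by
        rw [mul_assoc, ← Real.rpow_add hpos, sub_add_cancel, Real.rpow_one]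
    _ ≤ _ := by gcongr

/-- `C^m` up to the boundary: the top order derivatives are uniformly continuous. -/
lemma BoundaryReg.of_contDiffOn (hu : ContDiffOn ℝ m u (closedBall 0 1)) : BoundaryReg u m 0 := by
  refine .of_closedBall hu one_pos fun ε hε => ?_
  have h := (isCompact_closedBall (0 : EuclideanSpace ℂ (Fin n)) 1)
    |>.uniformContinuousOn_of_continuous
    (continuousOn_iteratedFDeriv_closedBall hu le_rfl)
  obtain ⟨δ, hδ, h⟩ := Metric.uniformContinuousOn_iff.1 h ε hε
  refine ⟨δ, hδ, fun x hx y hy hxy => ?_⟩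
  rw [iteratedFDeriv_eq_within hu le_rfl hx, iteratedFDeriv_eq_within hu le_rfl hy, Real.rpow_zero,
    mul_one, ← dist_eq_norm]
  exact (h x (ball_subset_closedBall hx) y (ball_subset_closedBall hy)
    (by rwa [dist_eq_norm])).le

/-- Hölder continuity with an exponent greater than `γ` of the top order derivatives. -/
lemma BoundaryReg.of_isHolderClass {α : ℝ≥0} (hu : IsHolderClass m α u) (hγα : γ < α)
    (hγ : γ < 1) : BoundaryReg u m γ := by
  obtain ⟨hu, C, hC⟩ := hu
  refine .of_closedBall hu hγ fun ε hε => ?_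
  have hlim : Tendsto (fun r : ℝ => (C : ℝ) * r ^ (α - γ)) (𝓝[>] 0) (𝓝 (C * 0)) :=
    (tendsto_rpow_zero (by linarith)).const_mul _
  rw [mul_zero] at hlim
  obtain ⟨δ, hδ, hsub⟩ := mem_nhdsGT_iff_exists_Ioo_subset.1 (hlim.eventually (gt_mem_nhds hε))
  refine ⟨δ, hδ, fun x hx y hy hxy => ?_⟩
  rcases eq_or_ne x y with rfl | hne
  · simp only [sub_self, norm_zero]
    exact mul_nonneg hε.le (Real.rpow_nonneg le_rfl _)
  have hpos : 0 < ‖x - y‖ := norm_pos_iff.2 (sub_ne_zero.2 hne)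
  have h1 : C * ‖x - y‖ ^ (α - γ) < ε := hsub ⟨hpos, hxy⟩
  have h2 := hC.dist_le (ball_subset_closedBall hx) (ball_subset_closedBall hy)
  rw [← iteratedFDeriv_eq_within hu le_rfl hx, ← iteratedFDeriv_eq_within hu le_rfl hy,
    dist_eq_norm, dist_eq_norm] at h2
  calc _ ≤ (C : ℝ) * ‖x - y‖ ^ (α : ℝ) := h2
    _ = C * ‖x - y‖ ^ (α - γ) * ‖x - y‖ ^ γ := by
        rw [mul_assoc, ← Real.rpow_add hpos, sub_add_cancel]
    _ ≤ _ := by gcongr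

end closedBall

/-! ### Conjugation and finite dimension of the spaces of bihomogeneous polynomials -/

section conjugation

variable {n p q : ℕ}

/-- The complex conjugate of a polynomial in `z` and `z̄`, which exchanges `z` and `z̄`. -/
noncomputable def conjPoly (P : ZPoly n) : ZPoly n := rename Sum.swap (map (starRingEnd ℂ) P)

lemma ev_conjPoly (P : ZPoly n) (z : EuclideanSpace ℂ (Fin n)) :
    ev (conjPoly P) z = conj (ev P z) := by
  induction P using MvPolynomial.induction_on with
  | C a => simp [conjPoly, ev]
  | add P Q hP hQ => simp only [conjPoly, map_add, ev_add] at *; rw [hP, hQ]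
  | mul_X P i hP =>
    simp only [conjPoly, map_mul, ev_mul] at *
    rw [hP]
    rcases i with i | i <;> simp [ev]

lemma IsBihom.conjPoly {P : ZPoly n} (hP : IsBihom p q P) : IsBihom q p (conjPoly P) := by
  intro d hd
  obtain ⟨e, rfl, he⟩ := coeff_rename_ne_zero _ _ _ hd
  have h := hP (d := e) (by intro h0; simp [coeff_map, h0] at he)
  have h1 := congrArg Prod.fst h
  have h2 := congrArg Prod.snd h
  rw [IsBihom.weight_fst] at h1
  rw [IsBihom.weight_snd] at h2
  rw [Finsupp.weight_apply, Finsupp.sum_fintype _ _ (by simp), Fintype.sum_sum_type] at h1 h2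
  refine Prod.ext ?_ ?_
  · rw [IsBihom.weight_fst, Finsupp.weight_apply, Finsupp.sum_mapDomain_index (by simp)
      (by simp [add_mul]), Finsupp.sum_fintype _ _ (by simp), Fintype.sum_sum_type]
    simpa [biweight] using h2
  · rw [IsBihom.weight_snd, Finsupp.weight_apply, Finsupp.sum_mapDomain_index (by simp)
      (by simp [add_mul]), Finsupp.sum_fintype _ _ (by simp), Fintype.sum_sum_type]
    simpa [biweight] using h1

instance finite_bihom (n p q : ℕ) :
    FiniteDimensional ℂ (weightedHomogeneousSubmodule ℂ (biweight n) (p, q)) := by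
  have hfg : FiniteDimensional ℂ
      (weightedHomogeneousSubmodule ℂ (fun _ : Fin n ⊕ Fin n => 1) (p + q)) :=
    Module.Finite.iff_fg.2 (weightedHomogeneousSubmodule_fg ℂ _ (fun _ => one_ne_zero) _)
  refine Submodule.finiteDimensional_of_le (S₂ := weightedHomogeneousSubmodule ℂ
    (fun _ : Fin n ⊕ Fin n => 1) (p + q)) fun P hP d hd => ?_
  have h := hP hd
  have h1 := congrArg Prod.fst h
  have h2 := congrArg Prod.snd h
  rw [IsBihom.weight_fst, Finsupp.weight_apply, Finsupp.sum_fintype _ _ (by simp),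
    Fintype.sum_sum_type] at h1
  rw [IsBihom.weight_snd, Finsupp.weight_apply, Finsupp.sum_fintype _ _ (by simp),
    Fintype.sum_sum_type] at h2
  rw [Finsupp.weight_apply, Finsupp.sum_fintype _ _ (by simp), Fintype.sum_sum_type]
  simp [biweight] at h1 h2 ⊢
  rw [h1, h2]

end conjugation

/-! ### Correction by a pluriharmonic polynomial -/

section correction

variable {n m : ℕ} {u : EuclideanSpace ℂ (Fin n) → ℂ}

lemma integrable_moment (hu : ContinuousOn u (ball 0 1)) (P : ZPoly n) {ρ : ℝ}
    (hρ : ρ ∈ Ioo (0 : ℝ) 1) :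
    Integrable (fun ζ : USphere n => u (ρ • (ζ : EuclideanSpace ℂ (Fin n))) * ev P ζ) (surf n) :=
  ((hu.comp_continuous (by fun_prop) fun ζ => smul_mem_ball hρ ζ).mul
    ((continuous_ev P).comp continuous_subtype_val)).integrable_of_hasCompactSupport
      (HasCompactSupport.of_compactSpace _)

lemma moment_add_right (hu : ContinuousOn u (ball 0 1)) (P Q : ZPoly n) {ρ : ℝ}
    (hρ : ρ ∈ Ioo (0 : ℝ) 1) : moment u (P + Q) 0 ρ = moment u P 0 ρ + moment u Q 0 ρ := by
  simp only [moment_zero, ev_add, mul_add]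
  exact integral_add (integrable_moment hu P hρ) (integrable_moment hu Q hρ)

lemma moment_add_left {v : EuclideanSpace ℂ (Fin n) → ℂ} (hu : ContinuousOn u (ball 0 1))
    (hv : ContinuousOn v (ball 0 1)) (P : ZPoly n) {ρ : ℝ} (hρ : ρ ∈ Ioo (0 : ℝ) 1) :
    moment (fun z => u z + v z) P 0 ρ = moment u P 0 ρ + moment v P 0 ρ := by
  simp only [moment_zero, add_mul]
  exact integral_add (integrable_moment hu P hρ) (integrable_moment hv P hρ)

lemma moment_smul_right (c : ℂ) (P : ZPoly n) (ρ : ℝ) :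
    moment u (c • P) 0 ρ = c * moment u P 0 ρ := by
  simp only [moment_zero, ev_smul, ← integral_const_mul]
  exact integral_congr_ae (Eventually.of_forall fun ζ => by ring)

lemma integrable_sphere {f : USphere n → ℂ} (hf : Continuous f) : Integrable f (surf n) :=
  hf.integrable_of_hasCompactSupport (HasCompactSupport.of_compactSpace _)

lemma continuous_ev_sphere (P : ZPoly n) : Continuous fun ζ : USphere n => ev P ζ :=
  (continuous_ev P).comp continuous_subtype_val

/-- The pairing of a polynomial with its conjugate is its squared norm in `L²(S)`. -/
lemma ev_eq_zero_of_integral (P : ZPoly n)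
    (h : ∫ ζ : USphere n, ev (conjPoly P) ζ * ev P ζ ∂(surf n) = 0) (ζ : USphere n) :
    ev P ζ = 0 := by
  by_contra hne
  have hc : Continuous fun ζ : USphere n => ‖ev P ζ‖ ^ 2 := (continuous_ev_sphere P).norm.pow 2
  have hpos := hc.integral_pos_of_hasCompactSupport_nonneg_nonzero (μ := surf n) (x := ζ)
    (HasCompactSupport.of_compactSpace _) (fun _ => by positivity) (by simpa using hne)
  have heq : ∫ ζ : USphere n, ev (conjPoly P) ζ * ev P ζ ∂(surf n) =
      ((∫ ζ : USphere n, ‖ev P ζ‖ ^ 2 ∂(surf n) : ℝ) : ℂ) := by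
    rw [← integral_complex_ofReal]
    refine integral_congr_ae (Eventually.of_forall fun ζ => ?_)
    simp only [ev_conjPoly, Complex.conj_mul']
    push_cast
    rfl
  rw [heq, Complex.ofReal_eq_zero] at h
  exact hpos.ne' h

/-- Riesz representation in the space of polynomials of bidegree `(p, q)` with the pairing of
`L²(S)`. -/
lemma exists_integral_mul_eq (hu : ContinuousOn u (ball 0 1)) (p q : ℕ) {ρ : ℝ}
    (hρ : ρ ∈ Ioo (0 : ℝ) 1) : ∃ U : ZPoly n, IsBihom q p U ∧ ∀ h, IsBihom p q h →
      ∫ ζ : USphere n, ev U ζ * ev h ζ ∂(surf n) = moment u h 0 ρ := by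
  set V := weightedHomogeneousSubmodule ℂ (biweight n) (p, q)
  set V' := weightedHomogeneousSubmodule ℂ (biweight n) (q, p)
  let Λ : Module.Dual ℂ V :=
    { toFun := fun h => moment u h 0 ρ
      map_add' := fun P Q => moment_add_right hu P Q hρ
      map_smul' := fun c P => moment_smul_right c (P : ZPoly n) ρ }
  let B : V' →ₗ[ℂ] Module.Dual ℂ V :=
    LinearMap.mk₂ ℂ (fun U h => ∫ ζ : USphere n, ev (U : ZPoly n) ζ * ev (h : ZPoly n) ζ ∂(surf n))
      (fun U U' h => by
        simp only [Submodule.coe_add, ev_add, add_mul]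
        exact integral_add
          (integrable_sphere ((continuous_ev_sphere _).mul (continuous_ev_sphere _)))
          (integrable_sphere ((continuous_ev_sphere _).mul (continuous_ev_sphere _))))
      (fun c U h => by
        simp only [Submodule.coe_smul, ev_smul, mul_assoc, integral_const_mul, smul_eq_mul])
      (fun U h h' => by
        simp only [Submodule.coe_add, ev_add, mul_add]
        exact integral_add
          (integrable_sphere ((continuous_ev_sphere _).mul (continuous_ev_sphere _)))
          (integrable_sphere ((continuous_ev_sphere _).mul (continuous_ev_sphere _))))
      (fun c U h => by
        simp only [Submodule.coe_smul, ev_smul, mul_left_comm _ c, integral_const_mul, smul_eq_mul])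
  -- In finite dimension it suffices that `Λ` vanishes on the polynomials orthogonal to all `U`.
  -- These vanish on the sphere: take for `U` the conjugate.
  have hmem : Λ ∈ LinearMap.range B := by
    rw [← Subspace.dualCoannihilator_dualAnnihilator_eq (W := LinearMap.range B),
      Submodule.mem_dualAnnihilator]
    intro h hh
    rw [Submodule.mem_dualCoannihilator] at hh
    have h0 := ev_eq_zero_of_integral (h : ZPoly n) (hh _ ⟨⟨conjPoly h, IsBihom.conjPoly h.2⟩, rfl⟩)
    change moment u h 0 ρ = 0
    simp [moment_zero, h0]
  obtain ⟨U, hU⟩ := hmem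
  exact ⟨U, U.2, fun h hh => LinearMap.congr_fun hU ⟨h, hh⟩⟩

lemma pderiv_pderiv_eq_zero {p q : ℕ} (h0 : p = 0 ∨ q = 0) {U : ZPoly n} (hU : IsBihom q p U)
    (j k : Fin n) : pderiv (.inl j) (pderiv (.inr k) U) = 0 := by
  rcases h0 with rfl | rfl
  · rw [hU.pderiv_inr_eq_zero, map_zero]
  · rw [pderiv_pderiv_comm, hU.pderiv_inl_eq_zero, map_zero]

lemma dz_dzbar_ev (P : ZPoly n) (j k : Fin n) (z : EuclideanSpace ℂ (Fin n)) :
    dz j (dzbar k (ev P)) z = ev (pderiv (.inl j) (pderiv (.inr k) P)) z := by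
  rw [show dzbar k (ev P) = ev (pderiv (.inr k) P) from funext fun x => dzbar_ev P x k, dz_ev]

/-- A solution regular up to the boundary agrees, as far as its moments against polynomials of
bidegrees `(p₀ + i, q₀ + i)` are concerned, with a holomorphic or antiholomorphic polynomial, here
`-U`. -/
lemma exists_pluriharmonic_correction (hn : 2 ≤ n) {γ : ℝ} (hu : ContDiffOn ℝ 2 u (ball 0 1))
    (hΔ : ∀ z ∈ ball (0 : EuclideanSpace ℂ (Fin n)) 1, modLaplacian u z = 0)
    (hr : BoundaryReg u m γ) (hγ0 : 0 ≤ γ) (hγ1 : γ < 1) (hγ : γ = ((n : ℝ) + 1) / 2 - m)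
    {p₀ q₀ : ℕ} (h0 : p₀ = 0 ∨ q₀ = 0) : ∃ U : ZPoly n,
      (∀ j k, pderiv (.inl j) (pderiv (.inr k) U) = 0) ∧
      ∀ i P, IsBihom (p₀ + i) (q₀ + i) P → ∀ ρ ∈ Ioo (0 : ℝ) 1,
        moment (fun z => u z + ev U z) P 0 ρ = 0 := by
  have hhalf : (1 / 2 : ℝ) ∈ Ioo (0 : ℝ) 1 := ⟨by norm_num, by norm_num⟩
  have hb : ∃ C, ∀ x ∈ ball (0 : EuclideanSpace ℂ (Fin n)) 1, ‖u x‖ ≤ C := by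
    simpa using hr.bounded 0 (Nat.zero_le _)
  obtain ⟨U, hU, hUh⟩ := exists_integral_mul_eq hu.continuousOn p₀ q₀ hhalf
  -- The moments of `u` against bidegree `(p₀, q₀)` are multiples of `ρ ^ (p₀ + q₀)`, as are those
  -- of `U`, so cancelling them at the radius `1 / 2` cancels them at all radii.
  set U' : ZPoly n := (-2 ^ (p₀ + q₀) : ℂ) • U with hU'
  have hUb : IsBihom q₀ p₀ U' := hU.smul _
  have hder := pderiv_pderiv_eq_zero h0 hUb
  have hUΔ : ∀ z ∈ ball (0 : EuclideanSpace ℂ (Fin n)) 1, modLaplacian (ev U') z = 0 :=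
    fun z _ => by simp [modLaplacian, dz_dzbar_ev, hder]
  have hUc : ContinuousOn (ev U') (ball 0 1) := (continuous_ev U').continuousOn
  refine ⟨U', hder, fun i => ?_⟩
  refine fischer_induction h0 (by omega)
    (fun P => ∀ ρ ∈ Ioo (0 : ℝ) 1, moment (fun z => u z + ev U' z) P 0 ρ = 0) ?_ ?_ ?_ i
  · intro P Q hP hQ ρ hρ
    rw [moment_add_right (u := fun z => u z + ev U' z) (hu.continuousOn.add hUc) P Q hρ, hP ρ hρ,
      hQ ρ hρ, add_zero]
  · intro P hP ρ hρ
    rw [moment_normSq_mul, hP ρ hρ]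
  · intro i h hh hD ρ hρ
    rw [moment_add_left hu.continuousOn hUc h hρ]
    rcases Nat.eq_zero_or_pos i with rfl | hi
    · obtain ⟨K, hK⟩ := moment_eq_mul_pow hn hu hΔ hb hh hD h0
      simp only [add_zero] at hK hh
      have h2 := hUh h hh
      rw [hK _ hhalf] at h2
      have h1 : moment (ev U') h 0 ρ = -(2 ^ (p₀ + q₀) * (ρ : ℂ) ^ (p₀ + q₀)) *
          ∫ ζ : USphere n, ev U ζ * ev h ζ ∂(surf n) := by
        rw [moment_zero, ← integral_const_mul]
        refine integral_congr_ae (Eventually.of_forall fun ζ => ?_)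
        change ev U' (ρ • (ζ : EuclideanSpace ℂ (Fin n))) * _ = _
        rw [hUb.ev_smul, hU', ev_smul]
        ring
      rw [hK ρ hρ, h1, h2]
      push_cast
      have h3 : (2 : ℂ) ^ (p₀ + q₀) * (1 / 2) ^ (p₀ + q₀) = 1 := by
        rw [← mul_pow]; norm_num
      linear_combination (-(ρ : ℂ) ^ (p₀ + q₀) * K) * h3
    · rw [moment_eq_zero hn hu hΔ hr hγ0 hγ1 hγ hh hD (by omega) (by omega) ρ hρ,
        moment_ev_eq_zero hn hUb hUΔ (add_comm q₀ p₀) (by omega) hi hh hD, add_zero]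

end correction

/-! ### Testing against radial multiples of polynomials -/

section testing

variable {n m : ℕ} {u v : EuclideanSpace ℂ (Fin n) → ℂ} {χ : ℝ → ℝ}

/-- Vanishing moments on all spheres, integrated over the radius. -/
lemma IsRadialTest.integral_mul_radialMul_eq_zero (hχ : IsRadialTest χ) (hn : 1 ≤ n)
    (hv : ContinuousOn v (ball 0 1)) {p q : ℕ} {P : ZPoly n} (hP : IsBihom p q P)
    (h0 : ∀ ρ ∈ Ioo (0 : ℝ) 1, moment v P 0 ρ = 0) : ∫ z, v z * radialMul χ P z = 0 := by
  rw [integral_mul_radialMul hn hv hχ hP]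
  refine (setIntegral_congr_fun measurableSet_Ioi (g := fun _ => (0 : ℂ)) fun t ht => ?_).trans
    (by simp)
  have ht : 0 < t := ht
  obtain ⟨a, b, -, -, hb, hs⟩ := hχ.supp
  by_cases hχt : χ t = 0
  · simp [hχt]
  · simp only
    rw [h0 _ ⟨Real.rpow_pos_of_pos ht _, Real.rpow_lt_one ht.le ((hs t hχt).2.trans_lt hb)
      (by norm_num)⟩, mul_zero]

/-- `v Φ` is integrable with integral `0`. -/
def Annihilates (v Φ : EuclideanSpace ℂ (Fin n) → ℂ) : Prop :=
  Integrable (fun z => v z * Φ z) ∧ ∫ z, v z * Φ z = 0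

lemma Annihilates.add {Φ Ψ : EuclideanSpace ℂ (Fin n) → ℂ} (hΦ : Annihilates v Φ)
    (hΨ : Annihilates v Ψ) : Annihilates v fun z => Φ z + Ψ z := by
  refine ⟨?_, ?_⟩
  · simpa only [mul_add] using! hΦ.1.add hΨ.1
  · simp only [mul_add]
    rw [integral_add hΦ.1 hΨ.1, hΦ.2, hΨ.2, add_zero]

lemma Annihilates.const_mul {Φ : EuclideanSpace ℂ (Fin n) → ℂ} (hΦ : Annihilates v Φ) (c : ℂ) :
    Annihilates v fun z => c * Φ z := by
  simp only [Annihilates, mul_left_comm _ c]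
  exact ⟨hΦ.1.const_mul c, by rw [integral_const_mul, hΦ.2, mul_zero]⟩

/-- If the moments of `v` against all polynomials of bidegree `(p, q)` with `p - q = p₀ - q₀`
vanish, then so do those of `∂²v/∂z_j∂z̄_k`: the derivatives can be moved to the test function, where
`∂²/∂z_j∂z̄_k` preserves `p - q`. -/
lemma integral_dz_dzbar_mul_radialMul_eq_zero (hn : 1 ≤ n) (hv : ContDiffOn ℝ 2 v (ball 0 1))
    {p₀ q₀ : ℕ} (h0 : p₀ = 0 ∨ q₀ = 0)
    (hm : ∀ i P, IsBihom (p₀ + i) (q₀ + i) P → ∀ ρ ∈ Ioo (0 : ℝ) 1, moment v P 0 ρ = 0)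
    (hχ : IsRadialTest χ) {i : ℕ} {P : ZPoly n} (hP : IsBihom (p₀ + i) (q₀ + i) P) (j k : Fin n) :
    ∫ z, dz j (dzbar k v) z * radialMul χ P z = 0 := by
  have key : ∀ {η : ℝ → ℝ} (_ : IsRadialTest η) (i : ℕ) {Q : ZPoly n},
      IsBihom (p₀ + i) (q₀ + i) Q → Annihilates v (radialMul η Q) := fun hη i Q hQ =>
    ⟨integrable_mul_of_tsupport hv.continuousOn (contDiff_radialMul hη.smooth Q).continuous
      (hη.tsupport_subset Q),
      hη.integral_mul_radialMul_eq_zero hn hv.continuousOn hQ (hm i Q hQ)⟩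
  rw [integral_dz_dzbar_mul hv (contDiff_radialMul hχ.smooth P) (hχ.tsupport_subset P)]
  set A : ZPoly n := normSqPoly n * (X (.inr j) * P) with hA
  have hAb : IsBihom (p₀ + i + 1) (q₀ + (i + 1) + 1) A := (hP.inr_mul j).normSq_mul
  have hderiv : dzbar k (dz j (radialMul χ P)) = fun z =>
      2 * (2 * radialMul (deriv (deriv χ)) (normSqPoly n * (X (.inl k) * A)) z +
        radialMul (deriv χ) (pderiv (.inr k) A) z) +
      (2 * radialMul (deriv χ) (normSqPoly n * (X (.inl k) * pderiv (.inl j) P)) z +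
        radialMul χ (pderiv (.inr k) (pderiv (.inl j) P)) z) := by
    ext z
    rw [dz_radialMul hχ.differentiable, dzbar_add k
      ((differentiable_radialMul hχ.deriv.differentiable A z).const_mul 2)
      (differentiable_radialMul hχ.differentiable _ z),
      dzbar_mul k (by fun_prop) (differentiable_radialMul hχ.deriv.differentiable A z),
      dzbar_const, dzbar_radialMul hχ.deriv.differentiable, dzbar_radialMul hχ.differentiable]
    ring
  -- Lowering a bidegree with a zero entry gives the zero polynomial, which has every bidegree.
  have h1 : Annihilates v (radialMul (deriv (deriv χ)) (normSqPoly n * (X (.inl k) * A))) :=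
    key hχ.deriv.deriv (i + 3) ((hAb.inl_mul k).normSq_mul)
  have h2 : Annihilates v (radialMul (deriv χ) (pderiv (.inr k) A)) :=
    key hχ.deriv (i + 1) (hAb.pderiv_inr k)
  have h3 : Annihilates v
      (radialMul (deriv χ) (normSqPoly n * (X (.inl k) * pderiv (.inl j) P))) := by
    refine key hχ.deriv (i + 1) ?_
    rcases Nat.eq_zero_or_pos (p₀ + i) with hp | hp
    · rw [hp] at hP
      rw [hP.pderiv_inl_eq_zero, mul_zero, mul_zero]
      exact .zero
    · obtain ⟨p, hp⟩ := Nat.exists_eq_add_of_lt hp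
      rw [zero_add] at hp
      rw [hp] at hP
      have := ((hP.pderiv_inl j).inl_mul k).normSq_mul
      rwa [← hp] at this
  have h4 : Annihilates v (radialMul χ (pderiv (.inr k) (pderiv (.inl j) P))) := by
    rcases i with _ | i
    · rw [pderiv_pderiv_comm, pderiv_pderiv_eq_zero h0.symm hP]
      exact key hχ 0 .zero
    · exact key hχ i ((IsBihom.pderiv_inl (p := p₀ + i) (q := q₀ + i + 1) hP j).pderiv_inr k)
  rw [hderiv]
  exact ((((h1.const_mul 2).add h2).const_mul 2).add ((h3.const_mul 2).add h4)).2

/-- Stone-Weierstrass: polynomials in `z` and `z̄` are dense on the closed ball. -/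
lemma exists_ev_near (f : C(closedBall (0 : EuclideanSpace ℂ (Fin n)) 1, ℂ)) {ε : ℝ} (hε : 0 < ε) :
    ∃ P : ZPoly n, ∀ z, ‖f z - ev P z‖ < ε := by
  let A : StarSubalgebra ℂ C(closedBall (0 : EuclideanSpace ℂ (Fin n)) 1, ℂ) :=
    { carrier := {g | ∃ P : ZPoly n, ∀ z, g z = ev P z}
      mul_mem' := by
        rintro g g' ⟨P, hP⟩ ⟨P', hP'⟩
        exact ⟨P * P', fun z => by simp [hP, hP']⟩
      add_mem' := by
        rintro g g' ⟨P, hP⟩ ⟨P', hP'⟩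
        exact ⟨P + P', fun z => by simp [hP, hP']⟩
      algebraMap_mem' := fun c => ⟨C c, fun z => by simp⟩
      star_mem' := by
        rintro g ⟨P, hP⟩
        exact ⟨conjPoly P, fun z => by simp [hP, ev_conjPoly]⟩ }
  have hsep : A.SeparatesPoints := by
    intro x y hxy
    obtain ⟨j, hj⟩ : ∃ j, (x : EuclideanSpace ℂ (Fin n)) j ≠ (y : EuclideanSpace ℂ (Fin n)) j := by
      by_contra! h
      exact hxy (Subtype.ext (PiLp.ext h))
    refine ⟨_, ⟨⟨fun z => (z : EuclideanSpace ℂ (Fin n)) j, by fun_prop⟩,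
      ⟨X (.inl j), fun z => by simp⟩, rfl⟩, hj⟩
  have : CompactSpace (closedBall (0 : EuclideanSpace ℂ (Fin n)) 1) :=
    isCompact_iff_compactSpace.1 (isCompact_closedBall _ _)
  have htop := ContinuousMap.starSubalgebra_topologicalClosure_eq_top_of_separatesPoints A hsep
  have hf : f ∈ closure (A : Set C(closedBall (0 : EuclideanSpace ℂ (Fin n)) 1, ℂ)) := by
    rw [← StarSubalgebra.topologicalClosure_coe, htop]
    trivial
  obtain ⟨g, ⟨P, hP⟩, hg⟩ := Metric.mem_closure_iff.1 hf ε hε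
  refine ⟨P, fun z => ?_⟩
  rw [← hP, ← dist_eq_norm]
  exact (ContinuousMap.dist_apply_le_dist z).trans_lt hg

/-- Replacing `ḡ` by a polynomial at uniform distance `ε` in `∫ g ḡ`. -/
lemma integral_norm_sq_le_of_integral_mul_ev {g : EuclideanSpace ℂ (Fin n) → ℂ} (hg : Continuous g)
    (hcs : HasCompactSupport g)
    (hs : ∀ z, g z ≠ 0 → z ∈ closedBall (0 : EuclideanSpace ℂ (Fin n)) 1)
    (h0 : ∀ P : ZPoly n, ∫ z, g z * ev P z = 0) {ε : ℝ} (hε : 0 < ε) :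
    ∫ z, ‖g z‖ ^ 2 ≤ ε * ∫ z, ‖g z‖ := by
  obtain ⟨P, hP⟩ := exists_ev_near (n := n) ⟨fun z => conj (g z), by fun_prop⟩ hε
  have hi1 : Integrable fun z => g z * conj (g z) :=
    (hg.mul (Complex.continuous_conj.comp hg)).integrable_of_hasCompactSupport hcs.mul_right
  have hi2 : Integrable fun z => g z * ev P z :=
    (hg.mul (continuous_ev P)).integrable_of_hasCompactSupport hcs.mul_right
  have h1 : ((∫ z, ‖g z‖ ^ 2 : ℝ) : ℂ) = ∫ z, g z * (conj (g z) - ev P z) := by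
    simp only [mul_sub]
    rw [integral_sub hi1 hi2, h0, sub_zero, ← integral_complex_ofReal]
    refine integral_congr_ae (Eventually.of_forall fun z => ?_)
    simp only [Complex.mul_conj']
    push_cast
    rfl
  calc ∫ z, ‖g z‖ ^ 2 ≤ ‖((∫ z, ‖g z‖ ^ 2 : ℝ) : ℂ)‖ := by
        rw [Complex.norm_real]
        exact le_abs_self _
    _ ≤ ∫ z, ε * ‖g z‖ := by
      rw [h1]
      refine norm_integral_le_of_norm_le
        ((hg.norm.integrable_of_hasCompactSupport hcs.norm).const_mul ε)
        (Eventually.of_forall fun z => ?_)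
      rw [norm_mul, mul_comm]
      by_cases hz : g z = 0
      · simp [hz]
      · exact mul_le_mul_of_nonneg_right (hP ⟨z, hs z hz⟩).le (norm_nonneg _)
    _ = ε * ∫ z, ‖g z‖ := integral_const_mul _ _

/-- A continuous function supported in the closed ball and orthogonal to all polynomials in `z` and
`z̄` vanishes. -/
lemma eq_zero_of_integral_mul_ev {g : EuclideanSpace ℂ (Fin n) → ℂ} (hg : Continuous g)
    (hs : ∀ z, g z ≠ 0 → z ∈ closedBall (0 : EuclideanSpace ℂ (Fin n)) 1)
    (h0 : ∀ P : ZPoly n, ∫ z, g z * ev P z = 0) (z : EuclideanSpace ℂ (Fin n)) : g z = 0 := by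
  have hcs : HasCompactSupport g :=
    HasCompactSupport.of_support_subset_isCompact (isCompact_closedBall 0 1) hs
  by_contra hne
  have hc : Continuous fun z => ‖g z‖ ^ 2 := hg.norm.pow 2
  have hcs2 : HasCompactSupport fun z => ‖g z‖ ^ 2 :=
    HasCompactSupport.of_support_subset_isCompact (isCompact_closedBall 0 1) fun x hx =>
      hs x (by simpa using hx)
  have hpos : 0 < ∫ z, ‖g z‖ ^ 2 := hc.integral_pos_of_hasCompactSupport_nonneg_nonzero
    (μ := volume) (x := z) hcs2 (fun _ => by positivity) (by simpa using hne)
  have hle : ∀ ε > 0, ∫ z, ‖g z‖ ^ 2 ≤ ε * ∫ z, ‖g z‖ := fun ε hε =>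
    integral_norm_sq_le_of_integral_mul_ev hg hcs hs h0 hε
  have hN : 0 ≤ ∫ z, ‖g z‖ := integral_nonneg fun _ => norm_nonneg _
  generalize ∫ z, ‖g z‖ ^ 2 = I at hpos hle
  generalize ∫ z, ‖g z‖ = N at hN hle
  have h2 := hle (I / (2 * (N + 1))) (by positivity)
  have h3 : I / (2 * (N + 1)) * N < I := by
    rw [div_mul_eq_mul_div, div_lt_iff₀ (by positivity)]
    nlinarith
  linarith

lemma exists_isRadialTest {t : ℝ} (ht : t ∈ Ioo (0 : ℝ) 1) : ∃ χ, IsRadialTest χ ∧ χ t ≠ 0 := by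
  obtain ⟨r, hr, h1, h2⟩ : ∃ r, 0 < r ∧ 0 < t - r ∧ t + r < 1 :=
    ⟨min t (1 - t) / 2, by have := lt_min ht.1 (sub_pos.2 ht.2); positivity,
      by linarith [min_le_left t (1 - t), ht.1], by linarith [min_le_right t (1 - t), ht.2]⟩
  let f : ContDiffBump t := ⟨r / 2, r, by positivity, by linarith⟩
  refine ⟨f, ⟨f.contDiff, t - r, t + r, h1, by linarith, h2, fun s hs => ?_⟩, ?_⟩
  · have : s ∈ Function.support f := hs
    rw [f.support_eq, Real.ball_eq_Ioo] at this
    exact Ioo_subset_Icc_self this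
  · rw [f.one_of_mem_closedBall (mem_closedBall_self f.rIn_pos.le)]
    exact one_ne_zero

/-- A continuous function on the ball orthogonal to all `χ(|z|⁴) P` vanishes. -/
lemma eq_zero_of_integral_mul_radialMul (hn : 1 ≤ n) {w : EuclideanSpace ℂ (Fin n) → ℂ}
    (hw : ContinuousOn w (ball 0 1))
    (h0 : ∀ χ, IsRadialTest χ → ∀ p q (P : ZPoly n), IsBihom p q P →
      ∫ z, w z * radialMul χ P z = 0) :
    ∀ z ∈ ball (0 : EuclideanSpace ℂ (Fin n)) 1, w z = 0 := by
  have hne : ∀ z ∈ ball (0 : EuclideanSpace ℂ (Fin n)) 1, z ≠ 0 → w z = 0 := by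
    intro z hz hz0
    have hzn : 0 < ‖z‖ := norm_pos_iff.2 hz0
    obtain ⟨χ, hχ, hχz⟩ := exists_isRadialTest (t := ‖z‖ ^ 4)
      ⟨by positivity, pow_lt_one₀ hzn.le (by simpa using hz) (by norm_num)⟩
    have hall : ∀ P : ZPoly n, ∫ z, w z * radialMul χ P z = 0 := by
      intro P
      induction P using MvPolynomial.induction_on' with
      | monomial d a =>
        exact h0 χ hχ (Finsupp.weight (biweight n) d).1 (Finsupp.weight (biweight n) d).2 _
          (isWeightedHomogeneous_monomial _ _ _ rfl)
      | add P Q hP hQ =>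
        have hi : ∀ P : ZPoly n, Integrable fun z => w z * radialMul χ P z := fun P =>
          integrable_mul_of_tsupport hw (contDiff_radialMul hχ.smooth P).continuous
            (hχ.tsupport_subset P)
        have he : ∀ z, w z * radialMul χ (P + Q) z =
            w z * radialMul χ P z + w z * radialMul χ Q z := fun z => by
          simp only [radialMul, ev_add]; ring
        simp only [he]
        rw [integral_add (hi P) (hi Q), hP, hQ, add_zero]
    have hg := eq_zero_of_integral_mul_ev (g := fun z => w z * radialMul χ 1 z)
      (continuous_mul_of_tsupport hw (contDiff_radialMul hχ.smooth 1).continuous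
        (hχ.tsupport_subset 1))
      (fun x hx => ball_subset_closedBall (hχ.tsupport_subset 1
        (subset_tsupport _ (right_ne_zero_of_mul hx))))
      (fun P => by
        rw [← hall P]
        congr 1 with x
        simp [radialMul]
        ring) z
    simpa [radialMul, hχz] using hg
  intro z hz
  rcases ne_or_eq z 0 with hz0 | rfl
  · exact hne z hz hz0
  · -- The test functions vanish near the origin, where `w` vanishes by continuity.
    have : Nonempty (Fin n) := ⟨⟨0, hn⟩⟩
    have hc : Tendsto w (𝓝[≠] 0) (𝓝 (w 0)) :=
      ((hw.continuousAt (isOpen_ball.mem_nhds hz)).tendsto).mono_left nhdsWithin_le_nhds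
    have hz : Tendsto w (𝓝[≠] 0) (𝓝 0) := by
      refine tendsto_const_nhds.congr' ?_
      filter_upwards [self_mem_nhdsWithin, mem_nhdsWithin_of_mem_nhds (isOpen_ball.mem_nhds hz)]
        with x hx hxb using (hne x hxb hx).symm
    exact tendsto_nhds_unique hc hz

end testing

/-! ### Pluriharmonicity -/

section conclusion

variable {n m : ℕ} {u : EuclideanSpace ℂ (Fin n) → ℂ} {γ : ℝ}

lemma dz_dzbar_add_ev (hu : ContDiffOn ℝ 2 u (ball 0 1)) {U : ZPoly n}
    (hU : ∀ j k, pderiv (.inl j) (pderiv (.inr k) U) = 0) (j k : Fin n)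
    {z : EuclideanSpace ℂ (Fin n)} (hz : z ∈ ball (0 : EuclideanSpace ℂ (Fin n)) 1) :
    dz j (dzbar k fun x => u x + ev U x) z = dz j (dzbar k u) z := by
  have hd : ∀ x ∈ ball (0 : EuclideanSpace ℂ (Fin n)) 1, DifferentiableAt ℝ u x := fun x hx =>
    (hu.differentiableOn (by simp)).differentiableAt (isOpen_ball.mem_nhds hx)
  have hev : dzbar k (fun x => u x + ev U x) =ᶠ[𝓝 z]
      fun x => dzbar k u x + dzbar k (ev U) x := by
    filter_upwards [isOpen_ball.mem_nhds hz] with x hx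
    exact dzbar_add k (hd x hx) (differentiableAt_ev U x)
  rw [dz_congr j hev, dz_add, dz_dzbar_ev, hU, ev_zero, add_zero]
  · exact ((contDiffOn_dzbar hu k).differentiableOn (by simp)).differentiableAt
      (isOpen_ball.mem_nhds hz)
  · exact (contDiff_dzbar (contDiff_ev U) k).differentiable (by simp) z

/-- The moments of `∂²u/∂z_j∂z̄_k` vanish for each value of `p - q` separately, and for each value
`u` may be corrected by the pluriharmonic polynomial of `exists_pluriharmonic_correction`, which does
not affect the mixed derivatives. -/
theorem isPluriharmonicOn_of_boundaryReg (hn : 2 ≤ n) (hu : ContDiffOn ℝ 2 u (ball 0 1))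
    (hΔ : ∀ z ∈ ball (0 : EuclideanSpace ℂ (Fin n)) 1, modLaplacian u z = 0)
    (hr : BoundaryReg u m γ) (hγ0 : 0 ≤ γ) (hγ1 : γ < 1) (hγ : γ = ((n : ℝ) + 1) / 2 - m) :
    IsPluriharmonicOn u (ball 0 1) := by
  refine ⟨hu, fun z hz j k => ?_⟩
  refine eq_zero_of_integral_mul_radialMul (by omega) (continuousOn_dz (contDiffOn_dzbar hu k) j)
    (fun χ hχ p q P hP => ?_) z hz
  obtain ⟨p₀, q₀, i, h0, rfl, rfl⟩ : ∃ p₀ q₀ i, (p₀ = 0 ∨ q₀ = 0) ∧ p = p₀ + i ∧ q = q₀ + i :=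
    ⟨p - min p q, q - min p q, min p q, by omega, by omega, by omega⟩
  obtain ⟨U, hU, hm⟩ := exists_pluriharmonic_correction hn hu hΔ hr hγ0 hγ1 hγ h0
  have hv : ContDiffOn ℝ 2 (fun z => u z + ev U z) (ball 0 1) :=
    hu.add (contDiff_infty.1 (contDiff_ev U) 2).contDiffOn
  rw [← integral_dz_dzbar_mul_radialMul_eq_zero (by omega) hv h0 hm hχ hP j k]
  congr 1 with x
  by_cases hx : radialMul χ P x = 0
  · simp [hx]
  · rw [dz_dzbar_add_ev hu hU j k (hχ.tsupport_subset P (subset_tsupport _ hx))]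

/-- In one variable the operator is `(1 - |z|⁴) ∂²/∂z∂z̄`, and no boundary regularity is needed. -/
lemma isPluriharmonicOn_one {u : EuclideanSpace ℂ (Fin 1) → ℂ} (hu : ContDiffOn ℝ 2 u (ball 0 1))
    (hΔ : ∀ z ∈ ball (0 : EuclideanSpace ℂ (Fin 1)) 1, modLaplacian u z = 0) :
    IsPluriharmonicOn u (ball 0 1) := by
  refine ⟨hu, fun z hz j k => ?_⟩
  have h := hΔ z hz
  rw [Subsingleton.elim j 0, Subsingleton.elim k 0]
  have hn : ‖z‖ < 1 := by simpa using hz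
  have hz2 : z 0 * conj (z 0) = ((‖z‖ ^ 2 : ℝ) : ℂ) := by
    rw [Complex.mul_conj', EuclideanSpace.norm_sq_eq]
    simp
  simp only [modLaplacian, Finset.univ_unique, Finset.sum_singleton, Fin.default_eq_zero,
    if_true, mul_assoc, hz2] at h
  refine (mul_eq_zero.1 h).resolve_left ?_
  rw [← Complex.ofReal_mul, ← Complex.ofReal_one, ← Complex.ofReal_sub, Complex.ofReal_eq_zero]
  have : ‖z‖ ^ 2 < 1 := pow_lt_one₀ (norm_nonneg _) hn (by norm_num)
  nlinarith [sq_nonneg ‖z‖]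

end conclusion

theorem theorem1p3 (n : ℕ) (u : EuclideanSpace ℂ (Fin n) → ℂ)
    (hu : ContDiffOn ℝ 2 u (ball 0 1))
    (hΔ : ∀ z ∈ ball (0 : EuclideanSpace ℂ (Fin n)) 1, modLaplacian u z = 0) :
    (Odd n → ContDiffOn ℝ (((n + 1) / 2 : ℕ) : WithTop ℕ∞) u (closedBall 0 1) →
      IsPluriharmonicOn u (ball 0 1)) ∧
    (∀ k : ℕ, n = 2 * k → (∃ α : ℝ≥0, 1 / 2 < α ∧ IsHolderClass k α u) →
      IsPluriharmonicOn u (ball 0 1)) := by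
  refine ⟨?_, ?_⟩
  · rintro ⟨l, hl⟩ hc
    rcases Nat.eq_zero_or_pos l with rfl | hpos
    · obtain rfl : n = 1 := by omega
      exact isPluriharmonicOn_one hu hΔ
    · refine isPluriharmonicOn_of_boundaryReg (by omega) hu hΔ (.of_contDiffOn hc) le_rfl one_pos ?_
      rw [show (n + 1) / 2 = l + 1 by omega, hl]
      push_cast
      ring
  · rintro k hk ⟨α, hα, hc⟩
    rcases Nat.eq_zero_or_pos k with rfl | hpos
    · obtain rfl : n = 0 := by omega
      exact ⟨hu, fun z _ j => j.elim0⟩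
    · have hα' : (1 / 2 : ℝ) < α := by exact_mod_cast hα
      refine isPluriharmonicOn_of_boundaryReg (by omega) hu hΔ
        (.of_isHolderClass (γ := 1 / 2) hc hα' (by norm_num)) (by norm_num) (by norm_num) ?_
      rw [hk]
      push_cast
      ring
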